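/- **Setting (the Nomos calculus).** All potentials, costs, work counters and energies are natural numbers. Channels have a mode: $R$ (purely linear), $S$ (shared), $L$ (linear phase of a shared channel) or $C$ (client linear, i.e. a transaction); every shared channel $c_S$ comes with countably many linear counterparts $c_L$. *Types.* Functional types are $\tau ::= \tau\to_p\tau' \mid \tau+\tau'\mid \tau\times\tau'\mid \mathsf{int}\mid\mathsf{bool}\mid L^q(\tau)\mid \{A_k\leftarrow \overline{A_S};\overline{D}\}_k$, where $p$ is the potential consumed by a call ($\to$ is $\to_0$), $L^q(\tau)$ is the type of lists with $q$ units of potential per element, and the last type (for $k\in\{R,S,C\}$) is that of suspended processes that offer a channel of type $A_k$ and use shared channels of types $\overline{A_S}$ and linear channels of types $\overline D$ (all of mode $R$ if $k\in\{R,S\}$; $\overline{A_S}$ empty if $k=R$). Session types are built from $\oplus\{\ell:A_\ell\}$, $\&\{\ell:A_\ell\}$, $A\otimes B$, $A\multimap B$, $\mathbf 1$ (modes $R$ and $C$), $\tau\times A$, $\tau\to A$, $\triangleright^r A$ (the provider pays $r$), $\triangleleft^r A$ (the client pays $r$), at each of the modes $R,L,C$ ($R$-types exchange $R$-channels only), together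 with $\uparrow\! A_L$ at mode $S$ and $\downarrow\! A_S$ at mode $L$. Types may be recursive: a signature $\Sigma$ has contractive definitions of type names and well-typed definitions of function names, types are equi-recursive, and the grammars, sharing $\tau\curlyvee(\tau_1,\tau_2)$ (which splits the potential of lists; suspended processes are not copied) and the judgment $(A,C)\,\mathsf{esync}$ (every $\downarrow$ reached from $A$ leads back to the shared type $C$) are read coinductively. *Typing.* $\Psi\vdash^q M:\tau$ says that the expression $M$ has type $\tau$ with potential $q$; it consists of the standard rules of linear amortized analysis ($\mathsf{tick}(r)$ costs $r$, a $\mathsf{cons}$ on $L^p(\tau)$ costs $p$ and a match returns $p$, variables are split along $\curlyvee$ and may be dropped, potential may be weakened) and the introduction of suspended processes. $\Psi;\Gamma;\Delta\vdash^q P::(z:C)$ says that the process $P$, with potential $q$, offers $z:C$ and uses the shared channels in $\Gamma$ (structurally) and the linear channels in $\Delta$ (linearly). Its rules are the left and right rules of the session type constructors (with $\triangleright,\triangleleft$ transferring potential, and acquire/accept, release/detach for $\uparrow,\downarrow$), spawning (for shared channels of type $A$ only if $(A,A)\,\mathsf{esync}$), forwarding at modes $R$ and $C$, $\mathsf{work}\{r\}$,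 which consumes $r$, and weakening of potential. In every judgment channels have types of their mode; if $z$ has mode $R$ then $\Gamma=\cdot$ and $\Delta$ has only $R$-channels, and if $z$ has mode $S$ then $\Delta$ has only $R$-channels; $\mathsf{acquire}$ and $\mathsf{release}$ occur only in processes of mode $L$ or $C$. *Dynamics.* $M\Downarrow V\mid\mu$ is the call-by-value evaluation of $M$ to $V$ with cost $\mu$, the sum of the ticks executed. A configuration $\Omega$ is a multiset of objects $\mathsf{proc}(c,w,P)$ and $\mathsf{msg}(c,w,N)$, which provide the channel $c$ and have performed work $w$. $\Omega\mapsto\Omega'$ is the asynchronous multiset rewriting semantics of Nomos: sending creates a message and a fresh continuation channel, the receiver absorbs the message with its work, $\mathsf{work}\{r\}$ adds $r$ to the work counter, evaluating an expression inside a process adds its cost, spawn creates a process with work $0$ at a fresh channel, a forwarding process merges with a message, acquire/accept turns the provider of $c_S$ into the provider of a fresh counterpart $c_L$, and release/detach turns it back. "Fresh" channels neither occur in the configuration nor (for shared channels, up to counterparts) are already in use. *Configuration typing.* $\Gamma_0\vDash^E\Omega::(\Gamma;\Delta)$ is given by: $\Gamma_0\vDash^0(\cdot)::(\cdot;\cdot)$;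 and if $\Gamma_0\vDash^{E}\Omega::(\Gamma;\Delta,\Delta')$ and $\cdot;\Gamma_0;\Delta'\vdash^q P::(c:A)$ (with $\cdot$ instead of $\Gamma_0$ if $c$ has mode $R$), then $\Omega$ extended by $\mathsf{proc}(c,w,P)$ has energy $E+q+w$ and offers $\Gamma;(\Delta,c:A)$ if $c$ has mode $R$ or $C$; $(\Gamma,c:A);\Delta$ if $c$ has mode $S$, $(c:A)\in\Gamma_0$ and $(A,A)\,\mathsf{esync}$; $(\Gamma,c_S:B);(\Delta,c_L:A)$ if $c=c_L$, $(c_S:B)\in\Gamma_0$ and $(A,B)\,\mathsf{esync}$. A message is typed with $\cdot;\cdot;\Delta'\vdash^q N::(c:A)$ as the process that sends and then forwards to or from the continuation (at any linear mode), and offers $\Gamma;(\Delta,c:A)$ with energy $E+q+w$. The configuration is *well-formed* if no two objects provide the same channel, the channels within each of $\Gamma_0$, $\Gamma$, $\Delta$ are unique, and $\Gamma\subseteq\Gamma_0$. Being closed, it has no free variables, only run-time channels. **Theorem (Type preservation).** Let $\Sigma$ be a well-formed signature. 1. If $\cdot\vdash^q M:\tau$ and $M\Downarrow V\mid\mu$,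 then $V$ is a value, $q\ge\mu$ and $\cdot\vdash^{q-\mu}V:\tau$. 2. Let $\Gamma_0\vDash^E\Omega::(\Gamma;\Delta)$ be a closed well-formed and well-typed configuration. - If $\Omega\mapsto\Omega'$, then there are $\Gamma_0'\supseteq\Gamma_0$ and $\Gamma'\supseteq\Gamma$ such that $\Gamma_0'\vDash^E\Omega'::(\Gamma';\Delta)$, with the same energy $E$ and the same $\Delta$, and this configuration is well-formed as well. - Consequently $E$ is a sound upper bound on gas: whenever $\Omega\mapsto^*\Omega'$, the sum of the work counters of all objects in $\Omega'$ is at most $E$. -/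

import Mathlib

namespace Nomos

/-! ## Modes, channels and labels -/

/-- Modes of channels: purely linear (`R`), shared (`S`), the linear phase of a shared
channel (`L`), and client linear, i.e. transactions (`C`). -/
inductive Mode
  | R | S | L | C
  deriving DecidableEq

/-- Run-time channels.  The channels `L a i` (`i = 0, 1, …`) are the linear counterparts of the
shared channel `S a`; this is the mapping between shared channels and their linear
counterparts. -/
inductive Chan
  | R (n : ℕ)
  | C (n : ℕ)
  | S (a : ℕ)
  | L (a i : ℕ)
  deriving DecidableEq

def Chan.mode : Chan → Mode
  | .R _ => .R
  | .C _ => .C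
  | .S _ => .S
  | .L _ _ => .L

/-- `Cont c c'`: the channel `c'` may serve as continuation channel `c⁺` of the linear channel `c`.
It has the mode of `c`, and at mode `L` it belongs to the same shared channel. -/
def Cont : Chan → Chan → Prop
  | .R _, .R _ => True
  | .C _, .C _ => True
  | .L a _, .L b _ => a = b
  | _, _ => False

/-- A reference to a channel inside a process term: a channel variable `x_m` (bound by a binder of
the language), or a run-time channel. -/
inductive Ref
  | var (x : ℕ) (m : Mode)
  | ch (c : Chan)
  deriving DecidableEq

def Ref.mode : Ref → Mode
  | .var _ m => m
  | .ch c => c.mode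

/-- Labels of internal and external choices. -/
abbrev Label := ℕ

/-! ## Types -/

mutual
/-- Functional type expressions. -/
inductive FTy
  /-- a type name defined in the signature -/
  | name (t : ℕ)
  /-- functions whose call consumes constant potential `p`; the plain arrow is `p = 0` -/
  | arrow (p : ℕ) (a b : FTy)
  | sum (a b : FTy)
  | prod (a b : FTy)
  | int
  | bool
  /-- lists that carry `q` units of potential per element -/
  | list (q : ℕ) (a : FTy)
  /-- the contextual monad `{A ← As ; Ds}_k`: computations offering `A` at mode `k ∈ {R, S, C}`,
  using shared channels of types `As` and linear channels of the listed modes and types `Ds` -/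
  | proc (k : Mode) (A : STy) (As : List STy) (Ds : List (Mode × STy))
/-- Session type expressions. -/
inductive STy
  /-- a type name defined in the signature -/
  | name (V : ℕ)
  /-- internal choice `⊕{l : B l}_{l ∈ K}` -/
  | ichoice (K : Finset Label) (B : Label → STy)
  /-- external choice `&{l : B l}_{l ∈ K}` -/
  | echoice (K : Finset Label) (B : Label → STy)
  /-- `A ⊸_n B` -/
  | lolli (n : Mode) (A B : STy)
  /-- `A ⊗_n B` -/
  | tensor (n : Mode) (A B : STy)
  | one
  /-- `τ → A` -/
  | arrow (τ : FTy) (A : STy)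
  /-- `τ × A` -/
  | times (τ : FTy) (A : STy)
  /-- `▷^r A`: the provider pays `r` units of potential -/
  | pay (r : ℕ) (A : STy)
  /-- `◁^r A`: the provider gets `r` units of potential -/
  | get (r : ℕ) (A : STy)
  /-- `↑ A`, from linear to shared -/
  | up (A : STy)
  /-- `↓ A`, from shared to linear -/
  | down (A : STy)
end

/-! ## Terms -/

mutual
/-- Functional expressions. -/
inductive Expr
  | var (x : ℕ)
  /-- a function name defined in the signature -/
  | fn (f : ℕ)
  | lam (x : ℕ) (τ : FTy) (M : Expr)
  | app (M N : Expr)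
  | inl (M : Expr)
  | inr (M : Expr)
  | cases (M : Expr) (x : ℕ) (Ml : Expr) (y : ℕ) (Mr : Expr)
  | pair (M N : Expr)
  | projl (M : Expr)
  | projr (M : Expr)
  | int (n : ℤ)
  | bool (b : Bool)
  | ite (M N₁ N₂ : Expr)
  | nil
  | cons (M N : Expr)
  | mtch (M N₁ : Expr) (x xs : ℕ) (N₂ : Expr)
  /-- `tick(r); M`: incurs cost `r` -/
  | tick (r : ℕ) (M : Expr)
  /-- the monadic value `{x_k ← P ← as ; ds}`; the variable `x_k`, the shared variables `as` and the
  linear variables `ds` (with their modes) are bound in `P`, which has no other free channels -/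
  | proc (k : Mode) (x : ℕ) (as : List ℕ) (ds : List (ℕ × Mode)) (P : Proc)
/-- Process terms. -/
inductive Proc
  /-- `x_k ← M ← as ; ds ; Q`, binding `x_k` in `Q` -/
  | spawn (k : Mode) (x : ℕ) (M : Expr) (as ds : List Ref) (Q : Proc)
  /-- `x ← y` -/
  | fwd (x y : Ref)
  /-- `x.l ; P` -/
  | sendL (x : Ref) (l : Label) (P : Proc)
  /-- `case x (l ⇒ Q l)_{l ∈ K}` -/
  | case (x : Ref) (K : Finset Label) (Q : Label → Proc)
  /-- `send x w ; P` for a channel `w` -/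
  | sendC (x w : Ref) (P : Proc)
  /-- `y_n ← recv x ; P` for a channel, binding `y_n` in `P` -/
  | recvC (x : Ref) (y : ℕ) (n : Mode) (P : Proc)
  /-- `send x M ; P` for a functional value -/
  | sendV (x : Ref) (M : Expr) (P : Proc)
  /-- `y ← recv x ; P` for a functional value, binding the functional variable `y` in `P` -/
  | recvV (x : Ref) (y : ℕ) (P : Proc)
  | close (x : Ref)
  | wait (x : Ref) (P : Proc)
  | work (r : ℕ) (P : Proc)
  | pay (x : Ref) (r : ℕ) (P : Proc)
  | get (x : Ref) (r : ℕ) (P : Proc)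
  /-- `y_L ← acquire x ; P`, binding `y_L` -/
  | acquire (y : ℕ) (x : Ref) (P : Proc)
  /-- `y_L ← accept x ; P`, binding `y_L` -/
  | accept (y : ℕ) (x : Ref) (P : Proc)
  /-- `y_S ← detach x ; P`, binding `y_S` -/
  | detach (y : ℕ) (x : Ref) (P : Proc)
  /-- `y_S ← release x ; P`, binding `y_S` -/
  | release (y : ℕ) (x : Ref) (P : Proc)
end

/-- Substitution `[σ]P` of channels for channels.  It is only used where `σ` moves references to
run-time channels, so that no capture can occur, and it does not enter expressions, since these
have no free channels. -/
def Proc.chsub (σ : Ref → Ref) : Proc → Proc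
  | .spawn k x M as ds Q =>
      .spawn k x M (as.map σ) (ds.map σ) (Q.chsub (Function.update σ (.var x k) (.var x k)))
  | .fwd x y => .fwd (σ x) (σ y)
  | .sendL x l P => .sendL (σ x) l (P.chsub σ)
  | .case x K Q => .case (σ x) K (fun l => (Q l).chsub σ)
  | .sendC x w P => .sendC (σ x) (σ w) (P.chsub σ)
  | .recvC x y n P => .recvC (σ x) y n (P.chsub (Function.update σ (.var y n) (.var y n)))
  | .sendV x M P => .sendV (σ x) M (P.chsub σ)
  | .recvV x y P => .recvV (σ x) y (P.chsub σ)
  | .close x => .close (σ x)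
  | .wait x P => .wait (σ x) (P.chsub σ)
  | .work r P => .work r (P.chsub σ)
  | .pay x r P => .pay (σ x) r (P.chsub σ)
  | .get x r P => .get (σ x) r (P.chsub σ)
  | .acquire y x P => .acquire y (σ x) (P.chsub (Function.update σ (.var y .L) (.var y .L)))
  | .accept y x P => .accept y (σ x) (P.chsub (Function.update σ (.var y .L) (.var y .L)))
  | .detach y x P => .detach y (σ x) (P.chsub (Function.update σ (.var y .S) (.var y .S)))
  | .release y x P => .release y (σ x) (P.chsub (Function.update σ (.var y .S) (.var y .S)))

/-- `[new/old]P` for channels. -/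
def Proc.ren (P : Proc) (old new : Ref) : Proc := P.chsub (Function.update id old new)

/-- The simultaneous substitution given by a list of pairs (old, new). -/
def multi (l : List (Ref × Ref)) (r : Ref) : Ref := (l.lookup r).getD r

mutual
/-- `[V/x]M` for a closed expression `V`. -/
def Expr.vsub (x : ℕ) (V : Expr) : Expr → Expr
  | .var y => if y = x then V else .var y
  | .fn f => .fn f
  | .lam y τ M => .lam y τ (if y = x then M else Expr.vsub x V M)
  | .app M N => .app (Expr.vsub x V M) (Expr.vsub x V N)
  | .inl M => .inl (Expr.vsub x V M)
  | .inr M => .inr (Expr.vsub x V M)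
  | .cases M y Ml z Mr =>
      .cases (Expr.vsub x V M) y (if y = x then Ml else Expr.vsub x V Ml)
        z (if z = x then Mr else Expr.vsub x V Mr)
  | .pair M N => .pair (Expr.vsub x V M) (Expr.vsub x V N)
  | .projl M => .projl (Expr.vsub x V M)
  | .projr M => .projr (Expr.vsub x V M)
  | .int n => .int n
  | .bool b => .bool b
  | .ite M N₁ N₂ => .ite (Expr.vsub x V M) (Expr.vsub x V N₁) (Expr.vsub x V N₂)
  | .nil => .nil
  | .cons M N => .cons (Expr.vsub x V M) (Expr.vsub x V N)
  | .mtch M N₁ y ys N₂ =>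
      .mtch (Expr.vsub x V M) (Expr.vsub x V N₁) y ys (if y = x ∨ ys = x then N₂ else Expr.vsub x V N₂)
  | .tick r M => .tick r (Expr.vsub x V M)
  | .proc k z as ds P => .proc k z as ds (P.vsub x V)
/-- `[V/x]P` for a closed expression `V`. -/
def Proc.vsub (x : ℕ) (V : Expr) : Proc → Proc
  | .spawn k z M as ds Q => .spawn k z (Expr.vsub x V M) as ds (Q.vsub x V)
  | .fwd z y => .fwd z y
  | .sendL z l P => .sendL z l (P.vsub x V)
  | .case z K Q => .case z K (fun l => (Q l).vsub x V)
  | .sendC z w P => .sendC z w (P.vsub x V)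
  | .recvC z y n P => .recvC z y n (P.vsub x V)
  | .sendV z M P => .sendV z (Expr.vsub x V M) (P.vsub x V)
  | .recvV z y P => .recvV z y (if y = x then P else P.vsub x V)
  | .close z => .close z
  | .wait z P => .wait z (P.vsub x V)
  | .work r P => .work r (P.vsub x V)
  | .pay z r P => .pay z r (P.vsub x V)
  | .get z r P => .get z r (P.vsub x V)
  | .acquire y z P => .acquire y z (P.vsub x V)
  | .accept y z P => .accept y z (P.vsub x V)
  | .detach y z P => .detach y z (P.vsub x V)
  | .release y z P => .release y z (P.vsub x V)
end

/-- The run-time channel `c` occurs in a process term. -/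
def Proc.Occ (c : Chan) : Proc → Prop
  | .spawn _ _ _ as ds Q => .ch c ∈ as ∨ .ch c ∈ ds ∨ Q.Occ c
  | .fwd x y => x = .ch c ∨ y = .ch c
  | .sendL x _ P => x = .ch c ∨ P.Occ c
  | .case x K Q => x = .ch c ∨ ∃ l ∈ K, (Q l).Occ c
  | .sendC x w P => x = .ch c ∨ w = .ch c ∨ P.Occ c
  | .recvC x _ _ P => x = .ch c ∨ P.Occ c
  | .sendV x _ P => x = .ch c ∨ P.Occ c
  | .recvV x _ P => x = .ch c ∨ P.Occ c
  | .close x => x = .ch c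
  | .wait x P => x = .ch c ∨ P.Occ c
  | .work _ P => P.Occ c
  | .pay x _ P => x = .ch c ∨ P.Occ c
  | .get x _ P => x = .ch c ∨ P.Occ c
  | .acquire _ x P => x = .ch c ∨ P.Occ c
  | .accept _ x P => x = .ch c ∨ P.Occ c
  | .detach _ x P => x = .ch c ∨ P.Occ c
  | .release _ x P => x = .ch c ∨ P.Occ c

/-! ## Signatures and equi-recursive types -/

/-- A signature: mutually recursive contractive type definitions and function definitions
`f = M : τ` (with the potential `fpot f` needed to evaluate `M`).  Names that are not in use may be
defined arbitrarily. -/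
structure Sig where
  fty : ℕ → FTy
  sty : ℕ → STy
  fty_contractive : ∀ t u, fty t ≠ .name u
  sty_contractive : ∀ V W, sty V ≠ .name W
  fdef : ℕ → Expr
  fpot : ℕ → ℕ
  ftype : ℕ → FTy

/-- Replace a type name by its definition. -/
def Sig.unfoldF (sg : Sig) : FTy → FTy
  | .name t => sg.fty t
  | a => a

/-- Replace a type name by its definition. -/
def Sig.unfoldS (sg : Sig) : STy → STy
  | .name V => sg.sty V
  | A => A

/-- Two functional types have the same head, and components related by `RF` and `RS`. -/
inductive FMatch (RF : FTy → FTy → Prop) (RS : STy → STy → Prop) : FTy → FTy → Prop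
  | arrow {p a a' b b'} : RF a a' → RF b b' → FMatch RF RS (.arrow p a b) (.arrow p a' b')
  | sum {a a' b b'} : RF a a' → RF b b' → FMatch RF RS (.sum a b) (.sum a' b')
  | prod {a a' b b'} : RF a a' → RF b b' → FMatch RF RS (.prod a b) (.prod a' b')
  | int : FMatch RF RS .int .int
  | bool : FMatch RF RS .bool .bool
  | list {q a a'} : RF a a' → FMatch RF RS (.list q a) (.list q a')
  | proc {k A A' As As' Ds Ds'} : RS A A' → List.Forall₂ RS As As' →
      List.Forall₂ (fun d d' => d.1 = d'.1 ∧ RS d.2 d'.2) Ds Ds' →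
      FMatch RF RS (.proc k A As Ds) (.proc k A' As' Ds')

/-- Two session types have the same head, and components related by `RF` and `RS`. -/
inductive SMatch (RF : FTy → FTy → Prop) (RS : STy → STy → Prop) : STy → STy → Prop
  | ichoice {K B B'} : (∀ l ∈ K, RS (B l) (B' l)) → SMatch RF RS (.ichoice K B) (.ichoice K B')
  | echoice {K B B'} : (∀ l ∈ K, RS (B l) (B' l)) → SMatch RF RS (.echoice K B) (.echoice K B')
  | lolli {n A A' B B'} : RS A A' → RS B B' → SMatch RF RS (.lolli n A B) (.lolli n A' B')
  | tensor {n A A' B B'} : RS A A' → RS B B' → SMatch RF RS (.tensor n A B) (.tensor n A' B')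
  | one : SMatch RF RS .one .one
  | arrow {τ τ' A A'} : RF τ τ' → RS A A' → SMatch RF RS (.arrow τ A) (.arrow τ' A')
  | times {τ τ' A A'} : RF τ τ' → RS A A' → SMatch RF RS (.times τ A) (.times τ' A')
  | pay {r A A'} : RS A A' → SMatch RF RS (.pay r A) (.pay r A')
  | get {r A A'} : RS A A' → SMatch RF RS (.get r A) (.get r A')
  | up {A A'} : RS A A' → SMatch RF RS (.up A) (.up A')
  | down {A A'} : RS A A' → SMatch RF RS (.down A) (.down A')

/-- `(RF, RS)` is a bisimulation: related types have matching unfoldings. -/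
def Sig.Bisim (sg : Sig) (RF : FTy → FTy → Prop) (RS : STy → STy → Prop) : Prop :=
  (∀ a b, RF a b → FMatch RF RS (sg.unfoldF a) (sg.unfoldF b)) ∧
  (∀ A B, RS A B → SMatch RF RS (sg.unfoldS A) (sg.unfoldS B))

/-- Equi-recursive (coinductive) equality of functional types. -/
def Sig.FEq (sg : Sig) (a b : FTy) : Prop := ∃ RF RS, sg.Bisim RF RS ∧ RF a b

/-- Equi-recursive (coinductive) equality of session types. -/
def Sig.SEq (sg : Sig) (A B : STy) : Prop := ∃ RF RS, sg.Bisim RF RS ∧ RS A B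

theorem Sig.bisim_eq (sg : Sig) : sg.Bisim Eq Eq := by
  constructor
  · rintro a _ rfl
    have h : ∀ t, sg.unfoldF a ≠ .name t := by
      intro t
      cases a <;> simp [Sig.unfoldF, sg.fty_contractive]
    revert h
    cases sg.unfoldF a with
    | name t => intro h; exact absurd rfl (h t)
    | arrow p a b => intro _; exact .arrow rfl rfl
    | sum a b => intro _; exact .sum rfl rfl
    | prod a b => intro _; exact .prod rfl rfl
    | int => intro _; exact .int
    | bool => intro _; exact .bool
    | list q a => intro _; exact .list rfl
    | proc k A As Ds =>
      intro _
      exact .proc rfl (List.forall₂_same.2 fun _ _ => rfl)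
        (List.forall₂_same.2 fun _ _ => ⟨rfl, rfl⟩)
  · rintro A _ rfl
    have h : ∀ V, sg.unfoldS A ≠ .name V := by
      intro V
      cases A <;> simp [Sig.unfoldS, sg.sty_contractive]
    revert h
    cases sg.unfoldS A with
    | name V => intro h; exact absurd rfl (h V)
    | ichoice K B => intro _; exact .ichoice fun _ _ => rfl
    | echoice K B => intro _; exact .echoice fun _ _ => rfl
    | lolli n A B => intro _; exact .lolli rfl rfl
    | tensor n A B => intro _; exact .tensor rfl rfl
    | one => intro _; exact .one
    | arrow τ A => intro _; exact .arrow rfl rfl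
    | times τ A => intro _; exact .times rfl rfl
    | pay r A => intro _; exact .pay rfl
    | get r A => intro _; exact .get rfl
    | up A => intro _; exact .up rfl
    | down A => intro _; exact .down rfl

theorem Sig.Bisim.symm {sg : Sig} {RF RS} (h : sg.Bisim RF RS) :
    sg.Bisim (fun a b => RF b a) (fun A B => RS B A) := by
  constructor
  · intro a b hab
    have h' := h.1 b a hab
    revert h'
    generalize sg.unfoldF a = u
    generalize sg.unfoldF b = v
    intro h'
    cases h' with
    | arrow h₁ h₂ => exact .arrow h₁ h₂
    | sum h₁ h₂ => exact .sum h₁ h₂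
    | prod h₁ h₂ => exact .prod h₁ h₂
    | int => exact .int
    | bool => exact .bool
    | list h₁ => exact .list h₁
    | proc h₁ h₂ h₃ =>
      exact .proc h₁ (List.forall₂_iff_get.2 ⟨h₂.length_eq.symm, fun i h₄ h₅ => h₂.get h₅ h₄⟩)
        (List.forall₂_iff_get.2 ⟨h₃.length_eq.symm, fun i h₄ h₅ =>
          ⟨(h₃.get h₅ h₄).1.symm, (h₃.get h₅ h₄).2⟩⟩)
  · intro A B hAB
    have h' := h.2 B A hAB
    revert h'
    generalize sg.unfoldS A = u
    generalize sg.unfoldS B = v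
    intro h'
    cases h' with
    | ichoice h₁ => exact .ichoice h₁
    | echoice h₁ => exact .echoice h₁
    | lolli h₁ h₂ => exact .lolli h₁ h₂
    | tensor h₁ h₂ => exact .tensor h₁ h₂
    | one => exact .one
    | arrow h₁ h₂ => exact .arrow h₁ h₂
    | times h₁ h₂ => exact .times h₁ h₂
    | pay h₁ => exact .pay h₁
    | get h₁ => exact .get h₁
    | up h₁ => exact .up h₁
    | down h₁ => exact .down h₁

theorem Sig.Bisim.comp {sg : Sig} {RF RS RF' RS'} (h : sg.Bisim RF RS) (h' : sg.Bisim RF' RS') :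
    sg.Bisim (Relation.Comp RF RF') (Relation.Comp RS RS') := by
  constructor
  · rintro a c ⟨b, hab, hbc⟩
    have h₁ := h.1 a b hab
    have h₂ := h'.1 b c hbc
    revert h₁ h₂
    generalize sg.unfoldF a = u
    generalize sg.unfoldF b = v
    generalize sg.unfoldF c = w
    intro h₁ h₂
    cases h₁ with
    | arrow x y => cases h₂ with | arrow x' y' => exact .arrow ⟨_, x, x'⟩ ⟨_, y, y'⟩
    | sum x y => cases h₂ with | sum x' y' => exact .sum ⟨_, x, x'⟩ ⟨_, y, y'⟩
    | prod x y => cases h₂ with | prod x' y' => exact .prod ⟨_, x, x'⟩ ⟨_, y, y'⟩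
    | int => cases h₂; exact .int
    | bool => cases h₂; exact .bool
    | list x => cases h₂ with | list x' => exact .list ⟨_, x, x'⟩
    | proc x y z =>
      cases h₂ with
      | proc x' y' z' =>
        refine .proc ⟨_, x, x'⟩
          (List.forall₂_iff_get.2 ⟨y.length_eq.trans y'.length_eq, fun i h₄ h₅ => ?_⟩)
          (List.forall₂_iff_get.2 ⟨z.length_eq.trans z'.length_eq, fun i h₄ h₅ => ?_⟩)
        · exact ⟨_, y.get h₄ (y.length_eq ▸ h₄), y'.get (y.length_eq ▸ h₄) h₅⟩
        · exact ⟨(z.get h₄ (z.length_eq ▸ h₄)).1.trans (z'.get (z.length_eq ▸ h₄) h₅).1,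
            _, (z.get h₄ (z.length_eq ▸ h₄)).2, (z'.get (z.length_eq ▸ h₄) h₅).2⟩
  · rintro A C ⟨B, hab, hbc⟩
    have h₁ := h.2 A B hab
    have h₂ := h'.2 B C hbc
    revert h₁ h₂
    generalize sg.unfoldS A = u
    generalize sg.unfoldS B = v
    generalize sg.unfoldS C = w
    intro h₁ h₂
    cases h₁ with
    | ichoice x => cases h₂ with | ichoice x' => exact .ichoice fun l hl => ⟨_, x l hl, x' l hl⟩
    | echoice x => cases h₂ with | echoice x' => exact .echoice fun l hl => ⟨_, x l hl, x' l hl⟩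
    | lolli x y => cases h₂ with | lolli x' y' => exact .lolli ⟨_, x, x'⟩ ⟨_, y, y'⟩
    | tensor x y => cases h₂ with | tensor x' y' => exact .tensor ⟨_, x, x'⟩ ⟨_, y, y'⟩
    | one => cases h₂; exact .one
    | arrow x y => cases h₂ with | arrow x' y' => exact .arrow ⟨_, x, x'⟩ ⟨_, y, y'⟩
    | times x y => cases h₂ with | times x' y' => exact .times ⟨_, x, x'⟩ ⟨_, y, y'⟩
    | pay x => cases h₂ with | pay x' => exact .pay ⟨_, x, x'⟩
    | get x => cases h₂ with | get x' => exact .get ⟨_, x, x'⟩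
    | up x => cases h₂ with | up x' => exact .up ⟨_, x, x'⟩
    | down x => cases h₂ with | down x' => exact .down ⟨_, x, x'⟩

abbrev Sig.fSetoid (sg : Sig) : Setoid FTy where
  r := sg.FEq
  iseqv :=
    { refl := fun _ => ⟨Eq, Eq, sg.bisim_eq, rfl⟩
      symm := fun ⟨_, _, h, hab⟩ => ⟨_, _, h.symm, hab⟩
      trans := fun ⟨_, _, h, hab⟩ ⟨_, _, h', hbc⟩ => ⟨_, _, h.comp h', _, hab, hbc⟩ }

abbrev Sig.sSetoid (sg : Sig) : Setoid STy where
  r := sg.SEq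
  iseqv :=
    { refl := fun _ => ⟨Eq, Eq, sg.bisim_eq, rfl⟩
      symm := fun ⟨_, _, h, hab⟩ => ⟨_, _, h.symm, hab⟩
      trans := fun ⟨_, _, h, hab⟩ ⟨_, _, h', hbc⟩ => ⟨_, _, h.comp h', _, hab, hbc⟩ }

/-- Functional types over the signature: type expressions up to equi-recursive equality. -/
def FType (sg : Sig) : Type := Quotient sg.fSetoid

/-- Session types over the signature: type expressions up to equi-recursive equality. -/
def SType (sg : Sig) : Type := Quotient sg.sSetoid

def FType.mk (sg : Sig) (a : FTy) : FType sg := Quotient.mk sg.fSetoid a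
def SType.mk (sg : Sig) (A : STy) : SType sg := Quotient.mk sg.sSetoid A
noncomputable def FType.rep {sg : Sig} (a : FType sg) : FTy := Quotient.out a
noncomputable def SType.rep {sg : Sig} (A : SType sg) : STy := Quotient.out A

/-! The type constructors on types up to equality. -/

noncomputable def FType.arrow {sg : Sig} (p : ℕ) (a b : FType sg) : FType sg :=
  .mk sg (.arrow p a.rep b.rep)
noncomputable def FType.sum {sg : Sig} (a b : FType sg) : FType sg := .mk sg (.sum a.rep b.rep)
noncomputable def FType.prod {sg : Sig} (a b : FType sg) : FType sg := .mk sg (.prod a.rep b.rep)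
def FType.int {sg : Sig} : FType sg := .mk sg .int
def FType.bool {sg : Sig} : FType sg := .mk sg .bool
noncomputable def FType.list {sg : Sig} (q : ℕ) (a : FType sg) : FType sg := .mk sg (.list q a.rep)
noncomputable def FType.proc {sg : Sig} (k : Mode) (A : SType sg) (As : List (SType sg))
    (Ds : List (Mode × SType sg)) : FType sg :=
  .mk sg (.proc k A.rep (As.map SType.rep) (Ds.map fun d => (d.1, d.2.rep)))

noncomputable def SType.ichoice {sg : Sig} (K : Finset Label) (B : Label → SType sg) : SType sg :=
  .mk sg (.ichoice K fun l => (B l).rep)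
noncomputable def SType.echoice {sg : Sig} (K : Finset Label) (B : Label → SType sg) : SType sg :=
  .mk sg (.echoice K fun l => (B l).rep)
noncomputable def SType.lolli {sg : Sig} (n : Mode) (A B : SType sg) : SType sg :=
  .mk sg (.lolli n A.rep B.rep)
noncomputable def SType.tensor {sg : Sig} (n : Mode) (A B : SType sg) : SType sg :=
  .mk sg (.tensor n A.rep B.rep)
def SType.one {sg : Sig} : SType sg := .mk sg .one
noncomputable def SType.arrow {sg : Sig} (τ : FType sg) (A : SType sg) : SType sg :=
  .mk sg (.arrow τ.rep A.rep)
noncomputable def SType.times {sg : Sig} (τ : FType sg) (A : SType sg) : SType sg :=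
  .mk sg (.times τ.rep A.rep)
noncomputable def SType.pay {sg : Sig} (r : ℕ) (A : SType sg) : SType sg := .mk sg (.pay r A.rep)
noncomputable def SType.get {sg : Sig} (r : ℕ) (A : SType sg) : SType sg := .mk sg (.get r A.rep)
noncomputable def SType.up {sg : Sig} (A : SType sg) : SType sg := .mk sg (.up A.rep)
noncomputable def SType.down {sg : Sig} (A : SType sg) : SType sg := .mk sg (.down A.rep)

/-! ## The type grammars, equi-synchronizing types, sharing of potential -/

/-- One step of the grammar of session types at each mode.  Purely linear types exchange purely
linear channels only. -/
inductive LangStep {sg : Sig} (F : FType sg → Prop) (G : Mode → SType sg → Prop) :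
    Mode → SType sg → Prop
  | ichoice {m K B} : m ≠ .S → (∀ l ∈ K, G m (B l)) → LangStep F G m (.ichoice K B)
  | echoice {m K B} : m ≠ .S → (∀ l ∈ K, G m (B l)) → LangStep F G m (.echoice K B)
  | lolli {m n A B} : m ≠ .S → n ≠ .S → (m = .R → n = .R) → G n A → G m B →
      LangStep F G m (.lolli n A B)
  | tensor {m n A B} : m ≠ .S → n ≠ .S → (m = .R → n = .R) → G n A → G m B →
      LangStep F G m (.tensor n A B)
  | one {m} : m = .R ∨ m = .C → LangStep F G m .one
  | arrow {m τ A} : m ≠ .S → F τ → G m A → LangStep F G m (.arrow τ A)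
  | times {m τ A} : m ≠ .S → F τ → G m A → LangStep F G m (.times τ A)
  | pay {m r A} : m ≠ .S → G m A → LangStep F G m (.pay r A)
  | get {m r A} : m ≠ .S → G m A → LangStep F G m (.get r A)
  | up {A} : G .L A → LangStep F G .S (.up A)
  | down {A} : G .S A → LangStep F G .L (.down A)

/-- One step of the grammar of functional types. -/
inductive FLangStep {sg : Sig} (F : FType sg → Prop) (G : Mode → SType sg → Prop) :
    FType sg → Prop
  | arrow {p a b} : F a → F b → FLangStep F G (.arrow p a b)
  | sum {a b} : F a → F b → FLangStep F G (.sum a b)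
  | prod {a b} : F a → F b → FLangStep F G (.prod a b)
  | int : FLangStep F G .int
  | bool : FLangStep F G .bool
  | list {q a} : F a → FLangStep F G (.list q a)
  | procR {A Ds} : G .R A → (∀ d ∈ Ds, d.1 = Mode.R ∧ G .R d.2) → FLangStep F G (.proc .R A [] Ds)
  | procS {A As Ds} : G .S A → (∀ B ∈ As, G .S B) → (∀ d ∈ Ds, d.1 = Mode.R ∧ G .R d.2) →
      FLangStep F G (.proc .S A As Ds)
  | procC {A As Ds} : G .C A → (∀ B ∈ As, G .S B) → (∀ d ∈ Ds, d.1 ≠ Mode.S ∧ G d.1 d.2) →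
      FLangStep F G (.proc .C A As Ds)

/-- `A` belongs to the language of session types at mode `m` (read coinductively, since types may
be recursive). -/
def Lang {sg : Sig} (m : Mode) (A : SType sg) : Prop :=
  ∃ (F : FType sg → Prop) (G : Mode → SType sg → Prop),
    (∀ a, F a → FLangStep F G a) ∧ (∀ k B, G k B → LangStep F G k B) ∧ G m A

/-- One step of the rules for equi-synchronizing types. -/
inductive ESyncStep {sg : Sig} (E : SType sg → SType sg → Prop) : SType sg → SType sg → Prop
  | ichoice {K B C} : (∀ l ∈ K, E (B l) C) → ESyncStep E (.ichoice K B) C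
  | echoice {K B C} : (∀ l ∈ K, E (B l) C) → ESyncStep E (.echoice K B) C
  | tensor {n A B C} : E B C → ESyncStep E (.tensor n A B) C
  | lolli {n A B C} : E B C → ESyncStep E (.lolli n A B) C
  | times {τ B C} : E B C → ESyncStep E (.times τ B) C
  | arrow {τ B C} : E B C → ESyncStep E (.arrow τ B) C
  | pay {r A C} : E A C → ESyncStep E (.pay r A) C
  | get {r A C} : E A C → ESyncStep E (.get r A) C
  | up {A} : E A (.up A) → ESyncStep E (.up A) (.up A)
  | down {A} : E A A → ESyncStep E (.down A) A

/-- `(A, C) esync`, read coinductively. -/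
def ESync {sg : Sig} (A C : SType sg) : Prop :=
  ∃ E : SType sg → SType sg → Prop, (∀ X Y, E X Y → ESyncStep E X Y) ∧ E A C

/-- One step of the sharing relation: base types are copied, potential is split.  A suspended
computation of monadic type may hold potential that cannot be split, so that it is not copied. -/
inductive ShareStep {sg : Sig} (H : FType sg → FType sg → FType sg → Prop) :
    FType sg → FType sg → FType sg → Prop
  | int : ShareStep H .int .int .int
  | bool : ShareStep H .bool .bool .bool
  | arrow {p a b} : ShareStep H (.arrow p a b) (.arrow p a b) (.arrow p a b)
  | sum {a a₁ a₂ b b₁ b₂} : H a a₁ a₂ → H b b₁ b₂ →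
      ShareStep H (.sum a b) (.sum a₁ b₁) (.sum a₂ b₂)
  | prod {a a₁ a₂ b b₁ b₂} : H a a₁ a₂ → H b b₁ b₂ →
      ShareStep H (.prod a b) (.prod a₁ b₁) (.prod a₂ b₂)
  | list {q₁ q₂ a a₁ a₂} : H a a₁ a₂ →
      ShareStep H (.list (q₁ + q₂) a) (.list q₁ a₁) (.list q₂ a₂)

/-- The sharing relation `τ ⋎ (τ₁, τ₂)` on functional types, read coinductively. -/
def Share {sg : Sig} (τ τ₁ τ₂ : FType sg) : Prop :=
  ∃ H : FType sg → FType sg → FType sg → Prop,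
    (∀ a b c, H a b c → ShareStep H a b c) ∧ H τ τ₁ τ₂

/-! ## Contexts -/

/-- Functional contexts `Ψ`. -/
abbrev FCtx (sg : Sig) := ℕ → Option (FType sg)

/-- Contexts of channels, used both for `Γ` (shared) and `Δ` (linear). -/
abbrev Ctx (sg : Sig) := Multiset (Ref × SType sg)

/-- The empty functional context. -/
def FCtx.empty {sg : Sig} : FCtx sg := fun _ => none

/-- `Ψ, (x : τ)`; a later binding shadows an earlier one. -/
def FCtx.ext {sg : Sig} (Ψ : FCtx sg) (x : ℕ) (τ : FType sg) : FCtx sg :=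
  Function.update Ψ x (some τ)

/-- A variable is shared between two contexts, or goes to one of them, or is dropped. -/
inductive OptShare {sg : Sig} :
    Option (FType sg) → Option (FType sg) → Option (FType sg) → Prop
  | none : OptShare .none .none .none
  | both {τ τ₁ τ₂} : Share τ τ₁ τ₂ → OptShare (some τ) (some τ₁) (some τ₂)
  | left {τ} : OptShare (some τ) (some τ) .none
  | right {τ} : OptShare (some τ) .none (some τ)
  | drop {τ} : OptShare (some τ) .none .none

/-- `Ψ ⋎ (Ψ₁, Ψ₂)`. -/
def FCtx.Split {sg : Sig} (Ψ Ψ₁ Ψ₂ : FCtx sg) : Prop := ∀ x, OptShare (Ψ x) (Ψ₁ x) (Ψ₂ x)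

/-- Every variable in `Ψ` may be copied without splitting potential. -/
def FCtx.Free {sg : Sig} (Ψ : FCtx sg) : Prop := ∀ x τ, Ψ x = some τ → Share τ τ τ

/-- `Ψ₀` is obtained from `Ψ` by dropping variables. -/
def FCtx.Sub {sg : Sig} (Ψ₀ Ψ : FCtx sg) : Prop := ∀ x, Ψ₀ x = none ∨ Ψ₀ x = Ψ x

/-- `Δ purelin`. -/
def Purelin {sg : Sig} (Δ : Ctx sg) : Prop := ∀ e ∈ Δ, e.1.mode = .R

/-- The invariants on the judgment `Ψ ; Γ ; Δ ⊢ P :: (z : C)`: the channels in the contexts and the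
offered channel have types in the grammar of their mode, and
* at mode `R`, the shared context is empty and the linear context is purely linear;
* at mode `S`, the linear context is purely linear. -/
structure Inv {sg : Sig} (Γ Δ : Ctx sg) (z : Ref) (C : SType sg) : Prop where
  shared : ∀ e ∈ Γ, e.1.mode = .S ∧ Lang .S e.2
  linear : ∀ e ∈ Δ, e.1.mode ≠ .S ∧ Lang e.1.mode e.2
  offer : Lang z.mode C
  modeR : z.mode = .R → Γ = 0 ∧ Purelin Δ
  modeS : z.mode = .S → Purelin Δ

/-- The bound variable `y` differs from all channels of the judgment. -/
def New {sg : Sig} (y : Ref) (Γ Δ : Ctx sg) (z : Ref) : Prop :=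
  (∀ e ∈ Γ, e.1 ≠ y) ∧ (∀ e ∈ Δ, e.1 ≠ y) ∧ z ≠ y

/-! ## Typing -/

mutual
/-- Expression typing `Ψ ⊢^q M : τ`. -/
inductive ETy (sg : Sig) : FCtx sg → ℕ → Expr → FType sg → Prop
  | relax {Ψ q q' M τ} : q ≤ q' → ETy sg Ψ q M τ → ETy sg Ψ q' M τ
  | var {Ψ x τ} : Ψ x = some τ → ETy sg Ψ 0 (.var x) τ
  | fn {Ψ f} : ETy sg Ψ (sg.fpot f) (.fn f) (.mk sg (sg.ftype f))
  | lam {Ψ Ψ₀ p x τ M σ} : FCtx.Sub Ψ₀ Ψ → FCtx.Free Ψ₀ →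
      ETy sg (Ψ₀.ext x (.mk sg τ)) p M σ →
      ETy sg Ψ 0 (.lam x τ M) (.arrow p (.mk sg τ) σ)
  | app {Ψ Ψ₁ Ψ₂ p q₁ q₂ M N τ σ} : FCtx.Split Ψ Ψ₁ Ψ₂ →
      ETy sg Ψ₁ q₁ M (.arrow p τ σ) → ETy sg Ψ₂ q₂ N τ →
      ETy sg Ψ (q₁ + q₂ + p) (.app M N) σ
  | inl {Ψ q M τ σ} : ETy sg Ψ q M τ → ETy sg Ψ q (.inl M) (.sum τ σ)
  | inr {Ψ q M τ σ} : ETy sg Ψ q M σ → ETy sg Ψ q (.inr M) (.sum τ σ)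
  | cases {Ψ Ψ₁ Ψ₂ q₁ q₂ M x Ml y Mr τ₁ τ₂ σ} : FCtx.Split Ψ Ψ₁ Ψ₂ →
      ETy sg Ψ₁ q₁ M (.sum τ₁ τ₂) →
      ETy sg (Ψ₂.ext x τ₁) q₂ Ml σ → ETy sg (Ψ₂.ext y τ₂) q₂ Mr σ →
      ETy sg Ψ (q₁ + q₂) (.cases M x Ml y Mr) σ
  | pair {Ψ Ψ₁ Ψ₂ q₁ q₂ M N τ σ} : FCtx.Split Ψ Ψ₁ Ψ₂ →
      ETy sg Ψ₁ q₁ M τ → ETy sg Ψ₂ q₂ N σ → ETy sg Ψ (q₁ + q₂) (.pair M N) (.prod τ σ)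
  | projl {Ψ q M τ σ} : ETy sg Ψ q M (.prod τ σ) → ETy sg Ψ q (.projl M) τ
  | projr {Ψ q M τ σ} : ETy sg Ψ q M (.prod τ σ) → ETy sg Ψ q (.projr M) σ
  | int {Ψ n} : ETy sg Ψ 0 (.int n) .int
  | bool {Ψ b} : ETy sg Ψ 0 (.bool b) .bool
  | ite {Ψ Ψ₁ Ψ₂ q₁ q₂ M N₁ N₂ τ} : FCtx.Split Ψ Ψ₁ Ψ₂ →
      ETy sg Ψ₁ q₁ M .bool → ETy sg Ψ₂ q₂ N₁ τ → ETy sg Ψ₂ q₂ N₂ τ →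
      ETy sg Ψ (q₁ + q₂) (.ite M N₁ N₂) τ
  | nil {Ψ p τ} : ETy sg Ψ 0 .nil (.list p τ)
  | cons {Ψ Ψ₁ Ψ₂ p q₁ q₂ M N τ} : FCtx.Split Ψ Ψ₁ Ψ₂ →
      ETy sg Ψ₁ q₁ M τ → ETy sg Ψ₂ q₂ N (.list p τ) →
      ETy sg Ψ (q₁ + q₂ + p) (.cons M N) (.list p τ)
  | mtch {Ψ Ψ₁ Ψ₂ p q₁ q₂ M N₁ x xs N₂ τ σ} : FCtx.Split Ψ Ψ₁ Ψ₂ →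
      ETy sg Ψ₁ q₁ M (.list p τ) → ETy sg Ψ₂ q₂ N₁ σ →
      ETy sg ((Ψ₂.ext x τ).ext xs (.list p τ)) (q₂ + p) N₂ σ →
      ETy sg Ψ (q₁ + q₂) (.mtch M N₁ x xs N₂) σ
  | tick {Ψ q r M τ} : ETy sg Ψ q M τ → ETy sg Ψ (q + r) (.tick r M) τ
  /-- `{} I_R`, `{} I_S` and `{} I_C`; the invariants on the premise give the side conditions of
  each mode. -/
  | proc {Ψ q k x as ds P A As Ds} : k ≠ .L → as.length = As.length →
      ds.map Prod.snd = Ds.map Prod.fst →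
      (Ref.var x k :: (as.map (Ref.var · .S) ++ ds.map fun d => Ref.var d.1 d.2)).Nodup →
      PTy sg Ψ ((as.map (Ref.var · .S)).zip As) ((ds.map fun d => Ref.var d.1 d.2).zip
        (Ds.map Prod.snd)) q P (.var x k) A →
      ETy sg Ψ q (.proc k x as ds P) (.proc k A As Ds)
/-- Process typing `Ψ ; Γ ; Δ ⊢^q P :: (z : C)`.  Shared contexts are structural, so that a channel
need not be removed from `Γ` when it is acquired. -/
inductive PTy (sg : Sig) :
    FCtx sg → Ctx sg → Ctx sg → ℕ → Proc → Ref → SType sg → Prop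
  /-- weakening of potential -/
  | relax {Ψ Γ Δ q q' P z C} : q ≤ q' → PTy sg Ψ Γ Δ q P z C → PTy sg Ψ Γ Δ q' P z C
  /-- `{} E_{R m}`, `m ∈ {R, S, L, C}` -/
  | spawnR {Ψ Ψ₁ Ψ₂ Γ Δ p q x M ds Q A Ds z C} :
      Inv Γ (((ds.zip (Ds.map Prod.snd) : List _) : Ctx sg) + Δ) z C →
      (∀ d ∈ Ds, d.1 = Mode.R) → ds.map Ref.mode = Ds.map Prod.fst →
      FCtx.Split Ψ Ψ₁ Ψ₂ → New (.var x .R) Γ Δ z →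
      ETy sg Ψ₁ p M (.proc .R A [] Ds) →
      PTy sg Ψ₂ Γ ((.var x .R, A) ::ₘ Δ) q Q z C →
      PTy sg Ψ Γ (((ds.zip (Ds.map Prod.snd) : List _) : Ctx sg) + Δ) (p + q)
        (.spawn .R x M [] ds Q) z C
  /-- `{} E_{S m}`, `m ∈ {S, L, C}` -/
  | spawnS {Ψ Ψ₁ Ψ₂ Γ Δ p q x M as ds Q A As Ds z C} :
      Inv Γ (((ds.zip (Ds.map Prod.snd) : List _) : Ctx sg) + Δ) z C →
      z.mode ≠ .R → List.Forall₂ (fun a B => (a, B) ∈ Γ) as As →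
      (∀ d ∈ Ds, d.1 = Mode.R) → ds.map Ref.mode = Ds.map Prod.fst →
      ESync A A → FCtx.Split Ψ Ψ₁ Ψ₂ → New (.var x .S) Γ Δ z →
      ETy sg Ψ₁ p M (.proc .S A As Ds) →
      PTy sg Ψ₂ ((.var x .S, A) ::ₘ Γ) Δ q Q z C →
      PTy sg Ψ Γ (((ds.zip (Ds.map Prod.snd) : List _) : Ctx sg) + Δ) (p + q)
        (.spawn .S x M as ds Q) z C
  /-- `{} E_{C m}`, `m ∈ {L, C}` -/
  | spawnC {Ψ Ψ₁ Ψ₂ Γ Δ p q x M as ds Q A As Ds z C} :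
      Inv Γ (((ds.zip (Ds.map Prod.snd) : List _) : Ctx sg) + Δ) z C →
      (z.mode = .L ∨ z.mode = .C) → List.Forall₂ (fun a B => (a, B) ∈ Γ) as As →
      ds.map Ref.mode = Ds.map Prod.fst →
      FCtx.Split Ψ Ψ₁ Ψ₂ → New (.var x .C) Γ Δ z →
      ETy sg Ψ₁ p M (.proc .C A As Ds) →
      PTy sg Ψ₂ Γ ((.var x .C, A) ::ₘ Δ) q Q z C →
      PTy sg Ψ Γ (((ds.zip (Ds.map Prod.snd) : List _) : Ctx sg) + Δ) (p + q)
        (.spawn .C x M as ds Q) z C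
  | fwd {Ψ Γ x y A} : Inv Γ {(y, A)} x A → (x.mode = .R ∨ x.mode = .C) → y.mode = x.mode →
      PTy sg Ψ Γ {(y, A)} 0 (.fwd x y) x A
  | ichoiceR {Ψ Γ Δ q x k P K B} : Inv Γ Δ x (.ichoice K B) → k ∈ K →
      PTy sg Ψ Γ Δ q P x (B k) → PTy sg Ψ Γ Δ q (.sendL x k P) x (.ichoice K B)
  | ichoiceL {Ψ Γ Δ q x Q K B z C} : Inv Γ ((x, .ichoice K B) ::ₘ Δ) z C →
      (∀ l ∈ K, PTy sg Ψ Γ ((x, B l) ::ₘ Δ) q (Q l) z C) →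
      PTy sg Ψ Γ ((x, .ichoice K B) ::ₘ Δ) q (.case x K Q) z C
  | echoiceR {Ψ Γ Δ q x P K B} : Inv Γ Δ x (.echoice K B) →
      (∀ l ∈ K, PTy sg Ψ Γ Δ q (P l) x (B l)) →
      PTy sg Ψ Γ Δ q (.case x K P) x (.echoice K B)
  | echoiceL {Ψ Γ Δ q x k P K B z C} : Inv Γ ((x, .echoice K B) ::ₘ Δ) z C → k ∈ K →
      PTy sg Ψ Γ ((x, B k) ::ₘ Δ) q P z C →
      PTy sg Ψ Γ ((x, .echoice K B) ::ₘ Δ) q (.sendL x k P) z C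
  | tensorR {Ψ Γ Δ q x w P n A B} : Inv Γ ((w, A) ::ₘ Δ) x (.tensor n A B) → w.mode = n →
      PTy sg Ψ Γ Δ q P x B → PTy sg Ψ Γ ((w, A) ::ₘ Δ) q (.sendC x w P) x (.tensor n A B)
  | tensorL {Ψ Γ Δ q x y Q n A B z C} : Inv Γ ((x, .tensor n A B) ::ₘ Δ) z C →
      New (.var y n) Γ ((x, .tensor n A B) ::ₘ Δ) z →
      PTy sg Ψ Γ ((.var y n, A) ::ₘ (x, B) ::ₘ Δ) q Q z C →
      PTy sg Ψ Γ ((x, .tensor n A B) ::ₘ Δ) q (.recvC x y n Q) z C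
  | lolliR {Ψ Γ Δ q x y P n A B} : Inv Γ Δ x (.lolli n A B) → New (.var y n) Γ Δ x →
      PTy sg Ψ Γ ((.var y n, A) ::ₘ Δ) q P x B →
      PTy sg Ψ Γ Δ q (.recvC x y n P) x (.lolli n A B)
  | lolliL {Ψ Γ Δ q x w Q n A B z C} : Inv Γ ((w, A) ::ₘ (x, .lolli n A B) ::ₘ Δ) z C →
      w.mode = n → PTy sg Ψ Γ ((x, B) ::ₘ Δ) q Q z C →
      PTy sg Ψ Γ ((w, A) ::ₘ (x, .lolli n A B) ::ₘ Δ) q (.sendC x w Q) z C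
  | timesR {Ψ Ψ₁ Ψ₂ Γ Δ p q x M P τ A} : Inv Γ Δ x (.times τ A) → FCtx.Split Ψ Ψ₁ Ψ₂ →
      ETy sg Ψ₁ p M τ → PTy sg Ψ₂ Γ Δ q P x A →
      PTy sg Ψ Γ Δ (p + q) (.sendV x M P) x (.times τ A)
  | timesL {Ψ Γ Δ q x y Q τ A z C} : Inv Γ ((x, .times τ A) ::ₘ Δ) z C →
      PTy sg (Ψ.ext y τ) Γ ((x, A) ::ₘ Δ) q Q z C →
      PTy sg Ψ Γ ((x, .times τ A) ::ₘ Δ) q (.recvV x y Q) z C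
  | arrowR {Ψ Γ Δ q x y P τ A} : Inv Γ Δ x (.arrow τ A) →
      PTy sg (Ψ.ext y τ) Γ Δ q P x A → PTy sg Ψ Γ Δ q (.recvV x y P) x (.arrow τ A)
  | arrowL {Ψ Ψ₁ Ψ₂ Γ Δ p q x M Q τ A z C} : Inv Γ ((x, .arrow τ A) ::ₘ Δ) z C →
      FCtx.Split Ψ Ψ₁ Ψ₂ → ETy sg Ψ₁ p M τ → PTy sg Ψ₂ Γ ((x, A) ::ₘ Δ) q Q z C →
      PTy sg Ψ Γ ((x, .arrow τ A) ::ₘ Δ) (p + q) (.sendV x M Q) z C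
  | oneR {Ψ Γ x} : Inv Γ 0 x .one → PTy sg Ψ Γ 0 0 (.close x) x .one
  | oneL {Ψ Γ Δ q x Q z C} : Inv Γ ((x, .one) ::ₘ Δ) z C → PTy sg Ψ Γ Δ q Q z C →
      PTy sg Ψ Γ ((x, .one) ::ₘ Δ) q (.wait x Q) z C
  | work {Ψ Γ Δ p r P z C} : Inv Γ Δ z C → PTy sg Ψ Γ Δ p P z C →
      PTy sg Ψ Γ Δ (p + r) (.work r P) z C
  | payR {Ψ Γ Δ p r x P A} : Inv Γ Δ x (.pay r A) → PTy sg Ψ Γ Δ p P x A →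
      PTy sg Ψ Γ Δ (p + r) (.pay x r P) x (.pay r A)
  | payL {Ψ Γ Δ q r x P A z C} : Inv Γ ((x, .pay r A) ::ₘ Δ) z C →
      PTy sg Ψ Γ ((x, A) ::ₘ Δ) (q + r) P z C →
      PTy sg Ψ Γ ((x, .pay r A) ::ₘ Δ) q (.get x r P) z C
  | getR {Ψ Γ Δ q r x P A} : Inv Γ Δ x (.get r A) → PTy sg Ψ Γ Δ (q + r) P x A →
      PTy sg Ψ Γ Δ q (.get x r P) x (.get r A)
  | getL {Ψ Γ Δ p r x P A z C} : Inv Γ ((x, .get r A) ::ₘ Δ) z C →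
      PTy sg Ψ Γ ((x, A) ::ₘ Δ) p P z C →
      PTy sg Ψ Γ ((x, .get r A) ::ₘ Δ) (p + r) (.pay x r P) z C
  | upR {Ψ Γ Δ q x y P A} : Inv Γ Δ x (.up A) → x.mode = .S → Purelin Δ →
      New (.var y .L) Γ Δ x → PTy sg Ψ Γ Δ q P (.var y .L) A →
      PTy sg Ψ Γ Δ q (.accept y x P) x (.up A)
  | upL {Ψ Γ Δ q x y Q A z C} : Inv Γ Δ z C → (z.mode = .L ∨ z.mode = .C) → (x, .up A) ∈ Γ →
      New (.var y .L) Γ Δ z → PTy sg Ψ Γ ((.var y .L, A) ::ₘ Δ) q Q z C →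
      PTy sg Ψ Γ Δ q (.acquire y x Q) z C
  | downR {Ψ Γ Δ q x y P A} : Inv Γ Δ x (.down A) → x.mode = .L → Purelin Δ →
      New (.var y .S) Γ Δ x → PTy sg Ψ Γ Δ q P (.var y .S) A →
      PTy sg Ψ Γ Δ q (.detach y x P) x (.down A)
  | downL {Ψ Γ Δ q x y Q A z C} : Inv Γ ((x, .down A) ::ₘ Δ) z C → x.mode = .L →
      (z.mode = .L ∨ z.mode = .C) → New (.var y .S) Γ Δ z →
      PTy sg Ψ ((.var y .S, A) ::ₘ Γ) Δ q Q z C →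
      PTy sg Ψ Γ ((x, .down A) ::ₘ Δ) q (.release y x Q) z C
end

/-- A signature is well-formed if its function definitions are well typed (contractiveness of the
type definitions is part of `Sig`). -/
def Sig.WF (sg : Sig) : Prop :=
  ∀ f, ETy sg FCtx.empty (sg.fpot f) (sg.fdef f) (.mk sg (sg.ftype f))

/-! ## Cost semantics of expressions -/

/-- `M val`. -/
inductive IsVal : Expr → Prop
  | lam {x τ M} : IsVal (.lam x τ M)
  | inl {V} : IsVal V → IsVal (.inl V)
  | inr {V} : IsVal V → IsVal (.inr V)
  | pair {V W} : IsVal V → IsVal W → IsVal (.pair V W)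
  | int {n} : IsVal (.int n)
  | bool {b} : IsVal (.bool b)
  | nil : IsVal .nil
  | cons {V W} : IsVal V → IsVal W → IsVal (.cons V W)
  | proc {k x as ds P} : IsVal (.proc k x as ds P)

/-- `M ⇓ V | μ`: the closed expression `M` evaluates to `V` with cost `μ`. -/
inductive Eval (sg : Sig) : Expr → Expr → ℕ → Prop
  | fn {f V μ} : Eval sg (sg.fdef f) V μ → Eval sg (.fn f) V μ
  | lam {x τ M} : Eval sg (.lam x τ M) (.lam x τ M) 0
  | app {M N x τ M' V W μ₁ μ₂ μ₃} : Eval sg M (.lam x τ M') μ₁ → Eval sg N V μ₂ →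
      Eval sg (Expr.vsub x V M') W μ₃ → Eval sg (.app M N) W (μ₁ + μ₂ + μ₃)
  | inl {M V μ} : Eval sg M V μ → Eval sg (.inl M) (.inl V) μ
  | inr {M V μ} : Eval sg M V μ → Eval sg (.inr M) (.inr V) μ
  | casesl {M x Ml y Mr V W μ₁ μ₂} : Eval sg M (.inl V) μ₁ → Eval sg (Expr.vsub x V Ml) W μ₂ →
      Eval sg (.cases M x Ml y Mr) W (μ₁ + μ₂)
  | casesr {M x Ml y Mr V W μ₁ μ₂} : Eval sg M (.inr V) μ₁ → Eval sg (Expr.vsub y V Mr) W μ₂ →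
      Eval sg (.cases M x Ml y Mr) W (μ₁ + μ₂)
  | pair {M N V W μ₁ μ₂} : Eval sg M V μ₁ → Eval sg N W μ₂ →
      Eval sg (.pair M N) (.pair V W) (μ₁ + μ₂)
  | projl {M V W μ} : Eval sg M (.pair V W) μ → Eval sg (.projl M) V μ
  | projr {M V W μ} : Eval sg M (.pair V W) μ → Eval sg (.projr M) W μ
  | int {n} : Eval sg (.int n) (.int n) 0
  | bool {b} : Eval sg (.bool b) (.bool b) 0
  | iteT {M N₁ N₂ V μ₁ μ₂} : Eval sg M (.bool true) μ₁ → Eval sg N₁ V μ₂ →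
      Eval sg (.ite M N₁ N₂) V (μ₁ + μ₂)
  | iteF {M N₁ N₂ V μ₁ μ₂} : Eval sg M (.bool false) μ₁ → Eval sg N₂ V μ₂ →
      Eval sg (.ite M N₁ N₂) V (μ₁ + μ₂)
  | nil : Eval sg .nil .nil 0
  | cons {M N V W μ₁ μ₂} : Eval sg M V μ₁ → Eval sg N W μ₂ →
      Eval sg (.cons M N) (.cons V W) (μ₁ + μ₂)
  | mtchNil {M N₁ x xs N₂ V μ₁ μ₂} : Eval sg M .nil μ₁ → Eval sg N₁ V μ₂ →
      Eval sg (.mtch M N₁ x xs N₂) V (μ₁ + μ₂)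
  | mtchCons {M N₁ x xs N₂ V W U μ₁ μ₂} : Eval sg M (.cons V W) μ₁ →
      Eval sg (Expr.vsub x V (Expr.vsub xs W N₂)) U μ₂ → Eval sg (.mtch M N₁ x xs N₂) U (μ₁ + μ₂)
  | tick {r M V μ} : Eval sg M V μ → Eval sg (.tick r M) V (μ + r)
  | proc {k x as ds P} : Eval sg (.proc k x as ds P) (.proc k x as ds P) 0

/-! ## Configurations and their cost semantics -/

/-- Semantic objects `proc(c, w, P)` and `msg(c, w, M)`: the process `P` (the message `M`) provides
`c` and has performed work `w`. -/
inductive Obj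
  | proc (c : Chan) (w : ℕ) (P : Proc)
  | msg (c : Chan) (w : ℕ) (M : Proc)

/-- Configurations are multisets of semantic objects. -/
abbrev Config := Multiset Obj

/-- The channel provided by a semantic object. -/
def Obj.chan : Obj → Chan
  | .proc c _ _ => c
  | .msg c _ _ => c

/-- The work counter of a semantic object. -/
def Obj.workDone : Obj → ℕ
  | .proc _ w _ => w
  | .msg _ w _ => w

/-- The total work (gas) performed by the processes and messages of a configuration. -/
def totalWork (Ω : Config) : ℕ := (Ω.map Obj.workDone).sum

/-- The channel `c` occurs in the configuration. -/
def Occurs (c : Chan) (Ω : Config) : Prop :=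
  ∃ o ∈ Ω, match o with
    | .proc d _ P => d = c ∨ P.Occ c
    | .msg d _ M => d = c ∨ M.Occ c

/-- `c` is globally fresh: it is not among the channels `N`, it does not occur in `Ω`, and, for a
shared channel, neither do its linear counterparts. -/
def Fresh (N : Set Chan) (Ω : Config) (c : Chan) : Prop :=
  c ∉ N ∧ ¬ Occurs c Ω ∧ ∀ a i, c = .S a → ¬ Occurs (.L a i) Ω

/-- The rewriting rules.  `fresh` says which channels are fresh. -/
inductive Red (sg : Sig) (fresh : Chan → Prop) : Config → Config → Prop
  | internalSpawn {c w k x M V μ as ds Q} : Eval sg M V μ →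
      Red sg fresh {.proc c w (.spawn k x M as ds Q)} {.proc c (w + μ) (.spawn k x V as ds Q)}
  | internalSend {c w x M V μ P} : Eval sg M V μ →
      Red sg fresh {.proc c w (.sendV x M P)} {.proc c (w + μ) (.sendV x V P)}
  /-- `{} E_{k m}` for `k ∈ {R, S, C}` -/
  | spawn {c d w k x x' ys zs P as bs Q} : fresh c → c.mode = k →
      Red sg fresh {.proc d w (.spawn k x (.proc k x' ys zs P) as bs Q)}
        {.proc c 0 (P.chsub (multi ((.var x' k, .ch c) ::
            ((ys.map (Ref.var · .S)).zip as ++ (zs.map fun z => Ref.var z.1 z.2).zip bs)))),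
         .proc d w (Q.ren (.var x k) (.ch c))}
  | fwdPos {c d w w' M} :
      Red sg fresh {.msg d w' M, .proc c w (.fwd (.ch c) (.ch d))}
        {.msg c (w + w') (M.ren (.ch d) (.ch c))}
  | fwdNeg {c d e w w' M} : e ≠ c → M.Occ c →
      Red sg fresh {.proc c w (.fwd (.ch c) (.ch d)), .msg e w' M}
        {.msg e (w + w') (M.ren (.ch c) (.ch d))}
  | ichoiceS {c c' w l P} : fresh c' → Cont c c' →
      Red sg fresh {.proc c w (.sendL (.ch c) l P)}
        {.proc c' w (P.ren (.ch c) (.ch c')),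
         .msg c 0 (.sendL (.ch c) l (.fwd (.ch c) (.ch c')))}
  | ichoiceC {c c' d w w' l K Q} : d ≠ c → l ∈ K →
      Red sg fresh {.msg c w (.sendL (.ch c) l (.fwd (.ch c) (.ch c'))),
         .proc d w' (.case (.ch c) K Q)}
        {.proc d (w + w') ((Q l).ren (.ch c) (.ch c'))}
  | echoiceS {c c' d w l P} : d ≠ c → fresh c' → Cont c c' →
      Red sg fresh {.proc d w (.sendL (.ch c) l P)}
        {.msg c' 0 (.sendL (.ch c) l (.fwd (.ch c') (.ch c))),
         .proc d w (P.ren (.ch c) (.ch c'))}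
  | echoiceC {c c' w w' l K Q} : l ∈ K →
      Red sg fresh {.proc c w' (.case (.ch c) K Q),
         .msg c' w (.sendL (.ch c) l (.fwd (.ch c') (.ch c)))}
        {.proc c' (w + w') ((Q l).ren (.ch c) (.ch c'))}
  | tensorS {c c' e w P} : fresh c' → Cont c c' →
      Red sg fresh {.proc c w (.sendC (.ch c) (.ch e) P)}
        {.proc c' w (P.ren (.ch c) (.ch c')),
         .msg c 0 (.sendC (.ch c) (.ch e) (.fwd (.ch c) (.ch c')))}
  | tensorC {c c' d e w w' y n Q} : d ≠ c →
      Red sg fresh {.msg c w (.sendC (.ch c) (.ch e) (.fwd (.ch c) (.ch c'))),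
         .proc d w' (.recvC (.ch c) y n Q)}
        {.proc d (w + w') ((Q.ren (.var y n) (.ch e)).ren (.ch c) (.ch c'))}
  | lolliS {c c' d e w P} : d ≠ c → fresh c' → Cont c c' →
      Red sg fresh {.proc d w (.sendC (.ch c) (.ch e) P)}
        {.msg c' 0 (.sendC (.ch c) (.ch e) (.fwd (.ch c') (.ch c))),
         .proc d w (P.ren (.ch c) (.ch c'))}
  | lolliC {c c' e w w' y n Q} :
      Red sg fresh {.proc c w' (.recvC (.ch c) y n Q),
         .msg c' w (.sendC (.ch c) (.ch e) (.fwd (.ch c') (.ch c)))}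
        {.proc c' (w + w') ((Q.ren (.var y n) (.ch e)).ren (.ch c) (.ch c'))}
  | timesS {c c' w N P} : fresh c' → Cont c c' → IsVal N →
      Red sg fresh {.proc c w (.sendV (.ch c) N P)}
        {.proc c' w (P.ren (.ch c) (.ch c')),
         .msg c 0 (.sendV (.ch c) N (.fwd (.ch c) (.ch c')))}
  | timesC {c c' d w w' N y Q} : d ≠ c →
      Red sg fresh {.msg c w (.sendV (.ch c) N (.fwd (.ch c) (.ch c'))),
         .proc d w' (.recvV (.ch c) y Q)}
        {.proc d (w + w') ((Q.vsub y N).ren (.ch c) (.ch c'))}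
  | arrowS {c c' d w N P} : d ≠ c → fresh c' → Cont c c' → IsVal N →
      Red sg fresh {.proc d w (.sendV (.ch c) N P)}
        {.msg c' 0 (.sendV (.ch c) N (.fwd (.ch c') (.ch c))),
         .proc d w (P.ren (.ch c) (.ch c'))}
  | arrowC {c c' w w' N y Q} :
      Red sg fresh {.proc c w' (.recvV (.ch c) y Q),
         .msg c' w (.sendV (.ch c) N (.fwd (.ch c') (.ch c)))}
        {.proc c' (w + w') ((Q.vsub y N).ren (.ch c) (.ch c'))}
  | oneS {c w} : Red sg fresh {.proc c w (.close (.ch c))} {.msg c w (.close (.ch c))}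
  | oneC {c d w w' Q} : d ≠ c →
      Red sg fresh {.msg c w (.close (.ch c)), .proc d w' (.wait (.ch c) Q)}
        {.proc d (w + w') Q}
  | work {c w μ P} : Red sg fresh {.proc c w (.work μ P)} {.proc c (w + μ) P}
  | payS {c c' w r P} : fresh c' → Cont c c' →
      Red sg fresh {.proc c w (.pay (.ch c) r P)}
        {.proc c' w (P.ren (.ch c) (.ch c')),
         .msg c 0 (.pay (.ch c) r (.fwd (.ch c) (.ch c')))}
  | payC {c c' d w w' r Q} : d ≠ c →
      Red sg fresh {.msg c w (.pay (.ch c) r (.fwd (.ch c) (.ch c'))),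
         .proc d w' (.get (.ch c) r Q)}
        {.proc d (w + w') (Q.ren (.ch c) (.ch c'))}
  | getS {c c' d w r P} : d ≠ c → fresh c' → Cont c c' →
      Red sg fresh {.proc d w (.pay (.ch c) r P)}
        {.msg c' 0 (.pay (.ch c) r (.fwd (.ch c') (.ch c))),
         .proc d w (P.ren (.ch c) (.ch c'))}
  | getC {c c' w w' r Q} :
      Red sg fresh {.proc c w' (.get (.ch c) r Q),
         .msg c' w (.pay (.ch c) r (.fwd (.ch c') (.ch c)))}
        {.proc c' (w + w') (Q.ren (.ch c) (.ch c'))}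
  | up {a i c w w' x y P Q} : fresh (.L a i) →
      Red sg fresh {.proc (.S a) w' (.accept x (.ch (.S a)) P),
         .proc c w (.acquire y (.ch (.S a)) Q)}
        {.proc (.L a i) w' (P.ren (.var x .L) (.ch (.L a i))),
         .proc c w (Q.ren (.var y .L) (.ch (.L a i)))}
  | down {a i c w w' x y P Q} :
      Red sg fresh {.proc (.L a i) w' (.detach x (.ch (.L a i)) P),
         .proc c w (.release y (.ch (.L a i)) Q)}
        {.proc (.S a) w' (P.ren (.var x .S) (.ch (.S a))),
         .proc c w (Q.ren (.var y .S) (.ch (.S a)))}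

/-- `Ω ↦ Ω'`: multiset rewriting, where the created channels are globally fresh, i.e. occur neither
in `Ω` nor among the channels `N`. -/
def Step (sg : Sig) (N : Set Chan) (Ω Ω' : Config) : Prop :=
  ∃ D L L' : Config, Ω = D + L ∧ Ω' = D + L' ∧ Red sg (Fresh N Ω) L L'

/-! ## Configuration typing -/

/-- Contexts of run-time channels. -/
abbrev CCtx (sg : Sig) := Multiset (Chan × SType sg)

/-- Run-time channels as references in process terms. -/
def CCtx.toCtx {sg : Sig} (Δ : CCtx sg) : Ctx sg := Multiset.map (fun e => (Ref.ch e.1, e.2)) Δ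

/-- The channels declared in a context. -/
def CCtx.names {sg : Sig} (Γ : CCtx sg) : Set Chan := {c | ∃ A, (c, A) ∈ Γ}

/-- Typing of messages `· ; · ; Δ ⊢^q M :: (c : A)`: a message is typed as the process consisting of
a send of a value or channel, followed by a forwarding between a channel and its continuation (at
any linear mode). -/
inductive MTy (sg : Sig) : CCtx sg → ℕ → Proc → Chan → SType sg → Prop
  | relax {Δ q q' M c A} : q ≤ q' → MTy sg Δ q M c A → MTy sg Δ q' M c A
  | ichoice {c c' k K B} : Inv 0 (CCtx.toCtx {(c', B k)}) (.ch c) (.ichoice K B) →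
      Cont c c' → k ∈ K →
      MTy sg {(c', B k)} 0 (.sendL (.ch c) k (.fwd (.ch c) (.ch c'))) c (.ichoice K B)
  | echoice {c c' k K B} : Inv 0 (CCtx.toCtx {(c, SType.echoice K B)}) (.ch c') (B k) →
      Cont c c' → k ∈ K →
      MTy sg {(c, .echoice K B)} 0 (.sendL (.ch c) k (.fwd (.ch c') (.ch c))) c' (B k)
  | tensor {c c' e n A B} : Inv 0 (CCtx.toCtx {(e, A), (c', B)}) (.ch c) (.tensor n A B) →
      Cont c c' → e.mode = n →
      MTy sg {(e, A), (c', B)} 0 (.sendC (.ch c) (.ch e) (.fwd (.ch c) (.ch c'))) c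
        (.tensor n A B)
  | lolli {c c' e n A B} : Inv 0 (CCtx.toCtx {(e, A), (c, SType.lolli n A B)}) (.ch c') B →
      Cont c c' → e.mode = n →
      MTy sg {(e, A), (c, .lolli n A B)} 0 (.sendC (.ch c) (.ch e) (.fwd (.ch c') (.ch c))) c' B
  | times {c c' p N τ A} : Inv 0 (CCtx.toCtx {(c', A)}) (.ch c) (.times τ A) →
      Cont c c' → IsVal N → ETy sg FCtx.empty p N τ →
      MTy sg {(c', A)} p (.sendV (.ch c) N (.fwd (.ch c) (.ch c'))) c (.times τ A)
  | arrow {c c' p N τ A} : Inv 0 (CCtx.toCtx {(c, SType.arrow τ A)}) (.ch c') A →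
      Cont c c' → IsVal N → ETy sg FCtx.empty p N τ →
      MTy sg {(c, .arrow τ A)} p (.sendV (.ch c) N (.fwd (.ch c') (.ch c))) c' A
  | one {c} : Inv (sg := sg) 0 0 (.ch c) .one → MTy sg 0 0 (.close (.ch c)) c .one
  | pay {c c' r A} : Inv 0 (CCtx.toCtx {(c', A)}) (.ch c) (.pay r A) → Cont c c' →
      MTy sg {(c', A)} r (.pay (.ch c) r (.fwd (.ch c) (.ch c'))) c (.pay r A)
  | get {c c' r A} : Inv 0 (CCtx.toCtx {(c, SType.get r A)}) (.ch c') A → Cont c c' →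
      MTy sg {(c, .get r A)} r (.pay (.ch c) r (.fwd (.ch c') (.ch c))) c' A

/-- Configuration typing `Γ₀ ⊨^E Ω :: (Γ ; Δ)`. -/
inductive CTy (sg : Sig) (Γ₀ : CCtx sg) : ℕ → Config → CCtx sg → CCtx sg → Prop
  | emp : CTy sg Γ₀ 0 0 0 0
  | procR {E q w c P Ω Γ Δ Δ' A} : CTy sg Γ₀ E Ω Γ (Δ + Δ') → c.mode = .R →
      PTy sg FCtx.empty 0 Δ'.toCtx q P (.ch c) A →
      CTy sg Γ₀ (E + q + w) (.proc c w P ::ₘ Ω) Γ ((c, A) ::ₘ Δ)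
  | procS {E q w a P Ω Γ Δ Δ' A} : (.S a, A) ∈ Γ₀ → ESync A A → CTy sg Γ₀ E Ω Γ (Δ + Δ') →
      PTy sg FCtx.empty Γ₀.toCtx Δ'.toCtx q P (.ch (.S a)) A →
      CTy sg Γ₀ (E + q + w) (.proc (.S a) w P ::ₘ Ω) ((.S a, A) ::ₘ Γ) Δ
  | procL {E q w a i P Ω Γ Δ Δ' A B} : (.S a, B) ∈ Γ₀ → ESync A B → CTy sg Γ₀ E Ω Γ (Δ + Δ') →
      PTy sg FCtx.empty Γ₀.toCtx Δ'.toCtx q P (.ch (.L a i)) A →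
      CTy sg Γ₀ (E + q + w) (.proc (.L a i) w P ::ₘ Ω) ((.S a, B) ::ₘ Γ) ((.L a i, A) ::ₘ Δ)
  | procC {E q w c P Ω Γ Δ Δ' A} : CTy sg Γ₀ E Ω Γ (Δ + Δ') → c.mode = .C →
      PTy sg FCtx.empty Γ₀.toCtx Δ'.toCtx q P (.ch c) A →
      CTy sg Γ₀ (E + q + w) (.proc c w P ::ₘ Ω) Γ ((c, A) ::ₘ Δ)
  | msg {E q w c M Ω Γ Δ Δ' A} : CTy sg Γ₀ E Ω Γ (Δ + Δ') →
      MTy sg Δ' q M c A →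
      CTy sg Γ₀ (E + q + w) (.msg c w M ::ₘ Ω) Γ ((c, A) ::ₘ Δ)

/-- Well-formed and well-typed configurations: `Γ₀ ⊨^E Ω :: (Γ ; Δ)`, no two semantic objects provide
the same channel, all channels in `Γ₀`, `Γ`, `Δ` are unique, and `Γ ⊆ Γ₀`. -/
structure WellTyped (sg : Sig) (Γ₀ : CCtx sg) (E : ℕ) (Ω : Config) (Γ Δ : CCtx sg) : Prop where
  typed : CTy sg Γ₀ E Ω Γ Δ
  providers : (Ω.map Obj.chan).Nodup
  unique₀ : (Γ₀.map Prod.fst).Nodup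
  uniqueS : (Γ.map Prod.fst).Nodup
  uniqueL : (Δ.map Prod.fst).Nodup
  sub : Γ ≤ Γ₀

end Nomos

open Nomos

-- For expressions, preservation with cost is the usual induction on evaluation, where potential
-- pays for ticks. Its substance is a substitution lemma (`typing_vsub`): a closed value typed with
-- potential `p` may replace a variable if `p` is added to the potential of the term. When the
-- variable is split along sharing, the potential of the value must split as well; this is
-- `IsVal.share`, an induction on values. Functions are typed with potential 0 and may be called
-- many times, so they capture only variables whose type is shared as `(τ, τ, τ)`; a closed value of
-- such a type can be retyped with potential 0 (`IsVal.free`).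
--
-- For configurations, the obstacle is that typing is ordered (an object is added after the objects
-- whose linear channels it uses), whereas rewriting acts on an arbitrary sub-multiset. The ordered
-- judgment `CTy` is therefore replaced by an unordered one, `Net`. It records the multiset `U` of
-- linear channels used and the multiset `L` of linear channels offered, and requires every
-- dependency to go upwards in a strict order `Below rank`. The interface `Δ` is determined by `L =
-- U + Δ`. A derivation of `CTy` yields a rank (`CTy.toNet`). Conversely, an object that is not
-- below any other is used by nobody and can be removed last (`Net.toCTy`). A `Net` can be cut into
-- a rewritten part and a rest and glued together again (`Net.split`, `Net.join`), and the interface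
-- survives if the rewritten part keeps the balance `U' + L = U + L'`. This and the conditions on
-- freshness and rank are collected in `LocalStep`, so that each rewriting rule becomes a statement
-- about one or two objects.
--
-- `Below` compares modes first: purely linear channels lie below all others, and ranks matter only
-- within a class. When a client acquires a shared process, a new dependency arises between objects
-- whose ranks were unrelated. It creates no cycle, because a shared process uses purely linear
-- channels only, and these are below the client in any case. Otherwise, a fresh linear channel is
-- inserted just below the object that will use it (`exists_rank_insert`).
--
-- The types on the two sides of a channel agree because offered linear channels are unique, and
-- constructors of equi-recursive types are injective since equality is bisimilarity.
-- Equi-synchronization is carried along with the linear phase of a shared channel, and at a release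
-- it forces the type to be the one declared in `Γ₀`. Energy is conserved since a step only moves
-- potential into work or into a message, and weakening of potential absorbs any surplus. The bound
-- on gas follows because energy is a sum of work counters and nonnegative potentials.

namespace Nomos

/-! ## Equality of types -/

theorem FMatch.mono {RF RF' : FTy → FTy → Prop} {RS RS' : STy → STy → Prop}
    (hF : ∀ a b, RF a b → RF' a b) (hS : ∀ A B, RS A B → RS' A B) {a b}
    (h : FMatch RF RS a b) : FMatch RF' RS' a b := by
  cases h with
  | arrow h₁ h₂ => exact .arrow (hF _ _ h₁) (hF _ _ h₂)
  | sum h₁ h₂ => exact .sum (hF _ _ h₁) (hF _ _ h₂)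
  | prod h₁ h₂ => exact .prod (hF _ _ h₁) (hF _ _ h₂)
  | int => exact .int
  | bool => exact .bool
  | list h₁ => exact .list (hF _ _ h₁)
  | proc h₁ h₂ h₃ => exact .proc (hS _ _ h₁) (h₂.imp hS) (h₃.imp fun _ _ h => ⟨h.1, hS _ _ h.2⟩)

theorem SMatch.mono {RF RF' : FTy → FTy → Prop} {RS RS' : STy → STy → Prop}
    (hF : ∀ a b, RF a b → RF' a b) (hS : ∀ A B, RS A B → RS' A B) {A B}
    (h : SMatch RF RS A B) : SMatch RF' RS' A B := by
  cases h with
  | ichoice h₁ => exact .ichoice fun l hl => hS _ _ (h₁ l hl)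
  | echoice h₁ => exact .echoice fun l hl => hS _ _ (h₁ l hl)
  | lolli h₁ h₂ => exact .lolli (hS _ _ h₁) (hS _ _ h₂)
  | tensor h₁ h₂ => exact .tensor (hS _ _ h₁) (hS _ _ h₂)
  | one => exact .one
  | arrow h₁ h₂ => exact .arrow (hF _ _ h₁) (hS _ _ h₂)
  | times h₁ h₂ => exact .times (hF _ _ h₁) (hS _ _ h₂)
  | pay h₁ => exact .pay (hS _ _ h₁)
  | get h₁ => exact .get (hS _ _ h₁)
  | up h₁ => exact .up (hS _ _ h₁)
  | down h₁ => exact .down (hS _ _ h₁)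

variable {sg : Sig}

/-- Equality of classes is bisimilarity, and a bisimulation can be unfolded one step. Both
injectivity of the type constructors and their disjointness are obtained by case analysis on the
resulting match. -/
theorem FType.match_of_eq {a b : FTy} (h : FType.mk sg a = FType.mk sg b) :
    FMatch sg.FEq sg.SEq (sg.unfoldF a) (sg.unfoldF b) := by
  obtain ⟨RF, RS, hb, hab⟩ : sg.FEq a b := Quotient.exact (s := sg.fSetoid) h
  exact (hb.1 a b hab).mono (fun _ _ h => ⟨RF, RS, hb, h⟩) (fun _ _ h => ⟨RF, RS, hb, h⟩)

theorem SType.match_of_eq {A B : STy} (h : SType.mk sg A = SType.mk sg B) :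
    SMatch sg.FEq sg.SEq (sg.unfoldS A) (sg.unfoldS B) := by
  obtain ⟨RF, RS, hb, hab⟩ : sg.SEq A B := Quotient.exact (s := sg.sSetoid) h
  exact (hb.2 A B hab).mono (fun _ _ h => ⟨RF, RS, hb, h⟩) (fun _ _ h => ⟨RF, RS, hb, h⟩)

theorem FType.eq_of_rep {a b : FType sg} (h : sg.FEq a.rep b.rep) : a = b := by
  rw [← Quotient.out_eq (s := sg.fSetoid) a, ← Quotient.out_eq (s := sg.fSetoid) b]
  exact Quotient.sound (s := sg.fSetoid) h

theorem SType.eq_of_rep {A B : SType sg} (h : sg.SEq A.rep B.rep) : A = B := by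
  rw [← Quotient.out_eq (s := sg.sSetoid) A, ← Quotient.out_eq (s := sg.sSetoid) B]
  exact Quotient.sound (s := sg.sSetoid) h

theorem FType.arrow_inj {p p'} {a b a' b' : FType sg} (h : FType.arrow p a b = .arrow p' a' b') :
    p = p' ∧ a = a' ∧ b = b' := by
  cases FType.match_of_eq h with
  | arrow h₁ h₂ => exact ⟨rfl, FType.eq_of_rep h₁, FType.eq_of_rep h₂⟩

theorem FType.sum_inj {a b a' b' : FType sg} (h : FType.sum a b = .sum a' b') :
    a = a' ∧ b = b' := by
  cases FType.match_of_eq h with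
  | sum h₁ h₂ => exact ⟨FType.eq_of_rep h₁, FType.eq_of_rep h₂⟩

theorem FType.prod_inj {a b a' b' : FType sg} (h : FType.prod a b = .prod a' b') :
    a = a' ∧ b = b' := by
  cases FType.match_of_eq h with
  | prod h₁ h₂ => exact ⟨FType.eq_of_rep h₁, FType.eq_of_rep h₂⟩

theorem FType.list_inj {q q'} {a a' : FType sg} (h : FType.list q a = .list q' a') :
    q = q' ∧ a = a' := by
  cases FType.match_of_eq h with
  | list h₁ => exact ⟨rfl, FType.eq_of_rep h₁⟩

theorem FType.proc_inj {k k'} {A A' : SType sg} {As As' Ds Ds'}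
    (h : FType.proc k A As Ds = .proc k' A' As' Ds') : k = k' ∧ A = A' ∧ As = As' ∧ Ds = Ds' := by
  cases FType.match_of_eq h with
  | proc h₁ h₂ h₃ =>
    refine ⟨rfl, SType.eq_of_rep h₁, ?_, ?_⟩
    · rw [List.forall₂_map_left_iff, List.forall₂_map_right_iff] at h₂
      exact List.forall₂_eq_eq_eq ▸ h₂.imp fun _ _ h => SType.eq_of_rep h
    · rw [List.forall₂_map_left_iff, List.forall₂_map_right_iff] at h₃
      exact List.forall₂_eq_eq_eq ▸ h₃.imp fun _ _ h => Prod.ext h.1 (SType.eq_of_rep h.2)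

/-- Bisimulations inspect only the branches with labels in `K`, so nothing can be said about the
functions `B` and `B'` outside `K`. -/
theorem SType.ichoice_inj {K K'} {B B' : Label → SType sg}
    (h : SType.ichoice K B = .ichoice K' B') : K = K' ∧ ∀ l ∈ K, B l = B' l := by
  cases SType.match_of_eq h with
  | ichoice h₁ => exact ⟨rfl, fun l hl => SType.eq_of_rep (h₁ l hl)⟩

theorem SType.echoice_inj {K K'} {B B' : Label → SType sg}
    (h : SType.echoice K B = .echoice K' B') : K = K' ∧ ∀ l ∈ K, B l = B' l := by
  cases SType.match_of_eq h with
  | echoice h₁ => exact ⟨rfl, fun l hl => SType.eq_of_rep (h₁ l hl)⟩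

theorem SType.lolli_inj {n n'} {A B A' B' : SType sg} (h : SType.lolli n A B = .lolli n' A' B') :
    n = n' ∧ A = A' ∧ B = B' := by
  cases SType.match_of_eq h with
  | lolli h₁ h₂ => exact ⟨rfl, SType.eq_of_rep h₁, SType.eq_of_rep h₂⟩

theorem SType.tensor_inj {n n'} {A B A' B' : SType sg}
    (h : SType.tensor n A B = .tensor n' A' B') : n = n' ∧ A = A' ∧ B = B' := by
  cases SType.match_of_eq h with
  | tensor h₁ h₂ => exact ⟨rfl, SType.eq_of_rep h₁, SType.eq_of_rep h₂⟩

theorem SType.arrow_inj {τ τ'} {A A' : SType sg} (h : SType.arrow τ A = .arrow τ' A') :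
    τ = τ' ∧ A = A' := by
  cases SType.match_of_eq h with
  | arrow h₁ h₂ => exact ⟨FType.eq_of_rep h₁, SType.eq_of_rep h₂⟩

theorem SType.times_inj {τ τ'} {A A' : SType sg} (h : SType.times τ A = .times τ' A') :
    τ = τ' ∧ A = A' := by
  cases SType.match_of_eq h with
  | times h₁ h₂ => exact ⟨FType.eq_of_rep h₁, SType.eq_of_rep h₂⟩

theorem SType.pay_inj {r r'} {A A' : SType sg} (h : SType.pay r A = .pay r' A') :
    r = r' ∧ A = A' := by
  cases SType.match_of_eq h with
  | pay h₁ => exact ⟨rfl, SType.eq_of_rep h₁⟩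

theorem SType.get_inj {r r'} {A A' : SType sg} (h : SType.get r A = .get r' A') :
    r = r' ∧ A = A' := by
  cases SType.match_of_eq h with
  | get h₁ => exact ⟨rfl, SType.eq_of_rep h₁⟩

theorem SType.up_inj {A A' : SType sg} (h : SType.up A = .up A') : A = A' := by
  cases SType.match_of_eq h with
  | up h₁ => exact SType.eq_of_rep h₁

theorem SType.down_inj {A A' : SType sg} (h : SType.down A = .down A') : A = A' := by
  cases SType.match_of_eq h with
  | down h₁ => exact SType.eq_of_rep h₁

/-! ## Inversion of typing up to weakening of potential -/

/-- The rules of `ETy` other than weakening of potential. -/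
inductive ETyCore (sg : Sig) : FCtx sg → ℕ → Expr → FType sg → Prop
  | var {Ψ x τ} : Ψ x = some τ → ETyCore sg Ψ 0 (.var x) τ
  | fn {Ψ f} : ETyCore sg Ψ (sg.fpot f) (.fn f) (.mk sg (sg.ftype f))
  | lam {Ψ Ψ₀ p x τ M σ} : FCtx.Sub Ψ₀ Ψ → FCtx.Free Ψ₀ →
      ETy sg (Ψ₀.ext x (.mk sg τ)) p M σ →
      ETyCore sg Ψ 0 (.lam x τ M) (.arrow p (.mk sg τ) σ)
  | app {Ψ Ψ₁ Ψ₂ p q₁ q₂ M N τ σ} : FCtx.Split Ψ Ψ₁ Ψ₂ →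
      ETy sg Ψ₁ q₁ M (.arrow p τ σ) → ETy sg Ψ₂ q₂ N τ →
      ETyCore sg Ψ (q₁ + q₂ + p) (.app M N) σ
  | inl {Ψ q M τ σ} : ETy sg Ψ q M τ → ETyCore sg Ψ q (.inl M) (.sum τ σ)
  | inr {Ψ q M τ σ} : ETy sg Ψ q M σ → ETyCore sg Ψ q (.inr M) (.sum τ σ)
  | cases {Ψ Ψ₁ Ψ₂ q₁ q₂ M x Ml y Mr τ₁ τ₂ σ} : FCtx.Split Ψ Ψ₁ Ψ₂ →
      ETy sg Ψ₁ q₁ M (.sum τ₁ τ₂) →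
      ETy sg (Ψ₂.ext x τ₁) q₂ Ml σ → ETy sg (Ψ₂.ext y τ₂) q₂ Mr σ →
      ETyCore sg Ψ (q₁ + q₂) (.cases M x Ml y Mr) σ
  | pair {Ψ Ψ₁ Ψ₂ q₁ q₂ M N τ σ} : FCtx.Split Ψ Ψ₁ Ψ₂ →
      ETy sg Ψ₁ q₁ M τ → ETy sg Ψ₂ q₂ N σ → ETyCore sg Ψ (q₁ + q₂) (.pair M N) (.prod τ σ)
  | projl {Ψ q M τ σ} : ETy sg Ψ q M (.prod τ σ) → ETyCore sg Ψ q (.projl M) τ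
  | projr {Ψ q M τ σ} : ETy sg Ψ q M (.prod τ σ) → ETyCore sg Ψ q (.projr M) σ
  | int {Ψ n} : ETyCore sg Ψ 0 (.int n) .int
  | bool {Ψ b} : ETyCore sg Ψ 0 (.bool b) .bool
  | ite {Ψ Ψ₁ Ψ₂ q₁ q₂ M N₁ N₂ τ} : FCtx.Split Ψ Ψ₁ Ψ₂ →
      ETy sg Ψ₁ q₁ M .bool → ETy sg Ψ₂ q₂ N₁ τ → ETy sg Ψ₂ q₂ N₂ τ →
      ETyCore sg Ψ (q₁ + q₂) (.ite M N₁ N₂) τ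
  | nil {Ψ p τ} : ETyCore sg Ψ 0 .nil (.list p τ)
  | cons {Ψ Ψ₁ Ψ₂ p q₁ q₂ M N τ} : FCtx.Split Ψ Ψ₁ Ψ₂ →
      ETy sg Ψ₁ q₁ M τ → ETy sg Ψ₂ q₂ N (.list p τ) →
      ETyCore sg Ψ (q₁ + q₂ + p) (.cons M N) (.list p τ)
  | mtch {Ψ Ψ₁ Ψ₂ p q₁ q₂ M N₁ x xs N₂ τ σ} : FCtx.Split Ψ Ψ₁ Ψ₂ →
      ETy sg Ψ₁ q₁ M (.list p τ) → ETy sg Ψ₂ q₂ N₁ σ →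
      ETy sg ((Ψ₂.ext x τ).ext xs (.list p τ)) (q₂ + p) N₂ σ →
      ETyCore sg Ψ (q₁ + q₂) (.mtch M N₁ x xs N₂) σ
  | tick {Ψ q r M τ} : ETy sg Ψ q M τ → ETyCore sg Ψ (q + r) (.tick r M) τ
  | proc {Ψ q k x as ds P A As Ds} : k ≠ .L → as.length = As.length →
      ds.map Prod.snd = Ds.map Prod.fst →
      (Ref.var x k :: (as.map (Ref.var · .S) ++ ds.map fun d => Ref.var d.1 d.2)).Nodup →
      PTy sg Ψ ((as.map (Ref.var · .S)).zip As) ((ds.map fun d => Ref.var d.1 d.2).zip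
        (Ds.map Prod.snd)) q P (.var x k) A →
      ETyCore sg Ψ q (.proc k x as ds P) (.proc k A As Ds)

/-- The rules of `PTy` other than weakening of potential. -/
inductive PTyCore (sg : Sig) :
    FCtx sg → Ctx sg → Ctx sg → ℕ → Proc → Ref → SType sg → Prop
  | spawnR {Ψ Ψ₁ Ψ₂ Γ Δ p q x M ds Q A Ds z C} :
      Inv Γ (((ds.zip (Ds.map Prod.snd) : List _) : Ctx sg) + Δ) z C →
      (∀ d ∈ Ds, d.1 = Mode.R) → ds.map Ref.mode = Ds.map Prod.fst →
      FCtx.Split Ψ Ψ₁ Ψ₂ → New (.var x .R) Γ Δ z →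
      ETy sg Ψ₁ p M (.proc .R A [] Ds) →
      PTy sg Ψ₂ Γ ((.var x .R, A) ::ₘ Δ) q Q z C →
      PTyCore sg Ψ Γ (((ds.zip (Ds.map Prod.snd) : List _) : Ctx sg) + Δ) (p + q)
        (.spawn .R x M [] ds Q) z C
  | spawnS {Ψ Ψ₁ Ψ₂ Γ Δ p q x M as ds Q A As Ds z C} :
      Inv Γ (((ds.zip (Ds.map Prod.snd) : List _) : Ctx sg) + Δ) z C →
      z.mode ≠ .R → List.Forall₂ (fun a B => (a, B) ∈ Γ) as As →
      (∀ d ∈ Ds, d.1 = Mode.R) → ds.map Ref.mode = Ds.map Prod.fst →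
      ESync A A → FCtx.Split Ψ Ψ₁ Ψ₂ → New (.var x .S) Γ Δ z →
      ETy sg Ψ₁ p M (.proc .S A As Ds) →
      PTy sg Ψ₂ ((.var x .S, A) ::ₘ Γ) Δ q Q z C →
      PTyCore sg Ψ Γ (((ds.zip (Ds.map Prod.snd) : List _) : Ctx sg) + Δ) (p + q)
        (.spawn .S x M as ds Q) z C
  | spawnC {Ψ Ψ₁ Ψ₂ Γ Δ p q x M as ds Q A As Ds z C} :
      Inv Γ (((ds.zip (Ds.map Prod.snd) : List _) : Ctx sg) + Δ) z C →
      (z.mode = .L ∨ z.mode = .C) → List.Forall₂ (fun a B => (a, B) ∈ Γ) as As →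
      ds.map Ref.mode = Ds.map Prod.fst →
      FCtx.Split Ψ Ψ₁ Ψ₂ → New (.var x .C) Γ Δ z →
      ETy sg Ψ₁ p M (.proc .C A As Ds) →
      PTy sg Ψ₂ Γ ((.var x .C, A) ::ₘ Δ) q Q z C →
      PTyCore sg Ψ Γ (((ds.zip (Ds.map Prod.snd) : List _) : Ctx sg) + Δ) (p + q)
        (.spawn .C x M as ds Q) z C
  | fwd {Ψ Γ x y A} : Inv Γ {(y, A)} x A → (x.mode = .R ∨ x.mode = .C) → y.mode = x.mode →
      PTyCore sg Ψ Γ {(y, A)} 0 (.fwd x y) x A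
  | ichoiceR {Ψ Γ Δ q x k P K B} : Inv Γ Δ x (.ichoice K B) → k ∈ K →
      PTy sg Ψ Γ Δ q P x (B k) → PTyCore sg Ψ Γ Δ q (.sendL x k P) x (.ichoice K B)
  | ichoiceL {Ψ Γ Δ q x Q K B z C} : Inv Γ ((x, .ichoice K B) ::ₘ Δ) z C →
      (∀ l ∈ K, PTy sg Ψ Γ ((x, B l) ::ₘ Δ) q (Q l) z C) →
      PTyCore sg Ψ Γ ((x, .ichoice K B) ::ₘ Δ) q (.case x K Q) z C
  | echoiceR {Ψ Γ Δ q x P K B} : Inv Γ Δ x (.echoice K B) →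
      (∀ l ∈ K, PTy sg Ψ Γ Δ q (P l) x (B l)) →
      PTyCore sg Ψ Γ Δ q (.case x K P) x (.echoice K B)
  | echoiceL {Ψ Γ Δ q x k P K B z C} : Inv Γ ((x, .echoice K B) ::ₘ Δ) z C → k ∈ K →
      PTy sg Ψ Γ ((x, B k) ::ₘ Δ) q P z C →
      PTyCore sg Ψ Γ ((x, .echoice K B) ::ₘ Δ) q (.sendL x k P) z C
  | tensorR {Ψ Γ Δ q x w P n A B} : Inv Γ ((w, A) ::ₘ Δ) x (.tensor n A B) → w.mode = n →
      PTy sg Ψ Γ Δ q P x B → PTyCore sg Ψ Γ ((w, A) ::ₘ Δ) q (.sendC x w P) x (.tensor n A B)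
  | tensorL {Ψ Γ Δ q x y Q n A B z C} : Inv Γ ((x, .tensor n A B) ::ₘ Δ) z C →
      New (.var y n) Γ ((x, .tensor n A B) ::ₘ Δ) z →
      PTy sg Ψ Γ ((.var y n, A) ::ₘ (x, B) ::ₘ Δ) q Q z C →
      PTyCore sg Ψ Γ ((x, .tensor n A B) ::ₘ Δ) q (.recvC x y n Q) z C
  | lolliR {Ψ Γ Δ q x y P n A B} : Inv Γ Δ x (.lolli n A B) → New (.var y n) Γ Δ x →
      PTy sg Ψ Γ ((.var y n, A) ::ₘ Δ) q P x B →
      PTyCore sg Ψ Γ Δ q (.recvC x y n P) x (.lolli n A B)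
  | lolliL {Ψ Γ Δ q x w Q n A B z C} : Inv Γ ((w, A) ::ₘ (x, .lolli n A B) ::ₘ Δ) z C →
      w.mode = n → PTy sg Ψ Γ ((x, B) ::ₘ Δ) q Q z C →
      PTyCore sg Ψ Γ ((w, A) ::ₘ (x, .lolli n A B) ::ₘ Δ) q (.sendC x w Q) z C
  | timesR {Ψ Ψ₁ Ψ₂ Γ Δ p q x M P τ A} : Inv Γ Δ x (.times τ A) → FCtx.Split Ψ Ψ₁ Ψ₂ →
      ETy sg Ψ₁ p M τ → PTy sg Ψ₂ Γ Δ q P x A →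
      PTyCore sg Ψ Γ Δ (p + q) (.sendV x M P) x (.times τ A)
  | timesL {Ψ Γ Δ q x y Q τ A z C} : Inv Γ ((x, .times τ A) ::ₘ Δ) z C →
      PTy sg (Ψ.ext y τ) Γ ((x, A) ::ₘ Δ) q Q z C →
      PTyCore sg Ψ Γ ((x, .times τ A) ::ₘ Δ) q (.recvV x y Q) z C
  | arrowR {Ψ Γ Δ q x y P τ A} : Inv Γ Δ x (.arrow τ A) →
      PTy sg (Ψ.ext y τ) Γ Δ q P x A → PTyCore sg Ψ Γ Δ q (.recvV x y P) x (.arrow τ A)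
  | arrowL {Ψ Ψ₁ Ψ₂ Γ Δ p q x M Q τ A z C} : Inv Γ ((x, .arrow τ A) ::ₘ Δ) z C →
      FCtx.Split Ψ Ψ₁ Ψ₂ → ETy sg Ψ₁ p M τ → PTy sg Ψ₂ Γ ((x, A) ::ₘ Δ) q Q z C →
      PTyCore sg Ψ Γ ((x, .arrow τ A) ::ₘ Δ) (p + q) (.sendV x M Q) z C
  | oneR {Ψ Γ x} : Inv Γ 0 x .one → PTyCore sg Ψ Γ 0 0 (.close x) x .one
  | oneL {Ψ Γ Δ q x Q z C} : Inv Γ ((x, .one) ::ₘ Δ) z C → PTy sg Ψ Γ Δ q Q z C →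
      PTyCore sg Ψ Γ ((x, .one) ::ₘ Δ) q (.wait x Q) z C
  | work {Ψ Γ Δ p r P z C} : Inv Γ Δ z C → PTy sg Ψ Γ Δ p P z C →
      PTyCore sg Ψ Γ Δ (p + r) (.work r P) z C
  | payR {Ψ Γ Δ p r x P A} : Inv Γ Δ x (.pay r A) → PTy sg Ψ Γ Δ p P x A →
      PTyCore sg Ψ Γ Δ (p + r) (.pay x r P) x (.pay r A)
  | payL {Ψ Γ Δ q r x P A z C} : Inv Γ ((x, .pay r A) ::ₘ Δ) z C →
      PTy sg Ψ Γ ((x, A) ::ₘ Δ) (q + r) P z C →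
      PTyCore sg Ψ Γ ((x, .pay r A) ::ₘ Δ) q (.get x r P) z C
  | getR {Ψ Γ Δ q r x P A} : Inv Γ Δ x (.get r A) → PTy sg Ψ Γ Δ (q + r) P x A →
      PTyCore sg Ψ Γ Δ q (.get x r P) x (.get r A)
  | getL {Ψ Γ Δ p r x P A z C} : Inv Γ ((x, .get r A) ::ₘ Δ) z C →
      PTy sg Ψ Γ ((x, A) ::ₘ Δ) p P z C →
      PTyCore sg Ψ Γ ((x, .get r A) ::ₘ Δ) (p + r) (.pay x r P) z C
  | upR {Ψ Γ Δ q x y P A} : Inv Γ Δ x (.up A) → x.mode = .S → Purelin Δ →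
      New (.var y .L) Γ Δ x → PTy sg Ψ Γ Δ q P (.var y .L) A →
      PTyCore sg Ψ Γ Δ q (.accept y x P) x (.up A)
  | upL {Ψ Γ Δ q x y Q A z C} : Inv Γ Δ z C → (z.mode = .L ∨ z.mode = .C) → (x, .up A) ∈ Γ →
      New (.var y .L) Γ Δ z → PTy sg Ψ Γ ((.var y .L, A) ::ₘ Δ) q Q z C →
      PTyCore sg Ψ Γ Δ q (.acquire y x Q) z C
  | downR {Ψ Γ Δ q x y P A} : Inv Γ Δ x (.down A) → x.mode = .L → Purelin Δ →
      New (.var y .S) Γ Δ x → PTy sg Ψ Γ Δ q P (.var y .S) A →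
      PTyCore sg Ψ Γ Δ q (.detach y x P) x (.down A)
  | downL {Ψ Γ Δ q x y Q A z C} : Inv Γ ((x, .down A) ::ₘ Δ) z C → x.mode = .L →
      (z.mode = .L ∨ z.mode = .C) → New (.var y .S) Γ Δ z →
      PTy sg Ψ ((.var y .S, A) ::ₘ Γ) Δ q Q z C →
      PTyCore sg Ψ Γ ((x, .down A) ::ₘ Δ) q (.release y x Q) z C

/-- Any stack of weakenings at the root collapses to a single inequality, after which inversion is a
plain case analysis. -/
theorem ETy.core {Ψ q M τ} (h : ETy sg Ψ q M τ) : ∃ q₀ ≤ q, ETyCore sg Ψ q₀ M τ := by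
  induction h using ETy.rec (motive_2 := fun _ _ _ _ _ _ _ _ => True)
  all_goals intros
  all_goals first
    | trivial
    | exact ⟨_, le_rfl, by constructor <;> assumption⟩
    | (rename_i hq _ ih
       obtain ⟨q₀, h₀, h⟩ := ih
       exact ⟨q₀, h₀.trans hq, h⟩)

theorem PTy.core {Ψ Γ Δ q P z C} (h : PTy sg Ψ Γ Δ q P z C) :
    ∃ q₀ ≤ q, PTyCore sg Ψ Γ Δ q₀ P z C := by
  induction h using PTy.rec (motive_1 := fun _ _ _ _ _ => True)
  all_goals intros
  all_goals first
    | trivial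
    | exact ⟨_, le_rfl, by constructor <;> assumption⟩
    | (rename_i hq _ ih
       obtain ⟨q₀, h₀, h⟩ := ih
       exact ⟨q₀, h₀.trans hq, h⟩)

theorem PTy.inv {Ψ Γ Δ q P z C} (h : PTy sg Ψ Γ Δ q P z C) : Inv Γ Δ z C := by
  obtain ⟨_, _, h⟩ := h.core
  cases h <;> assumption

/-! ## Substitution of values -/

theorem FCtx.Sub.ext {Ψ Ψ' : FCtx sg} (h : FCtx.Sub Ψ Ψ') (x : ℕ) (τ : FType sg) :
    FCtx.Sub (Ψ.ext x τ) (Ψ'.ext x τ) := by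
  intro y
  by_cases hy : y = x
  · subst hy; right; simp [FCtx.ext]
  · simpa [FCtx.ext, hy] using h y

theorem FCtx.Sub.trans {Ψ Ψ' Ψ'' : FCtx sg} (h : FCtx.Sub Ψ Ψ') (h' : FCtx.Sub Ψ' Ψ'') :
    FCtx.Sub Ψ Ψ'' := by
  intro y
  rcases h y with h₁ | h₁
  · exact .inl h₁
  · rw [h₁]; exact h' y

/-- Contexts are affine: the variables that only the larger context has go to neither half. -/
theorem FCtx.Sub.split {Ψ Ψ' Ψ₁ Ψ₂ : FCtx sg} (h : FCtx.Sub Ψ Ψ') (hs : FCtx.Split Ψ Ψ₁ Ψ₂) :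
    FCtx.Split Ψ' Ψ₁ Ψ₂ := by
  intro y
  rcases h y with h₁ | h₁
  · have h₂ := hs y
    rw [h₁] at h₂
    generalize Ψ₁ y = a at h₂ ⊢
    generalize Ψ₂ y = b at h₂ ⊢
    cases h₂
    cases Ψ' y with
    | none => exact .none
    | some τ => exact .drop
  · rw [← h₁]; exact hs y

/-- Needed to place a closed value under an arbitrary context. A rule with a split or a subcontext
absorbs the extra variables at that point, so that its premises remain as they are. -/
theorem ETy.weaken {Ψ q M τ} (h : ETy sg Ψ q M τ) :
    ∀ {Ψ' : FCtx sg}, FCtx.Sub Ψ Ψ' → ETy sg Ψ' q M τ := by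
  induction h using ETy.rec (motive_2 := fun Ψ Γ Δ q P z C _ =>
    ∀ {Ψ' : FCtx sg}, FCtx.Sub Ψ Ψ' → PTy sg Ψ' Γ Δ q P z C)
  all_goals intros
  case var h _ hs =>
    refine .var ?_
    rcases hs _ with h₁ | h₁
    · rw [h] at h₁; cases h₁
    · rw [← h₁, h]
  case lam h hf hM _ _ hs => exact .lam (h.trans hs) hf hM
  case app h hM hN _ _ _ hs => exact .app (hs.split h) hM hN
  case cases h hM hl hr _ _ _ _ hs => exact .cases (hs.split h) hM hl hr
  case pair h hM hN _ _ _ hs => exact .pair (hs.split h) hM hN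
  case ite h hM hl hr _ _ _ _ hs => exact .ite (hs.split h) hM hl hr
  case cons h hM hN _ _ _ hs => exact .cons (hs.split h) hM hN
  case mtch h hM hl hr _ _ _ _ hs => exact .mtch (hs.split h) hM hl hr
  case spawnR hs => apply PTy.spawnR <;> first | assumption | exact hs.split ‹_›
  case spawnS hs => apply PTy.spawnS <;> first | assumption | exact hs.split ‹_›
  case spawnC hs => apply PTy.spawnC <;> first | assumption | exact hs.split ‹_›
  case timesR hs => apply PTy.timesR <;> first | assumption | exact hs.split ‹_›
  case arrowL hs => apply PTy.arrowL <;> first | assumption | exact hs.split ‹_›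
  case timesL ih _ hs => exact .timesL ‹_› (ih (hs.ext _ _))
  case arrowR ih _ hs => exact .arrowR ‹_› (ih (hs.ext _ _))
  case ichoiceL ih _ hs => exact .ichoiceL ‹_› fun l hl => ih l hl hs
  case echoiceR ih _ hs => exact .echoiceR ‹_› fun l hl => ih l hl hs
  case proc ih _ hs => exact .proc ‹_› ‹_› ‹_› ‹_› (ih hs)
  case tick ih _ hs => exact .tick (ih hs)
  case fn => exact .fn
  case int => exact .int
  case bool => exact .bool
  case nil => exact .nil
  case inl ih _ hs => exact .inl (ih hs)
  case inr ih _ hs => exact .inr (ih hs)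
  case projl ih _ hs => exact .projl (ih hs)
  case projr ih _ hs => exact .projr (ih hs)
  case relax hq _ ih _ hs => exact .relax hq (ih hs)
  case relax hq _ ih _ hs => exact .relax hq (ih hs)
  case fwd => exact .fwd ‹_› ‹_› ‹_›
  case ichoiceR ih _ hs => exact .ichoiceR ‹_› ‹_› (ih hs)
  case echoiceL ih _ hs => exact .echoiceL ‹_› ‹_› (ih hs)
  case tensorR ih _ hs => exact .tensorR ‹_› ‹_› (ih hs)
  case tensorL ih _ hs => exact .tensorL ‹_› ‹_› (ih hs)
  case lolliR ih _ hs => exact .lolliR ‹_› ‹_› (ih hs)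
  case lolliL ih _ hs => exact .lolliL ‹_› ‹_› (ih hs)
  case oneR => exact .oneR ‹_›
  case oneL ih _ hs => exact .oneL ‹_› (ih hs)
  case work ih _ hs => exact .work ‹_› (ih hs)
  case payR ih _ hs => exact .payR ‹_› (ih hs)
  case payL ih _ hs => exact .payL ‹_› (ih hs)
  case getR ih _ hs => exact .getR ‹_› (ih hs)
  case getL ih _ hs => exact .getL ‹_› (ih hs)
  case upR ih _ hs => exact .upR ‹_› ‹_› ‹_› ‹_› (ih hs)
  case upL ih _ hs => exact .upL ‹_› ‹_› ‹_› ‹_› (ih hs)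
  case downR ih _ hs => exact .downR ‹_› ‹_› ‹_› ‹_› (ih hs)
  case downL ih _ hs => exact .downL ‹_› ‹_› ‹_› ‹_› (ih hs)

-- Closed values and the splitting of their potential

theorem FCtx.empty_sub (Ψ : FCtx sg) : FCtx.Sub FCtx.empty Ψ := fun _ => .inl rfl

theorem FCtx.Sub.eq_empty {Ψ : FCtx sg} (h : FCtx.Sub Ψ FCtx.empty) : Ψ = FCtx.empty := by
  funext x
  rcases h x with h | h <;> exact h

theorem FCtx.Split.eq_empty {Ψ₁ Ψ₂ : FCtx sg} (h : FCtx.Split FCtx.empty Ψ₁ Ψ₂) :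
    Ψ₁ = FCtx.empty ∧ Ψ₂ = FCtx.empty := by
  constructor <;> funext x <;> have hx := h x <;> revert hx <;>
    generalize Ψ₁ x = a <;> generalize Ψ₂ x = b <;> rintro ⟨⟩ <;> rfl

theorem Share.step {τ τ₁ τ₂ : FType sg} (h : Share τ τ₁ τ₂) : ShareStep Share τ τ₁ τ₂ := by
  obtain ⟨H, hH, h⟩ := h
  have key : ∀ {a b c}, H a b c → Share a b c := fun h => ⟨H, hH, h⟩
  cases hH _ _ _ h with
  | int => exact .int
  | bool => exact .bool
  | arrow => exact .arrow
  | sum h₁ h₂ => exact .sum (key h₁) (key h₂)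
  | prod h₁ h₂ => exact .prod (key h₁) (key h₂)
  | list h₁ => exact .list (key h₁)

/-- The potential of a closed value is split along with its type. -/
theorem IsVal.share {V : Expr} (hV : IsVal V) :
    ∀ {p} {τ τ₁ τ₂ : FType sg}, ETy sg FCtx.empty p V τ → Share τ τ₁ τ₂ →
      ∃ p₁ p₂, p₁ + p₂ ≤ p ∧ ETy sg FCtx.empty p₁ V τ₁ ∧ ETy sg FCtx.empty p₂ V τ₂ := by
  induction hV with
  | lam =>
    intro p τ τ₁ τ₂ h hs
    obtain ⟨p₀, hp, h⟩ := h.core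
    generalize hσ : τ = σ at h
    cases h with
    | lam h₁ h₂ h₃ =>
      cases hs.step with
      | arrow => exact ⟨0, 0, by omega, hσ ▸ .lam h₁ h₂ h₃, hσ ▸ .lam h₁ h₂ h₃⟩
      | _ => cases FType.match_of_eq hσ
  | inl _ ih =>
    intro p τ τ₁ τ₂ h hs
    obtain ⟨p₀, hp, h⟩ := h.core
    generalize hσ : τ = σ at h
    cases h with
    | inl h₁ =>
      cases hs.step with
      | sum ha hb =>
        obtain ⟨rfl, rfl⟩ := FType.sum_inj hσ
        obtain ⟨p₁, p₂, hle, h₁, h₂⟩ := ih h₁ ha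
        exact ⟨p₁, p₂, hle.trans hp, .inl h₁, .inl h₂⟩
      | _ => cases FType.match_of_eq hσ
  | inr _ ih =>
    intro p τ τ₁ τ₂ h hs
    obtain ⟨p₀, hp, h⟩ := h.core
    generalize hσ : τ = σ at h
    cases h with
    | inr h₁ =>
      cases hs.step with
      | sum ha hb =>
        obtain ⟨rfl, rfl⟩ := FType.sum_inj hσ
        obtain ⟨p₁, p₂, hle, h₁, h₂⟩ := ih h₁ hb
        exact ⟨p₁, p₂, hle.trans hp, .inr h₁, .inr h₂⟩
      | _ => cases FType.match_of_eq hσ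
  | pair _ _ ih ih' =>
    intro p τ τ₁ τ₂ h hs
    obtain ⟨p₀, hp, h⟩ := h.core
    generalize hσ : τ = σ at h
    cases h with
    | pair hsp h₁ h₂ =>
      obtain ⟨rfl, rfl⟩ := hsp.eq_empty
      cases hs.step with
      | prod ha hb =>
        obtain ⟨rfl, rfl⟩ := FType.prod_inj hσ
        obtain ⟨p₁, p₂, hle, h₁, h₂⟩ := ih h₁ ha
        obtain ⟨p₃, p₄, hle', h₃, h₄⟩ := ih' ‹_› hb
        exact ⟨p₁ + p₃, p₂ + p₄, by omega, .pair hsp h₁ h₃, .pair hsp h₂ h₄⟩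
      | _ => cases FType.match_of_eq hσ
  | int =>
    intro p τ τ₁ τ₂ h hs
    obtain ⟨p₀, hp, h⟩ := h.core
    generalize hσ : τ = σ at h
    cases h with
    | int =>
      cases hs.step with
      | int => exact ⟨0, 0, by omega, .int, .int⟩
      | _ => cases FType.match_of_eq hσ
  | bool =>
    intro p τ τ₁ τ₂ h hs
    obtain ⟨p₀, hp, h⟩ := h.core
    generalize hσ : τ = σ at h
    cases h with
    | bool =>
      cases hs.step with
      | bool => exact ⟨0, 0, by omega, .bool, .bool⟩
      | _ => cases FType.match_of_eq hσ
  | nil =>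
    intro p τ τ₁ τ₂ h hs
    obtain ⟨p₀, hp, h⟩ := h.core
    generalize hσ : τ = σ at h
    cases h with
    | nil =>
      cases hs.step with
      | list => exact ⟨0, 0, by omega, .nil, .nil⟩
      | _ => cases FType.match_of_eq hσ
  | cons _ _ ih ih' =>
    intro p τ τ₁ τ₂ h hs
    obtain ⟨p₀, hp, h⟩ := h.core
    generalize hσ : τ = σ at h
    cases h with
    | cons hsp h₁ h₂ =>
      obtain ⟨rfl, rfl⟩ := hsp.eq_empty
      -- The tail has the same list type as the whole list, so the original sharing is used once
      -- more for it.
      have hs' := hs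
      cases hs.step with
      | list ha =>
        obtain ⟨rfl, rfl⟩ := FType.list_inj hσ
        obtain ⟨p₁, p₂, hle, h₁, h₂⟩ := ih h₁ ha
        obtain ⟨p₃, p₄, hle', h₃, h₄⟩ := ih' ‹_› hs'
        exact ⟨_, _, by omega, .cons hsp h₁ h₃, .cons hsp h₂ h₄⟩
      | _ => cases FType.match_of_eq hσ
  | proc =>
    intro p τ τ₁ τ₂ h hs
    obtain ⟨p₀, hp, h⟩ := h.core
    generalize hσ : τ = σ at h
    cases h with
    -- No sharing rule has a monadic type, whose potential could not be split.
    | proc => cases hs.step <;> cases FType.match_of_eq hσ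

/-- A closed value of a type that can be copied carries no potential. -/
theorem IsVal.free {V : Expr} (hV : IsVal V) :
    ∀ {p} {τ : FType sg}, ETy sg FCtx.empty p V τ → Share τ τ τ → ETy sg FCtx.empty 0 V τ := by
  intro p
  induction p using Nat.strong_induction_on with
  | _ p ih =>
    intro τ h hs
    obtain ⟨p₁, p₂, hle, h₁, h₂⟩ := hV.share h hs
    rcases Nat.eq_zero_or_pos p with rfl | hp
    · exact h
    -- Both halves are again typings at `τ`. As `p₁ + p₂ ≤ p` and `p` is positive, at least one of
    -- them has strictly smaller potential.
    · by_cases h' : p₁ < p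
      · exact ih _ h' h₁ hs
      · exact ih _ (by omega) h₂ hs

/-- The closed expression `V` may be substituted, with potential `p`, for a variable that is
declared as `o`. -/
def Fits (V : Expr) (o : Option (FType sg)) (p : ℕ) : Prop :=
  ∀ τ, o = some τ → ETy sg FCtx.empty p V τ

theorem Fits.split {V : Expr} (hV : IsVal V) {o o₁ o₂ : Option (FType sg)} {p} (h : Fits V o p)
    (hs : OptShare o o₁ o₂) : ∃ p₁ p₂, p₁ + p₂ ≤ p ∧ Fits V o₁ p₁ ∧ Fits V o₂ p₂ := by
  have hn : ∀ q, Fits V (none : Option (FType sg)) q := fun _ _ h => by cases h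
  cases hs with
  | none => exact ⟨0, 0, by omega, hn _, hn _⟩
  | both hs =>
    obtain ⟨p₁, p₂, hle, h₁, h₂⟩ := hV.share (h _ rfl) hs
    exact ⟨p₁, p₂, hle, fun _ e => by cases e; exact h₁, fun _ e => by cases e; exact h₂⟩
  | left => exact ⟨p, 0, by omega, h, hn _⟩
  | right => exact ⟨0, p, by omega, hn _, h⟩
  | drop => exact ⟨0, 0, by omega, hn _, hn _⟩

/-- `Ψ` without the variable `x`. -/
def FCtx.del (Ψ : FCtx sg) (x : ℕ) : FCtx sg := Function.update Ψ x none

theorem FCtx.del_ext_self (Ψ : FCtx sg) (x : ℕ) (τ : FType sg) : (Ψ.del x).ext x τ = Ψ.ext x τ := by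
  simp [FCtx.del, FCtx.ext]

theorem FCtx.del_ext {x y : ℕ} (h : y ≠ x) (Ψ : FCtx sg) (τ : FType sg) :
    (Ψ.del x).ext y τ = (Ψ.ext y τ).del x := by
  simp [FCtx.del, FCtx.ext, Function.update_comm h]

theorem FCtx.ext_apply {x y : ℕ} (h : y ≠ x) (Ψ : FCtx sg) (τ : FType sg) :
    (Ψ.ext y τ) x = Ψ x := by
  simp [FCtx.ext, Ne.symm h]

theorem FCtx.Split.del {Ψ Ψ₁ Ψ₂ : FCtx sg} (h : FCtx.Split Ψ Ψ₁ Ψ₂) (x : ℕ) :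
    FCtx.Split (Ψ.del x) (Ψ₁.del x) (Ψ₂.del x) := by
  intro y
  by_cases hy : y = x
  · subst hy; simpa [FCtx.del] using OptShare.none
  · simpa [FCtx.del, hy] using h y

theorem FCtx.Sub.del {Ψ Ψ' : FCtx sg} (h : FCtx.Sub Ψ Ψ') (x : ℕ) :
    FCtx.Sub (Ψ.del x) (Ψ'.del x) := by
  intro y
  by_cases hy : y = x
  · subst hy; left; simp [FCtx.del]
  · simpa [FCtx.del, hy] using h y

theorem FCtx.Free.del {Ψ : FCtx sg} (h : FCtx.Free Ψ) (x : ℕ) : FCtx.Free (Ψ.del x) := by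
  intro y τ hy
  by_cases hxy : y = x
  · subst hxy; simp [FCtx.del] at hy
  · exact h y τ (by simpa [FCtx.del, hxy] using hy)

/-- A binder for `x` itself stops the substitution, and then the potential of the value is wasted.
Any other binder commutes with the removal of `x` from the context. -/
theorem ETy.vsub_binder {x y : ℕ} {V M : Expr} {Ψ : FCtx sg} {τ σ : FType sg} {p q : ℕ}
    (h : ETy sg (Ψ.ext y τ) q M σ)
    (ih : ∀ p, Fits V ((Ψ.ext y τ) x) p → ETy sg ((Ψ.ext y τ).del x) (q + p) (Expr.vsub x V M) σ)
    (hp : Fits V (Ψ x) p) :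
    ETy sg ((Ψ.del x).ext y τ) (q + p) (if y = x then M else Expr.vsub x V M) σ := by
  split_ifs with hy
  · subst hy
    rw [FCtx.del_ext_self]
    exact h.relax (by omega)
  · rw [FCtx.del_ext hy]
    exact ih p (by rwa [FCtx.ext_apply hy])

theorem PTy.vsub_binder {x y : ℕ} {V : Expr} {P : Proc} {Ψ : FCtx sg} {Γ Δ z C} {τ : FType sg}
    {p q : ℕ} (h : PTy sg (Ψ.ext y τ) Γ Δ q P z C)
    (ih : ∀ p, Fits V ((Ψ.ext y τ) x) p → PTy sg ((Ψ.ext y τ).del x) Γ Δ (q + p) (P.vsub x V) z C)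
    (hp : Fits V (Ψ x) p) :
    PTy sg ((Ψ.del x).ext y τ) Γ Δ (q + p) (if y = x then P else P.vsub x V) z C := by
  split_ifs with hy
  · subst hy
    rw [FCtx.del_ext_self]
    exact h.relax (by omega)
  · rw [FCtx.del_ext hy]
    exact ih p (by rwa [FCtx.ext_apply hy])

/-- Expressions and processes contain each other, so the two claims are proved by the same mutual
induction, run once for each judgment with identical cases. At a split of the context, `Fits.split`
divides the potential of the value between the premises. -/
theorem typing_vsub {x : ℕ} {V : Expr} (hV : IsVal V) :
    (∀ {Ψ : FCtx sg} {q M σ}, ETy sg Ψ q M σ → ∀ p, Fits V (Ψ x) p →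
      ETy sg (Ψ.del x) (q + p) (Expr.vsub x V M) σ) ∧
    (∀ {Ψ : FCtx sg} {Γ Δ q P z C}, PTy sg Ψ Γ Δ q P z C → ∀ p, Fits V (Ψ x) p →
      PTy sg (Ψ.del x) Γ Δ (q + p) (P.vsub x V) z C) := by
  constructor
  case' left =>
    intro Ψ q M σ h
    induction h using ETy.rec (motive_2 := fun Ψ Γ Δ q P z C _ => ∀ p, Fits V (Ψ x) p →
      PTy sg (Ψ.del x) Γ Δ (q + p) (P.vsub x V) z C)
  case' right =>
    intro Ψ Γ Δ q P z C h
    induction h using PTy.rec (motive_1 := fun Ψ q M σ _ => ∀ p, Fits V (Ψ x) p →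
      ETy sg (Ψ.del x) (q + p) (Expr.vsub x V M) σ)
  all_goals intros
  all_goals try simp only [Expr.vsub, Proc.vsub]
  case var h p hp | var h p hp =>
    split_ifs with hy
    · subst hy
      exact ((hp _ h).weaken (FCtx.empty_sub _)).relax (by omega)
    · exact .relax (Nat.zero_le _) (.var (by simpa [FCtx.del, hy] using h))
  case lam Ψ Ψ₀ p₀ y τ M σ h hf hM ih p hp | lam Ψ Ψ₀ p₀ y τ M σ h hf hM ih p hp =>
    refine .relax (Nat.zero_le _) (.lam (h.del x) (hf.del x) ?_)
    -- The body must keep its potential, since it is the annotation of the arrow type. A captured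
    -- variable has a type that can be copied, so the value is retyped with potential 0.
    refine ETy.vsub_binder (p := 0) hM ih fun τ hτ => ?_
    refine hV.free (hp τ ?_) (hf _ _ hτ)
    rcases h x with h | h
    · rw [h] at hτ; cases hτ
    · rw [← h, hτ]
  case app hs hM hN ih ih' p hp | app hs hM hN ih ih' p hp =>
    obtain ⟨p₁, p₂, hle, h₁, h₂⟩ := hp.split hV (hs x)
    exact .relax (by omega) (.app (hs.del x) (ih _ h₁) (ih' _ h₂))
  case cases hs hM hl hr ih ihl ihr p hp | cases hs hM hl hr ih ihl ihr p hp =>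
    obtain ⟨p₁, p₂, hle, h₁, h₂⟩ := hp.split hV (hs x)
    exact .relax (by omega) (.cases (hs.del x) (ih _ h₁) (.vsub_binder hl ihl h₂)
      (.vsub_binder hr ihr h₂))
  case pair hs hM hN ih ih' p hp | pair hs hM hN ih ih' p hp =>
    obtain ⟨p₁, p₂, hle, h₁, h₂⟩ := hp.split hV (hs x)
    exact .relax (by omega) (.pair (hs.del x) (ih _ h₁) (ih' _ h₂))
  case ite hs hM hl hr ih ihl ihr p hp | ite hs hM hl hr ih ihl ihr p hp =>
    obtain ⟨p₁, p₂, hle, h₁, h₂⟩ := hp.split hV (hs x)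
    exact .relax (by omega) (.ite (hs.del x) (ih _ h₁) (ihl _ h₂) (ihr _ h₂))
  case cons hs hM hN ih ih' p hp | cons hs hM hN ih ih' p hp =>
    obtain ⟨p₁, p₂, hle, h₁, h₂⟩ := hp.split hV (hs x)
    exact .relax (by omega) (.cons (hs.del x) (ih _ h₁) (ih' _ h₂))
  case mtch Ψ Ψ₁ Ψ₂ r q₁ q₂ M N₁ y ys N₂ τ σ hs hM hl hr ih ihl ihr p hp |
      mtch Ψ Ψ₁ Ψ₂ r q₁ q₂ M N₁ y ys N₂ τ σ hs hM hl hr ih ihl ihr p hp =>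
    obtain ⟨p₁, p₂, hle, h₁, h₂⟩ := hp.split hV (hs x)
    refine .relax (by omega) (.mtch (hs.del x) (ih _ h₁) (ihl _ h₂) (?_ : ETy sg _ (_ + r) _ _))
    rw [Nat.add_right_comm]
    -- If one of the two binders shadows `x`, the branch is untouched and its context does not see
    -- that `x` was removed.
    split_ifs with hy
    · refine .relax (Nat.le_add_right _ _) ?_
      by_cases hys : ys = x
      · subst hys
        by_cases hyy : y = ys
        · subst hyy; rwa [FCtx.del_ext_self]
        · rwa [FCtx.del_ext hyy, FCtx.del_ext_self]
      · obtain rfl := hy.resolve_right hys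
        rwa [FCtx.del_ext_self]
    · rw [not_or] at hy
      rw [FCtx.del_ext hy.1, FCtx.del_ext hy.2]
      exact ihr _ (by rwa [FCtx.ext_apply hy.2, FCtx.ext_apply hy.1])
  case spawnR hs hn hM hQ ih ih' p hp | spawnR hs hn hM hQ ih ih' p hp =>
    obtain ⟨p₁, p₂, hle, h₁, h₂⟩ := hp.split hV (hs x)
    exact .relax (by omega) (.spawnR ‹_› ‹_› ‹_› (hs.del x) hn (ih _ h₁) (ih' _ h₂))
  case spawnS hs hn hM hQ ih ih' p hp | spawnS hs hn hM hQ ih ih' p hp =>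
    obtain ⟨p₁, p₂, hle, h₁, h₂⟩ := hp.split hV (hs x)
    exact .relax (by omega)
      (.spawnS ‹_› ‹_› ‹_› ‹_› ‹_› ‹_› (hs.del x) hn (ih _ h₁) (ih' _ h₂))
  case spawnC hs hn hM hQ ih ih' p hp | spawnC hs hn hM hQ ih ih' p hp =>
    obtain ⟨p₁, p₂, hle, h₁, h₂⟩ := hp.split hV (hs x)
    exact .relax (by omega) (.spawnC ‹_› ‹_› ‹_› ‹_› (hs.del x) hn (ih _ h₁) (ih' _ h₂))
  case timesR hi hs hM hQ ih ih' p hp | timesR hi hs hM hQ ih ih' p hp =>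
    obtain ⟨p₁, p₂, hle, h₁, h₂⟩ := hp.split hV (hs x)
    exact .relax (by omega) (.timesR hi (hs.del x) (ih _ h₁) (ih' _ h₂))
  case arrowL hi hs hM hQ ih ih' p hp | arrowL hi hs hM hQ ih ih' p hp =>
    obtain ⟨p₁, p₂, hle, h₁, h₂⟩ := hp.split hV (hs x)
    exact .relax (by omega) (.arrowL hi (hs.del x) (ih _ h₁) (ih' _ h₂))
  case timesL hi h ih p hp | timesL hi h ih p hp => exact .timesL hi (.vsub_binder h ih hp)
  case arrowR hi h ih p hp | arrowR hi h ih p hp => exact .arrowR hi (.vsub_binder h ih hp)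
  case ichoiceL hi h ih p hp | ichoiceL hi h ih p hp =>
    exact .ichoiceL hi fun l hl => ih l hl p hp
  case echoiceR hi h ih p hp | echoiceR hi h ih p hp =>
    exact .echoiceR hi fun l hl => ih l hl p hp
  case proc ih p hp | proc ih p hp => exact .proc ‹_› ‹_› ‹_› ‹_› (ih p hp)
  case tick ih p hp | tick ih p hp => exact .relax (by omega) (.tick (ih p hp))
  case fn | fn => exact .relax (by omega) .fn
  case int | int => exact .relax (by omega) .int
  case bool | bool => exact .relax (by omega) .bool
  case nil | nil => exact .relax (by omega) .nil
  case inl ih p hp | inl ih p hp => exact .inl (ih p hp)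
  case inr ih p hp | inr ih p hp => exact .inr (ih p hp)
  case projl ih p hp | projl ih p hp => exact .projl (ih p hp)
  case projr ih p hp | projr ih p hp => exact .projr (ih p hp)
  case relax hq _ ih p hp | relax hq _ ih p hp => exact .relax (by omega) (ih p hp)
  case relax hq _ ih p hp | relax hq _ ih p hp => exact .relax (by omega) (ih p hp)
  case fwd | fwd => exact .relax (by omega) (.fwd ‹_› ‹_› ‹_›)
  case ichoiceR ih p hp | ichoiceR ih p hp => exact .ichoiceR ‹_› ‹_› (ih p hp)
  case echoiceL ih p hp | echoiceL ih p hp => exact .echoiceL ‹_› ‹_› (ih p hp)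
  case tensorR ih p hp | tensorR ih p hp => exact .tensorR ‹_› ‹_› (ih p hp)
  case tensorL ih p hp | tensorL ih p hp => exact .tensorL ‹_› ‹_› (ih p hp)
  case lolliR ih p hp | lolliR ih p hp => exact .lolliR ‹_› ‹_› (ih p hp)
  case lolliL ih p hp | lolliL ih p hp => exact .lolliL ‹_› ‹_› (ih p hp)
  case oneR | oneR => exact .relax (by omega) (.oneR ‹_›)
  case oneL ih p hp | oneL ih p hp => exact .oneL ‹_› (ih p hp)
  case work ih p hp | work ih p hp => exact .relax (by omega) (.work ‹_› (ih p hp))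
  case payR ih p hp | payR ih p hp => exact .relax (by omega) (.payR ‹_› (ih p hp))
  case payL ih p hp | payL ih p hp => exact .payL ‹_› (.relax (by omega) (ih p hp))
  case getR ih p hp | getR ih p hp => exact .getR ‹_› (.relax (by omega) (ih p hp))
  case getL ih p hp | getL ih p hp => exact .relax (by omega) (.getL ‹_› (ih p hp))
  case upR ih p hp | upR ih p hp => exact .upR ‹_› ‹_› ‹_› ‹_› (ih p hp)
  case upL ih p hp | upL ih p hp => exact .upL ‹_› ‹_› ‹_› ‹_› (ih p hp)
  case downR ih p hp | downR ih p hp => exact .downR ‹_› ‹_› ‹_› ‹_› (ih p hp)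
  case downL ih p hp | downL ih p hp => exact .downL ‹_› ‹_› ‹_› ‹_› (ih p hp)

theorem FCtx.del_ext_empty (x : ℕ) (τ : FType sg) :
    (FCtx.empty.ext x τ).del x = FCtx.empty := by
  funext y
  by_cases h : y = x <;> simp [FCtx.del, FCtx.ext, FCtx.empty, h]

theorem ETy.vsub {Ψ : FCtx sg} {x : ℕ} {τ σ : FType sg} {p q V M}
    (h : ETy sg (Ψ.ext x τ) q M σ) (hV : IsVal V) (hT : ETy sg FCtx.empty p V τ) :
    ETy sg ((Ψ.ext x τ).del x) (q + p) (Expr.vsub x V M) σ :=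
  (typing_vsub hV).1 h p fun _ e => by
    obtain rfl : τ = _ := by simpa [FCtx.ext] using e
    exact hT

theorem PTy.vsub_empty {x : ℕ} {τ : FType sg} {p q V P Γ Δ z C}
    (h : PTy sg (FCtx.empty.ext x τ) Γ Δ q P z C) (hV : IsVal V) (hT : ETy sg FCtx.empty p V τ) :
    PTy sg FCtx.empty Γ Δ (q + p) (P.vsub x V) z C :=
  FCtx.del_ext_empty x τ ▸ (typing_vsub hV).2 h p fun _ e => by
    obtain rfl : τ = _ := by simpa [FCtx.ext] using e
    exact hT

theorem ETy.vsub_empty {x : ℕ} {τ σ : FType sg} {p q V M}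
    (h : ETy sg (FCtx.empty.ext x τ) q M σ) (hV : IsVal V) (hT : ETy sg FCtx.empty p V τ) :
    ETy sg FCtx.empty (q + p) (Expr.vsub x V M) σ :=
  FCtx.del_ext_empty x τ ▸ h.vsub hV hT

/-- This is the substitution made by a list match: the tail first, then the head. If both variables
coincide, the tail shadows the head and the second substitution concerns a variable that is no
longer in the context, so that any potential fits. -/
theorem ETy.vsub_empty₂ {x xs : ℕ} {τ τ' σ : FType sg} {p p' q V W M}
    (h : ETy sg ((FCtx.empty.ext x τ).ext xs τ') q M σ) (hV : IsVal V)
    (hT : ETy sg FCtx.empty p V τ) (hW : IsVal W) (hT' : ETy sg FCtx.empty p' W τ') :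
    ETy sg FCtx.empty (q + p' + p) (Expr.vsub x V (Expr.vsub xs W M)) σ := by
  have h₁ := h.vsub hW hT'
  have h₂ := (typing_vsub (x := x) hV).1 h₁ p fun σ' e => by
    by_cases hx : x = xs
    · simp [FCtx.del, hx] at e
    · obtain rfl : τ = σ' := by simpa [FCtx.del, FCtx.ext, hx] using e
      exact hT
  have h₃ : (((FCtx.empty.ext x τ).ext xs τ').del xs).del x = FCtx.empty := by
    funext y
    by_cases h : y = x <;> by_cases h' : y = xs <;>
      simp_all [FCtx.del, FCtx.ext, FCtx.empty, Function.update_apply]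
  rwa [h₃] at h₂

/-! ## Preservation for expressions -/

/-- The remaining potential is an existential `r` with `r + μ ≤ q`, which avoids truncated
subtraction and composes along subevaluations. That the result is a value is proved simultaneously,
because the substitution lemma applies to values only. -/
theorem Eval.preservation (hsg : sg.WF) {M V μ} (h : Eval sg M V μ) :
    ∀ {q τ}, ETy sg FCtx.empty q M τ →
      IsVal V ∧ ∃ r, r + μ ≤ q ∧ ETy sg FCtx.empty r V τ := by
  induction h with
  | fn _ ih =>
    intro q τ h
    obtain ⟨q₀, hq, h⟩ := h.core
    cases h
    obtain ⟨hV, r, hr, h⟩ := ih (hsg _)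
    exact ⟨hV, r, by omega, h⟩
  | lam =>
    intro q τ h
    exact ⟨.lam, q, by omega, h⟩
  | app _ _ _ ih₁ ih₂ ih₃ =>
    intro q τ h
    obtain ⟨q₀, hq, h⟩ := h.core
    cases h with
    | app hs h₁ h₂ =>
      obtain ⟨rfl, rfl⟩ := hs.eq_empty
      obtain ⟨-, r₁, hr₁, h₁⟩ := ih₁ h₁
      obtain ⟨hV, r₂, hr₂, h₂⟩ := ih₂ h₂
      obtain ⟨_, _, h₁⟩ := h₁.core
      generalize hτ : FType.arrow _ _ _ = τ' at h₁
      cases h₁ with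
      | lam hsub _ h₁ =>
        obtain rfl := hsub.eq_empty
        obtain ⟨rfl, rfl, rfl⟩ := FType.arrow_inj hτ
        obtain ⟨hW, r₃, hr₃, h₃⟩ := ih₃ (h₁.vsub_empty hV h₂)
        exact ⟨hW, r₃, by omega, h₃⟩
  | inl _ ih =>
    intro q τ h
    obtain ⟨q₀, hq, h⟩ := h.core
    cases h with
    | inl h₁ =>
      obtain ⟨hV, r, hr, h⟩ := ih h₁
      exact ⟨.inl hV, r, by omega, .inl h⟩
  | inr _ ih =>
    intro q τ h
    obtain ⟨q₀, hq, h⟩ := h.core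
    cases h with
    | inr h₁ =>
      obtain ⟨hV, r, hr, h⟩ := ih h₁
      exact ⟨.inr hV, r, by omega, .inr h⟩
  | casesl _ _ ih₁ ih₂ =>
    intro q τ h
    obtain ⟨q₀, hq, h⟩ := h.core
    cases h with
    | cases hs h hl hr =>
      obtain ⟨rfl, rfl⟩ := hs.eq_empty
      obtain ⟨hV, r₁, hr₁, h⟩ := ih₁ h
      obtain ⟨_, _, h⟩ := h.core
      generalize hτ : FType.sum _ _ = τ' at h
      cases hV with | inl hV =>
      cases h with
      | inl h =>
        obtain ⟨rfl, rfl⟩ := FType.sum_inj hτ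
        obtain ⟨hW, r₂, hr₂, h⟩ := ih₂ (hl.vsub_empty hV h)
        exact ⟨hW, r₂, by omega, h⟩
  | casesr _ _ ih₁ ih₂ =>
    intro q τ h
    obtain ⟨q₀, hq, h⟩ := h.core
    cases h with
    | cases hs h hl hr =>
      obtain ⟨rfl, rfl⟩ := hs.eq_empty
      obtain ⟨hV, r₁, hr₁, h⟩ := ih₁ h
      obtain ⟨_, _, h⟩ := h.core
      generalize hτ : FType.sum _ _ = τ' at h
      cases hV with | inr hV =>
      cases h with
      | inr h =>
        obtain ⟨rfl, rfl⟩ := FType.sum_inj hτ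
        obtain ⟨hW, r₂, hr₂, h⟩ := ih₂ (hr.vsub_empty hV h)
        exact ⟨hW, r₂, by omega, h⟩
  | pair _ _ ih₁ ih₂ =>
    intro q τ h
    obtain ⟨q₀, hq, h⟩ := h.core
    cases h with
    | pair hs h₁ h₂ =>
      obtain ⟨rfl, rfl⟩ := hs.eq_empty
      obtain ⟨hV, r₁, hr₁, h₁⟩ := ih₁ h₁
      obtain ⟨hW, r₂, hr₂, h₂⟩ := ih₂ ‹_›
      exact ⟨.pair hV hW, r₁ + r₂, by omega, .pair hs h₁ h₂⟩
  | projl _ ih =>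
    intro q τ h
    obtain ⟨q₀, hq, h⟩ := h.core
    cases h with
    | projl h =>
      obtain ⟨hV, r, hr, h⟩ := ih h
      obtain ⟨_, _, h⟩ := h.core
      generalize hτ : FType.prod _ _ = τ' at h
      cases hV with | pair hV hW =>
      cases h with
      | pair hs h₁ h₂ =>
        obtain ⟨rfl, rfl⟩ := hs.eq_empty
        obtain ⟨rfl, rfl⟩ := FType.prod_inj hτ
        exact ⟨hV, _, by omega, h₁⟩
  | projr _ ih =>
    intro q τ h
    obtain ⟨q₀, hq, h⟩ := h.core
    cases h with
    | projr h =>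
      obtain ⟨hV, r, hr, h⟩ := ih h
      obtain ⟨_, _, h⟩ := h.core
      generalize hτ : FType.prod _ _ = τ' at h
      cases hV with | pair hV hW =>
      cases h with
      | pair hs h₁ h₂ =>
        obtain ⟨rfl, rfl⟩ := hs.eq_empty
        obtain ⟨rfl, rfl⟩ := FType.prod_inj hτ
        refine ⟨hW, _, ?_, h₂⟩
        omega
  | int =>
    intro q τ h
    exact ⟨.int, q, by omega, h⟩
  | bool =>
    intro q τ h
    exact ⟨.bool, q, by omega, h⟩
  | iteT _ _ ih₁ ih₂ | iteF _ _ ih₁ ih₂ =>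
    intro q τ h
    obtain ⟨q₀, hq, h⟩ := h.core
    cases h with
    | ite hs h hl hr =>
      obtain ⟨rfl, rfl⟩ := hs.eq_empty
      obtain ⟨-, r₁, hr₁, -⟩ := ih₁ h
      obtain ⟨hW, r₂, hr₂, h⟩ := ih₂ ‹_›
      exact ⟨hW, r₂, by omega, h⟩
  | nil =>
    intro q τ h
    exact ⟨.nil, q, by omega, h⟩
  | cons _ _ ih₁ ih₂ =>
    intro q τ h
    obtain ⟨q₀, hq, h⟩ := h.core
    cases h with
    | cons hs h₁ h₂ =>
      obtain ⟨rfl, rfl⟩ := hs.eq_empty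
      obtain ⟨hV, r₁, hr₁, h₁⟩ := ih₁ h₁
      obtain ⟨hW, r₂, hr₂, h₂⟩ := ih₂ ‹_›
      exact ⟨.cons hV hW, _, by omega, .cons hs h₁ h₂⟩
  | mtchNil _ _ ih₁ ih₂ =>
    intro q τ h
    obtain ⟨q₀, hq, h⟩ := h.core
    cases h with
    | mtch hs h hl hr =>
      obtain ⟨rfl, rfl⟩ := hs.eq_empty
      obtain ⟨-, r₁, hr₁, -⟩ := ih₁ h
      obtain ⟨hW, r₂, hr₂, h⟩ := ih₂ hl
      exact ⟨hW, r₂, by omega, h⟩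
  | mtchCons _ _ ih₁ ih₂ =>
    intro q τ h
    obtain ⟨q₀, hq, h⟩ := h.core
    cases h with
    | mtch hs h hl hr =>
      obtain ⟨rfl, rfl⟩ := hs.eq_empty
      obtain ⟨hV, r₁, hr₁, h⟩ := ih₁ h
      obtain ⟨_, _, h⟩ := h.core
      generalize hτ : FType.list _ _ = τ' at h
      cases hV with | cons hV hW =>
      cases h with
      | cons hs h₁ h₂ =>
        obtain ⟨rfl, rfl⟩ := hs.eq_empty
        obtain ⟨rfl, rfl⟩ := FType.list_inj hτ
        obtain ⟨hW, r₂, hr₂, h⟩ := ih₂ (hr.vsub_empty₂ hV h₁ hW h₂)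
        exact ⟨hW, r₂, by omega, h⟩
  | tick _ ih =>
    intro q τ h
    obtain ⟨q₀, hq, h⟩ := h.core
    cases h with
    | tick h =>
      obtain ⟨hV, r, hr, h⟩ := ih h
      exact ⟨hV, r, by omega, h⟩
  | proc =>
    intro q τ h
    exact ⟨.proc, q, by omega, h⟩

/-! ## Substitution of run-time channels -/

/-- `σ` moves references to run-time channels of the same mode. -/
structure Moves (σ : Ref → Ref) : Prop where
  mode : ∀ r, (σ r).mode = r.mode
  ch : ∀ r, σ r = r ∨ ∃ c, σ r = .ch c

/-- What a substitution moves becomes a run-time channel, which is never a bound variable; hence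
capture is impossible. -/
theorem Moves.ne_var {σ : Ref → Ref} (h : Moves σ) {r y m} (hr : r ≠ .var y m) :
    σ r ≠ .var y m := by
  rcases h.ch r with h | ⟨c, h⟩ <;> rw [h]
  · exact hr
  · simp

theorem Moves.bind {σ : Ref → Ref} (h : Moves σ) (y : ℕ) (m : Mode) :
    Moves (Function.update σ (.var y m) (.var y m)) := by
  constructor <;> intro r <;> by_cases hr : r = .var y m
  · simp [hr]
  · simp [hr, h.mode]
  · simp [hr]
  · simpa [hr] using h.ch r

/-- Substitution of channels in a context. -/
def Ctx.sub (σ : Ref → Ref) (Δ : Ctx sg) : Ctx sg := Multiset.map (fun e => (σ e.1, e.2)) Δ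

@[simp] theorem Ctx.sub_zero (σ : Ref → Ref) : Ctx.sub σ (0 : Ctx sg) = 0 := rfl

@[simp] theorem Ctx.sub_cons (σ : Ref → Ref) (e) (Δ : Ctx sg) :
    Ctx.sub σ (e ::ₘ Δ) = (σ e.1, e.2) ::ₘ Ctx.sub σ Δ := Multiset.map_cons _ _ _

@[simp] theorem Ctx.sub_singleton (σ : Ref → Ref) (e : Ref × SType sg) :
    Ctx.sub σ {e} = {(σ e.1, e.2)} := rfl

@[simp] theorem Ctx.sub_add (σ : Ref → Ref) (Δ Δ' : Ctx sg) :
    Ctx.sub σ (Δ + Δ') = Ctx.sub σ Δ + Ctx.sub σ Δ' := Multiset.map_add _ _ _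

@[simp] theorem Ctx.sub_zip (σ : Ref → Ref) (ds : List Ref) (As : List (SType sg)) :
    Ctx.sub σ ((ds.zip As : List _) : Ctx sg) = (((ds.map σ).zip As : List _) : Ctx sg) := by
  simp [Ctx.sub, List.zip_map_left, Prod.map_def]

theorem Ctx.sub_congr {σ σ' : Ref → Ref} {Δ : Ctx sg} (h : ∀ e ∈ Δ, σ e.1 = σ' e.1) :
    Ctx.sub σ Δ = Ctx.sub σ' Δ :=
  Multiset.map_congr rfl fun e he => by rw [h e he]

theorem Ctx.sub_bind (σ : Ref → Ref) {y m} {Δ : Ctx sg} (h : ∀ e ∈ Δ, e.1 ≠ .var y m) :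
    Ctx.sub (Function.update σ (.var y m) (.var y m)) Δ = Ctx.sub σ Δ :=
  Ctx.sub_congr fun e he => by simp [h e he]

theorem Ctx.mem_sub {σ : Ref → Ref} {Δ : Ctx sg} {e} (h : e ∈ Ctx.sub σ Δ) :
    ∃ e' ∈ Δ, e = (σ e'.1, e'.2) := by
  obtain ⟨e', he', rfl⟩ := Multiset.mem_map.1 h
  exact ⟨e', he', rfl⟩

/-- The shared context `Γ'` contains the image of `Γ` under `σ`, and otherwise run-time channels
only. -/
structure SharedSub (σ : Ref → Ref) (Γ Γ' : Ctx sg) : Prop where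
  image : ∀ e ∈ Γ, (σ e.1, e.2) ∈ Γ'
  shared : ∀ e ∈ Γ', e.1.mode = .S ∧ Lang .S e.2
  old : ∀ e ∈ Γ', (∃ c, e.1 = .ch c) ∨ ∃ e' ∈ Γ, e.1 = e'.1

theorem SharedSub.bind {σ : Ref → Ref} {Γ Γ' : Ctx sg} (h : SharedSub σ Γ Γ') {y m}
    (hy : ∀ e ∈ Γ, e.1 ≠ .var y m) :
    SharedSub (Function.update σ (.var y m) (.var y m)) Γ Γ' :=
  ⟨fun e he => by simpa [hy e he] using h.image e he, h.shared, h.old⟩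

theorem SharedSub.cons {σ : Ref → Ref} {Γ Γ' : Ctx sg} (h : SharedSub σ Γ Γ') {y A}
    (hy : ∀ e ∈ Γ, e.1 ≠ .var y .S) (hA : Lang .S A) :
    SharedSub (Function.update σ (.var y .S) (.var y .S)) ((.var y .S, A) ::ₘ Γ)
      ((.var y .S, A) ::ₘ Γ') := by
  have h' := h.bind hy
  constructor
  · intro e he
    rcases Multiset.mem_cons.1 he with rfl | he
    · simp
    · exact Multiset.mem_cons_of_mem (h'.image e he)
  · intro e he
    rcases Multiset.mem_cons.1 he with rfl | he
    · exact ⟨rfl, hA⟩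
    · exact h.shared e he
  · intro e he
    rcases Multiset.mem_cons.1 he with rfl | he
    · exact .inr ⟨_, Multiset.mem_cons_self _ _, rfl⟩
    · exact (h.old e he).imp_right fun ⟨e', he', h⟩ => ⟨e', Multiset.mem_cons_of_mem he', h⟩

theorem Purelin.sub {σ : Ref → Ref} (hσ : Moves σ) {Δ : Ctx sg} (h : Purelin Δ) :
    Purelin (Ctx.sub σ Δ) := by
  intro e he
  obtain ⟨e', he', rfl⟩ := Ctx.mem_sub he
  exact (hσ.mode _).trans (h e' he')

/-- Since modes are preserved, the invariants carry over. Mode `R` is the exception that prevents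
arbitrary weakening of the shared context, whence `hR`. -/
theorem Inv.sub {σ : Ref → Ref} (hσ : Moves σ) {Γ Γ' Δ : Ctx sg} {z C} (h : Inv Γ Δ z C)
    (hΓ : SharedSub σ Γ Γ') (hR : z.mode = .R → Γ' = 0) : Inv Γ' (Ctx.sub σ Δ) (σ z) C where
  shared := hΓ.shared
  linear e he := by
    obtain ⟨e', he', rfl⟩ := Ctx.mem_sub he
    simpa [hσ.mode] using h.linear e' he'
  offer := by rw [hσ.mode]; exact h.offer
  modeR hz := by
    rw [hσ.mode] at hz
    exact ⟨hR hz, (h.modeR hz).2.sub hσ⟩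
  modeS hz := by
    rw [hσ.mode] at hz
    exact (h.modeS hz).sub hσ

/-- The references added to `Γ'` are run-time channels, which cannot clash with a bound variable.
This is the purpose of the field `old` of `SharedSub`. -/
theorem New.sub {σ : Ref → Ref} (hσ : Moves σ) {Γ Γ' Δ : Ctx sg} {y m z}
    (h : New (.var y m) Γ Δ z) (hΓ : SharedSub σ Γ Γ') :
    New (.var y m) Γ' (Ctx.sub σ Δ) (σ z) := by
  refine ⟨fun e he => ?_, fun e he => ?_, hσ.ne_var h.2.2⟩
  · rcases hΓ.old e he with ⟨c, hc⟩ | ⟨e', he', h'⟩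
    · rw [hc]; simp
    · rw [h']; exact h.1 e' he'
  · obtain ⟨e', he', rfl⟩ := Ctx.mem_sub he
    exact hσ.ne_var (h.2.1 e' he')

/-- Process typing is preserved by substitution of run-time channels and by weakening of the
shared context. -/
theorem PTy.chsub {Ψ : FCtx sg} {Γ Δ q P z C} (h : PTy sg Ψ Γ Δ q P z C) :
    ∀ {σ : Ref → Ref} {Γ'}, Moves σ → SharedSub σ Γ Γ' → (z.mode = .R → Γ' = 0) →
      PTy sg Ψ Γ' (Ctx.sub σ Δ) q (P.chsub σ) (σ z) C := by
  induction h using PTy.rec (motive_1 := fun _ _ _ _ _ => True)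
  all_goals intros
  all_goals try trivial
  all_goals try simp only [Proc.chsub, Ctx.sub_cons, Ctx.sub_add, Ctx.sub_zip, Ctx.sub_zero,
    Ctx.sub_singleton]
  case relax hq _ ih σ Γ' hσ hΓ hR => exact .relax hq (ih hσ hΓ hR)
  case spawnR hi hDs hds hs hn hM hQ _ ih σ Γ' hσ hΓ hR =>
    have ih := ih (hσ.bind _ _) (hΓ.bind hn.1) hR
    rw [Ctx.sub_cons, Ctx.sub_bind _ hn.2.1, Function.update_self,
      Function.update_of_ne hn.2.2] at ih
    refine .spawnR ?_ hDs (by simp [← hds, hσ.mode]) hs (hn.sub hσ hΓ) hM ih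
    simpa using hi.sub hσ hΓ hR
  case spawnS hi hz has hDs hds hes hs hn hM hQ _ ih σ Γ' hσ hΓ hR =>
    have ih := ih (hσ.bind _ _) (hΓ.cons hn.1 (hQ.inv.shared _ (Multiset.mem_cons_self _ _)).2)
      (fun h => absurd h hz)
    rw [Ctx.sub_bind _ hn.2.1, Function.update_of_ne hn.2.2] at ih
    refine .spawnS ?_ (by rwa [hσ.mode]) ?_ hDs (by simp [← hds, hσ.mode]) hes hs (hn.sub hσ hΓ)
      hM ih
    · simpa using hi.sub hσ hΓ hR
    · rw [List.forall₂_map_left_iff]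
      exact has.imp fun a B h => hΓ.image _ h
  case spawnC hi hz has hds hs hn hM hQ _ ih σ Γ' hσ hΓ hR =>
    have ih := ih (hσ.bind _ _) (hΓ.bind hn.1) hR
    rw [Ctx.sub_cons, Ctx.sub_bind _ hn.2.1, Function.update_self,
      Function.update_of_ne hn.2.2] at ih
    refine .spawnC ?_ (by rwa [hσ.mode]) ?_ (by simp [← hds, hσ.mode]) hs (hn.sub hσ hΓ)
      hM ih
    · simpa using hi.sub hσ hΓ hR
    · rw [List.forall₂_map_left_iff]
      exact has.imp fun a B h => hΓ.image _ h
  case fwd hi hm hm' σ Γ' hσ hΓ hR =>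
    exact .fwd (by simpa using hi.sub hσ hΓ hR) (by rwa [hσ.mode]) (by rwa [hσ.mode, hσ.mode])
  case ichoiceR hi hk _ ih σ Γ' hσ hΓ hR => exact .ichoiceR (hi.sub hσ hΓ hR) hk (ih hσ hΓ hR)
  case ichoiceL hi _ ih σ Γ' hσ hΓ hR =>
    exact .ichoiceL (by simpa using hi.sub hσ hΓ hR) fun l hl => by simpa using ih l hl hσ hΓ hR
  case echoiceR hi _ ih σ Γ' hσ hΓ hR =>
    exact .echoiceR (hi.sub hσ hΓ hR) fun l hl => ih l hl hσ hΓ hR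
  case echoiceL hi hk _ ih σ Γ' hσ hΓ hR =>
    exact .echoiceL (by simpa using hi.sub hσ hΓ hR) hk (by simpa using ih hσ hΓ hR)
  case tensorR hi hm _ ih σ Γ' hσ hΓ hR =>
    exact .tensorR (by simpa using hi.sub hσ hΓ hR) (by rwa [hσ.mode]) (ih hσ hΓ hR)
  case tensorL hi hn _ ih σ Γ' hσ hΓ hR =>
    have ih := ih (hσ.bind _ _) (hΓ.bind hn.1) hR
    rw [Ctx.sub_cons, Ctx.sub_cons, Function.update_self,
      Function.update_of_ne (hn.2.1 _ (Multiset.mem_cons_self _ _)),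
      Ctx.sub_bind _ fun e he => hn.2.1 e (Multiset.mem_cons_of_mem he),
      Function.update_of_ne hn.2.2] at ih
    have hn := hn.sub hσ hΓ
    rw [Ctx.sub_cons] at hn
    exact .tensorL (by simpa using hi.sub hσ hΓ hR) hn ih
  case lolliR hi hn _ ih σ Γ' hσ hΓ hR =>
    have ih := ih (hσ.bind _ _) (hΓ.bind hn.1) hR
    rw [Ctx.sub_cons, Ctx.sub_bind _ hn.2.1, Function.update_self,
      Function.update_of_ne hn.2.2] at ih
    exact .lolliR (hi.sub hσ hΓ hR) (hn.sub hσ hΓ) ih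
  case lolliL hi hm _ ih σ Γ' hσ hΓ hR =>
    exact .lolliL (by simpa using hi.sub hσ hΓ hR) (by rwa [hσ.mode])
      (by simpa using ih hσ hΓ hR)
  case timesR hi hs hM _ _ ih σ Γ' hσ hΓ hR =>
    exact .timesR (hi.sub hσ hΓ hR) hs hM (ih hσ hΓ hR)
  case timesL hi _ ih σ Γ' hσ hΓ hR =>
    exact .timesL (by simpa using hi.sub hσ hΓ hR) (by simpa using ih hσ hΓ hR)
  case arrowR hi _ ih σ Γ' hσ hΓ hR => exact .arrowR (hi.sub hσ hΓ hR) (ih hσ hΓ hR)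
  case arrowL hi hs hM _ _ ih σ Γ' hσ hΓ hR =>
    exact .arrowL (by simpa using hi.sub hσ hΓ hR) hs hM (by simpa using ih hσ hΓ hR)
  case oneR hi σ Γ' hσ hΓ hR => exact .oneR (hi.sub hσ hΓ hR)
  case oneL hi _ ih σ Γ' hσ hΓ hR =>
    exact .oneL (by simpa using hi.sub hσ hΓ hR) (ih hσ hΓ hR)
  case work hi _ ih σ Γ' hσ hΓ hR => exact .work (hi.sub hσ hΓ hR) (ih hσ hΓ hR)
  case payR hi _ ih σ Γ' hσ hΓ hR => exact .payR (hi.sub hσ hΓ hR) (ih hσ hΓ hR)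
  case payL hi _ ih σ Γ' hσ hΓ hR =>
    exact .payL (by simpa using hi.sub hσ hΓ hR) (by simpa using ih hσ hΓ hR)
  case getR hi _ ih σ Γ' hσ hΓ hR => exact .getR (hi.sub hσ hΓ hR) (ih hσ hΓ hR)
  case getL hi _ ih σ Γ' hσ hΓ hR =>
    exact .getL (by simpa using hi.sub hσ hΓ hR) (by simpa using ih hσ hΓ hR)
  case upR hi hm hp hn _ ih σ Γ' hσ hΓ hR =>
    -- After an accept the offered channel is a variable of mode `L`, so the condition for mode `R`
    -- is vacuous.
    have ih := ih (hσ.bind _ _) (hΓ.bind hn.1) (by simp [Ref.mode])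
    rw [Ctx.sub_bind _ hn.2.1, Function.update_self] at ih
    exact .upR (hi.sub hσ hΓ hR) (by rwa [hσ.mode]) (hp.sub hσ) (hn.sub hσ hΓ) ih
  case upL hi hm hx hn _ ih σ Γ' hσ hΓ hR =>
    have ih := ih (hσ.bind _ _) (hΓ.bind hn.1) hR
    rw [Ctx.sub_cons, Ctx.sub_bind _ hn.2.1, Function.update_self,
      Function.update_of_ne hn.2.2] at ih
    exact .upL (hi.sub hσ hΓ hR) (by rwa [hσ.mode]) (hΓ.image _ hx) (hn.sub hσ hΓ) ih
  case downR hi hm hp hn _ ih σ Γ' hσ hΓ hR =>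
    have ih := ih (hσ.bind _ _) (hΓ.bind hn.1) (by simp [Ref.mode])
    rw [Ctx.sub_bind _ hn.2.1, Function.update_self] at ih
    exact .downR (hi.sub hσ hΓ hR) (by rwa [hσ.mode]) (hp.sub hσ) (hn.sub hσ hΓ) ih
  case downL hi hm hz hn h ih σ Γ' hσ hΓ hR =>
    have ih := ih (hσ.bind _ _) (hΓ.cons hn.1 (h.inv.shared _ (Multiset.mem_cons_self _ _)).2)
      (by rcases hz with hz | hz <;> simp [hz])
    rw [Ctx.sub_bind _ hn.2.1, Function.update_of_ne hn.2.2] at ih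
    exact .downL (by simpa using hi.sub hσ hΓ hR) (by rwa [hσ.mode]) (by rwa [hσ.mode])
      (hn.sub hσ hΓ) ih

theorem update_id_self (r : Ref) : Function.update (id : Ref → Ref) r r = id :=
  Function.update_eq_self r (id : Ref → Ref)

theorem Proc.chsub_id (P : Proc) : P.chsub id = P := by
  induction P using Proc.rec (motive_1 := fun _ => True) with
  | _ => simp_all [Proc.chsub, update_id_self]

/-! ## Contexts of run-time channels -/

/-- The shared context available to a process that provides `c`. -/
def sharedFor (Γ₀ : CCtx sg) (c : Chan) : Ctx sg := if c.mode = .R then 0 else Γ₀.toCtx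

theorem sharedFor_congr (Γ₀ : CCtx sg) {c c' : Chan} (h : c'.mode = c.mode) :
    sharedFor Γ₀ c' = sharedFor Γ₀ c := by simp [sharedFor, h]

@[simp] theorem CCtx.toCtx_zero : CCtx.toCtx (0 : CCtx sg) = 0 := rfl

@[simp] theorem CCtx.toCtx_cons (e) (Δ : CCtx sg) :
    CCtx.toCtx (e ::ₘ Δ) = (.ch e.1, e.2) ::ₘ CCtx.toCtx Δ := Multiset.map_cons _ _ _

@[simp] theorem CCtx.toCtx_add (Δ Δ' : CCtx sg) :
    CCtx.toCtx (Δ + Δ') = CCtx.toCtx Δ + CCtx.toCtx Δ' := Multiset.map_add _ _ _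

@[simp] theorem CCtx.toCtx_singleton (e : Chan × SType sg) :
    CCtx.toCtx {e} = {(.ch e.1, e.2)} := rfl

theorem CCtx.mem_toCtx {Δ : CCtx sg} {e} (h : e ∈ Δ.toCtx) :
    ∃ c, e.1 = .ch c ∧ (c, e.2) ∈ Δ := by
  obtain ⟨e', he', rfl⟩ := Multiset.mem_map.1 h
  exact ⟨e'.1, rfl, he'⟩

theorem CCtx.mem_toCtx_ch {Δ : CCtx sg} {c A} : (Ref.ch c, A) ∈ Δ.toCtx ↔ (c, A) ∈ Δ := by
  constructor
  · intro h
    obtain ⟨c', h₁, h₂⟩ := CCtx.mem_toCtx h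
    cases h₁
    exact h₂
  · intro h
    exact Multiset.mem_map.2 ⟨_, h, rfl⟩

/-- Inversion of process typing yields contexts of references. In a configuration these come from
contexts of run-time channels, and the decomposition has to be pulled back to them. -/
theorem CCtx.toCtx_eq_cons {Δ : CCtx sg} {x A D} (h : Δ.toCtx = (x, A) ::ₘ D) :
    ∃ (c : Chan) (Δ' : CCtx sg), x = .ch c ∧ Δ = (c, A) ::ₘ Δ' ∧ D = Δ'.toCtx := by
  obtain ⟨c, hc, hmem⟩ := CCtx.mem_toCtx (Δ := Δ) (e := (x, A)) (h ▸ Multiset.mem_cons_self _ _)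
  obtain ⟨Δ', rfl⟩ := Multiset.exists_cons_of_mem hmem
  refine ⟨c, Δ', hc, rfl, ?_⟩
  dsimp only at hc
  subst hc
  rw [CCtx.toCtx_cons] at h
  exact ((Multiset.cons_inj_right _).1 h).symm

theorem CCtx.toCtx_eq_zero {Δ : CCtx sg} (h : Δ.toCtx = 0) : Δ = 0 := Multiset.map_eq_zero.1 h

theorem CCtx.toCtx_eq_list_add {l : List (Ref × SType sg)} :
    ∀ {Δ : CCtx sg} {D : Ctx sg}, Δ.toCtx = (l : Ctx sg) + D →
      ∃ Δ₁ Δ₂, Δ = Δ₁ + Δ₂ ∧ (l : Ctx sg) = CCtx.toCtx Δ₁ ∧ D = CCtx.toCtx Δ₂ := by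
  induction l with
  | nil => exact fun {Δ D} h => ⟨0, Δ, by simp, rfl, by simpa using h.symm⟩
  | cons e l ih =>
    intro Δ D h
    rw [← Multiset.cons_coe, Multiset.cons_add] at h
    obtain ⟨c, Δ', hc, rfl, h'⟩ := CCtx.toCtx_eq_cons h
    obtain ⟨Δ₁, Δ₂, rfl, h₁, h₂⟩ := ih h'.symm
    refine ⟨(c, e.2) ::ₘ Δ₁, Δ₂, by simp, ?_, h₂⟩
    rw [← Multiset.cons_coe, h₁, CCtx.toCtx_cons, ← hc]

theorem CCtx.sub_toCtx_of_notMem {σ : Ref → Ref} {Δ : CCtx sg}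
    (h : ∀ e ∈ Δ, σ (.ch e.1) = .ch e.1) : Ctx.sub σ Δ.toCtx = Δ.toCtx := by
  rw [Ctx.sub, CCtx.toCtx, Multiset.map_map]
  exact Multiset.map_congr rfl fun e he => by simp [h e he]

theorem CCtx.sub_ren_chan {Δ : CCtx sg} {c : Chan} (r : Ref) (h : ∀ e ∈ Δ, e.1 ≠ c) :
    Ctx.sub (Function.update id (.ch c) r) Δ.toCtx = Δ.toCtx :=
  CCtx.sub_toCtx_of_notMem fun e he => by simp [h e he]

theorem CCtx.sub_ren_var {Δ : CCtx sg} {y m} (r : Ref) :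
    Ctx.sub (Function.update id (.var y m) r) Δ.toCtx = Δ.toCtx :=
  CCtx.sub_toCtx_of_notMem fun e he => by simp

theorem Cont.mode_eq {c c'} (h : Cont c c') : c'.mode = c.mode := by
  cases c <;> cases c' <;> first | rfl | cases h

theorem Cont.mode_ne {c c'} (h : Cont c c') : c.mode ≠ .S := by
  cases c <;> cases c' <;> cases h <;> simp [Chan.mode]

theorem moves_ren {r : Ref} {c : Chan} (h : c.mode = r.mode) :
    Moves (Function.update id r (.ch c)) := by
  constructor <;> intro r' <;> by_cases hr : r' = r
  · subst hr; simpa [Ref.mode] using h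
  · simp [hr]
  · exact .inr ⟨c, by simp [hr]⟩
  · exact .inl (by simp [hr])

theorem mem_sharedFor {Γ₀ : CCtx sg} {d : Chan} {e} (h : e ∈ sharedFor Γ₀ d) :
    e ∈ Γ₀.toCtx ∧ d.mode ≠ .R := by
  unfold sharedFor at h
  split_ifs at h with hd
  · cases h
  · exact ⟨h, hd⟩

theorem sharedFor_old {Γ₀ : CCtx sg} {d : Chan} {e} (h : e ∈ sharedFor Γ₀ d) :
    ∃ c, e.1 = .ch c := by
  obtain ⟨c, hc, -⟩ := CCtx.mem_toCtx (mem_sharedFor h).1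
  exact ⟨c, hc⟩

theorem sharedFor_eq_zero {Γ₀ : CCtx sg} {d : Chan} (h : d.mode = .R) : sharedFor Γ₀ d = 0 := by
  simp [sharedFor, h]

/-- Renaming of a linear channel or of a bound variable. -/
theorem PTy.ren {Γ₀ : CCtx sg} {Ψ Δ q P C} {c d : Chan} {r : Ref} {z : Ref}
    (h : PTy sg Ψ (sharedFor Γ₀ d) Δ q P z C) (hz : z.mode = d.mode) (hr : c.mode = r.mode)
    (hr' : ∀ e ∈ sharedFor Γ₀ d, e.1 ≠ r) :
    PTy sg Ψ (sharedFor Γ₀ d) (Ctx.sub (Function.update id r (.ch c)) Δ) q (P.ren r (.ch c))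
      (Function.update id r (.ch c) z) C :=
  h.chsub (moves_ren hr)
    ⟨fun e he => by simpa [hr' e he] using he, h.inv.shared, fun e he => .inl (sharedFor_old he)⟩
    fun hR => sharedFor_eq_zero (by rwa [← hz])

theorem PTy.ren_chan {Γ₀ : CCtx sg} {Ψ Δ q P C} {c c' d : Chan} {z : Ref}
    (h : PTy sg Ψ (sharedFor Γ₀ d) Δ q P z C) (hz : z.mode = d.mode) (hc : c'.mode = c.mode)
    (hS : c.mode ≠ .S) :
    PTy sg Ψ (sharedFor Γ₀ d) (Ctx.sub (Function.update id (.ch c) (.ch c')) Δ) q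
      (P.ren (.ch c) (.ch c')) (Function.update id (.ch c) (.ch c') z) C :=
  h.ren hz hc fun e he h' => hS <| by
    have := (h.inv.shared e he).1
    rwa [h'] at this

theorem PTy.ren_var {Γ₀ : CCtx sg} {Ψ Δ q P C} {y m} {e d : Chan} {z : Ref}
    (h : PTy sg Ψ (sharedFor Γ₀ d) Δ q P z C) (hz : z.mode = d.mode) (hc : e.mode = m) :
    PTy sg Ψ (sharedFor Γ₀ d) (Ctx.sub (Function.update id (.var y m) (.ch e)) Δ) q
      (P.ren (.var y m) (.ch e)) (Function.update id (.var y m) (.ch e) z) C :=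
  h.ren hz hc fun e' he h' => by
    obtain ⟨c, hc⟩ := sharedFor_old he
    rw [hc] at h'
    cases h'

/-- Weakening of the shared context by run-time channels. -/
theorem PTy.weaken_shared {Ψ : FCtx sg} {Γ Γ' Δ q P z C} (h : PTy sg Ψ Γ Δ q P z C)
    (hsub : ∀ e ∈ Γ, e ∈ Γ') (hS : ∀ e ∈ Γ', e.1.mode = .S ∧ Lang .S e.2)
    (hch : ∀ e ∈ Γ', ∃ c, e.1 = .ch c) (hR : z.mode = .R → Γ' = 0) : PTy sg Ψ Γ' Δ q P z C := by
  have := h.chsub (σ := id) ⟨fun _ => rfl, fun _ => .inl rfl⟩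
    ⟨hsub, hS, fun e he => .inl (hch e he)⟩ hR
  rw [Proc.chsub_id] at this
  have h' : Ctx.sub id Δ = Δ := Multiset.map_id' Δ
  rwa [h'] at this

/-! ## Unordered configuration typing -/

/-- The channel `d` may be used by the provider of `c`, for an order of the channels in which the
purely linear channels come first. -/
def Below (rank : Chan → ℕ) (d c : Chan) : Prop :=
  (c.mode = .R → d.mode = .R) ∧ (c.mode = .R ∨ d.mode ≠ .R → rank d < rank c)

/-- Together with transitivity this makes `Below` a strict order for every `rank`, the ranks being
compared as soon as `c` is purely linear or `d` is not. Acyclicity of the configuration is encoded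
in this way. -/
theorem Below.irrefl {rank c} : ¬ Below rank c c := fun h =>
  absurd (h.2 (em _)) (lt_irrefl _)

theorem Below.trans {rank a b c} (h : Below rank a b) (h' : Below rank b c) : Below rank a c := by
  refine ⟨fun hc => h.1 (h'.1 hc), fun hc => ?_⟩
  rcases hc with hc | ha
  · exact (h.2 (.inl (h'.1 hc))).trans (h'.2 (.inl hc))
  · exact (h.2 (.inr ha)).trans (h'.2 (.inr fun hb => ha (h.1 hb)))

/-- A fresh channel can be inserted below `x`. -/
theorem exists_rank_insert (rank : Chan → ℕ) {c x : Chan} (hcx : x ≠ c) (Δ : CCtx sg)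
    (hne : ∀ e ∈ Δ, e.1 ≠ c) (hx : ∀ e ∈ Δ, Below rank e.1 x)
    (hc : c.mode = .R → ∀ e ∈ Δ, e.1.mode = .R) (hm : x.mode = .R → c.mode = .R) :
    ∃ rank' : Chan → ℕ, (∀ a b, a ≠ c → b ≠ c → Below rank a b → Below rank' a b) ∧
      (∀ e ∈ Δ, Below rank' e.1 c) ∧ Below rank' c x := by
  by_cases h : x.mode = .R ∨ c.mode ≠ .R
  -- Doubling makes room between consecutive ranks: old channels get odd ranks, and `c` gets the
  -- even rank immediately below that of `x`.
  · refine ⟨fun a => if a = c then 2 * rank x else 2 * rank a + 1, ?_, ?_, ?_⟩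
    · intro a b ha hb hab
      refine ⟨hab.1, fun h => ?_⟩
      have := hab.2 h
      simp only [ha, hb, if_false]
      omega
    · intro e he
      refine ⟨fun h => hc h e he, fun h' => ?_⟩
      simp only [hne e he, if_false, if_true]
      have := (hx e he).2 (by
        rcases h with h | h
        · exact .inl h
        · exact .inr (h'.resolve_left h))
      omega
    · refine ⟨hm, fun _ => ?_⟩
      simp [hcx]
  · push Not at h
    -- Here `c` is purely linear and `x` is not, so `c` is below `x` whatever their ranks are, and
    -- it suffices that `c` exceeds the ranks in `Δ`.
    obtain ⟨B, hB⟩ : ∃ B, ∀ e ∈ Δ, rank e.1 < B :=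
      ⟨(Δ.map fun e => rank e.1).sum + 1, fun e he => Nat.lt_succ_of_le
        (Multiset.le_sum_of_mem (Multiset.mem_map_of_mem (fun e => rank e.1) he))⟩
    refine ⟨fun a => if a = c then B else rank a, ?_, ?_, ?_⟩
    · intro a b ha hb hab
      refine ⟨hab.1, fun h => ?_⟩
      simpa only [ha, hb, if_false] using hab.2 h
    · intro e he
      refine ⟨fun h => hc h e he, fun h' => ?_⟩
      simpa only [hne e he, if_false, if_true] using hB e he
    · exact ⟨hm, fun h' => absurd h.2 (h'.resolve_left h.1)⟩

/-- What the provider of `c` at type `A` adds to the shared and to the linear context. -/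
inductive Offer (Γ₀ : CCtx sg) : Chan → SType sg → CCtx sg → CCtx sg → Prop
  | R {n A} : Offer Γ₀ (.R n) A 0 {(.R n, A)}
  | C {n A} : Offer Γ₀ (.C n) A 0 {(.C n, A)}
  | S {a A} : (.S a, A) ∈ Γ₀ → ESync A A → Offer Γ₀ (.S a) A {(.S a, A)} 0
  | L {a i A B} : (.S a, B) ∈ Γ₀ → ESync A B →
      Offer Γ₀ (.L a i) A {(.S a, B)} {(.L a i, A)}

theorem Offer.mono {Γ₀ Γ₀' : CCtx sg} (hle : Γ₀ ≤ Γ₀') {c A S L} (h : Offer Γ₀ c A S L) :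
    Offer Γ₀' c A S L := by
  cases h with
  | R => exact .R
  | C => exact .C
  | S h h' => exact .S (Multiset.mem_of_le hle h) h'
  | L h h' => exact .L (Multiset.mem_of_le hle h) h'

theorem Offer.linear {Γ₀ : CCtx sg} {c A S L} (h : Offer Γ₀ c A S L) (hc : c.mode ≠ .S) :
    L = {(c, A)} := by
  cases h <;> first | rfl | exact absurd rfl hc

/-- Moving to a continuation channel keeps the underlying shared channel and its declared type, so
only the equi-synchronization of the new linear type has to be supplied. -/
theorem Offer.cont {Γ₀ : CCtx sg} {c c' A A' S L} (h : Offer Γ₀ c A S L) (hc : Cont c c')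
    (hA : ∀ B, ESync A B → ESync A' B) : Offer Γ₀ c' A' S {(c', A')} := by
  cases h <;> cases c' <;> try cases hc
  · exact .R
  · exact .C
  · exact .L ‹_› (hA _ ‹_›)

/-- Typing of a semantic object that uses the linear channels `Δ`, has energy `e`, and offers the
shared channels `S` and the linear channels `L`. -/
inductive ObjTy (Γ₀ : CCtx sg) : Obj → CCtx sg → ℕ → CCtx sg → CCtx sg → Prop
  | proc {c w P Δ q e A S L} : PTy sg FCtx.empty (sharedFor Γ₀ c) Δ.toCtx q P (.ch c) A →
      Offer Γ₀ c A S L → q + w ≤ e → ObjTy Γ₀ (.proc c w P) Δ e S L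
  | msg {c w M Δ q e A} : MTy sg Δ q M c A → q + w ≤ e → ObjTy Γ₀ (.msg c w M) Δ e 0 {(c, A)}

/-- Configuration typing without an order of the objects: the objects of `Ω` use the linear channels
`U`, offer the linear channels `L`, and depend on each other along `rank`. -/
inductive Net (Γ₀ : CCtx sg) (rank : Chan → ℕ) : ℕ → Config → CCtx sg → CCtx sg → CCtx sg → Prop
  | emp : Net Γ₀ rank 0 0 0 0 0
  | cons {E E' Ω Γ Γ' U U' L L' o Δ e S O} : ObjTy Γ₀ o Δ e S O →
      (∀ d ∈ Δ, Below rank d.1 o.chan) → Net Γ₀ rank E Ω Γ U L →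
      E' = e + E → Γ' = S + Γ → U' = Δ + U → L' = O + L → Net Γ₀ rank E' (o ::ₘ Ω) Γ' U' L'

/-! ## Messages -/

/-- The rules of `MTy` other than weakening of potential. -/
inductive MTyCore (sg : Sig) : CCtx sg → ℕ → Proc → Chan → SType sg → Prop
  | ichoice {c c' k K B} : Inv 0 (CCtx.toCtx {(c', B k)}) (.ch c) (.ichoice K B) →
      Cont c c' → k ∈ K →
      MTyCore sg {(c', B k)} 0 (.sendL (.ch c) k (.fwd (.ch c) (.ch c'))) c (.ichoice K B)
  | echoice {c c' k K B} : Inv 0 (CCtx.toCtx {(c, SType.echoice K B)}) (.ch c') (B k) →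
      Cont c c' → k ∈ K →
      MTyCore sg {(c, .echoice K B)} 0 (.sendL (.ch c) k (.fwd (.ch c') (.ch c))) c' (B k)
  | tensor {c c' e n A B} : Inv 0 (CCtx.toCtx {(e, A), (c', B)}) (.ch c) (.tensor n A B) →
      Cont c c' → e.mode = n →
      MTyCore sg {(e, A), (c', B)} 0 (.sendC (.ch c) (.ch e) (.fwd (.ch c) (.ch c'))) c
        (.tensor n A B)
  | lolli {c c' e n A B} : Inv 0 (CCtx.toCtx {(e, A), (c, SType.lolli n A B)}) (.ch c') B →
      Cont c c' → e.mode = n →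
      MTyCore sg {(e, A), (c, .lolli n A B)} 0
        (.sendC (.ch c) (.ch e) (.fwd (.ch c') (.ch c))) c' B
  | times {c c' p N τ A} : Inv 0 (CCtx.toCtx {(c', A)}) (.ch c) (.times τ A) →
      Cont c c' → IsVal N → ETy sg FCtx.empty p N τ →
      MTyCore sg {(c', A)} p (.sendV (.ch c) N (.fwd (.ch c) (.ch c'))) c (.times τ A)
  | arrow {c c' p N τ A} : Inv 0 (CCtx.toCtx {(c, SType.arrow τ A)}) (.ch c') A →
      Cont c c' → IsVal N → ETy sg FCtx.empty p N τ →
      MTyCore sg {(c, .arrow τ A)} p (.sendV (.ch c) N (.fwd (.ch c') (.ch c))) c' A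
  | one {c} : Inv (sg := sg) 0 0 (.ch c) .one → MTyCore sg 0 0 (.close (.ch c)) c .one
  | pay {c c' r A} : Inv 0 (CCtx.toCtx {(c', A)}) (.ch c) (.pay r A) → Cont c c' →
      MTyCore sg {(c', A)} r (.pay (.ch c) r (.fwd (.ch c) (.ch c'))) c (.pay r A)
  | get {c c' r A} : Inv 0 (CCtx.toCtx {(c, SType.get r A)}) (.ch c') A → Cont c c' →
      MTyCore sg {(c, .get r A)} r (.pay (.ch c) r (.fwd (.ch c') (.ch c))) c' A

theorem MTy.core {Δ q M c A} (h : MTy sg Δ q M c A) : ∃ q₀ ≤ q, MTyCore sg Δ q₀ M c A := by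
  induction h with
  | relax hq _ ih =>
    obtain ⟨q₀, h₀, h⟩ := ih
    exact ⟨q₀, h₀.trans hq, h⟩
  | ichoice h₁ h₂ h₃ => exact ⟨_, le_rfl, .ichoice h₁ h₂ h₃⟩
  | echoice h₁ h₂ h₃ => exact ⟨_, le_rfl, .echoice h₁ h₂ h₃⟩
  | tensor h₁ h₂ h₃ => exact ⟨_, le_rfl, .tensor h₁ h₂ h₃⟩
  | lolli h₁ h₂ h₃ => exact ⟨_, le_rfl, .lolli h₁ h₂ h₃⟩
  | times h₁ h₂ h₃ h₄ => exact ⟨_, le_rfl, .times h₁ h₂ h₃ h₄⟩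
  | arrow h₁ h₂ h₃ h₄ => exact ⟨_, le_rfl, .arrow h₁ h₂ h₃ h₄⟩
  | one h₁ => exact ⟨_, le_rfl, .one h₁⟩
  | pay h₁ h₂ => exact ⟨_, le_rfl, .pay h₁ h₂⟩
  | get h₁ h₂ => exact ⟨_, le_rfl, .get h₁ h₂⟩

theorem Lang.step {m} {A : SType sg} (h : Lang m A) :
    ∃ F G, LangStep (sg := sg) F G m A := by
  obtain ⟨F, G, -, hG, h⟩ := h
  exact ⟨F, G, hG _ _ h⟩

theorem Lang.one_mode {m} (h : Lang m (SType.one (sg := sg))) : m = .R ∨ m = .C := by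
  obtain ⟨F, G, h⟩ := h.step
  generalize hA : SType.one = A at h
  cases h with
  | one h => exact h
  | _ => cases SType.match_of_eq hA

/-- Messages other than `close` involve a continuation channel, which exists only at linear modes;
for `close` the grammar restricts the type to modes `R` and `C`. -/
theorem MTy.mode_ne {Δ q M c A} (h : MTy sg Δ q M c A) : c.mode ≠ .S := by
  obtain ⟨_, _, h⟩ := h.core
  cases h with
  | one hi => rcases hi.offer.one_mode with hm | hm <;> simp_all [Ref.mode]
  | ichoice _ hc | tensor _ hc | times _ hc | pay _ hc => exact hc.mode_ne
  | echoice _ hc | lolli _ hc | arrow _ hc | get _ hc => rw [hc.mode_eq]; exact hc.mode_ne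

theorem MTy.occ {Δ q M c A d} (h : MTy sg Δ q M c A) (hd : M.Occ d) :
    d = c ∨ ∃ B, (d, B) ∈ Δ := by
  obtain ⟨_, _, h⟩ := h.core
  cases h <;> simp only [Proc.Occ, Ref.ch.injEq, Multiset.mem_singleton,
    Multiset.insert_eq_cons, Multiset.mem_cons, Prod.mk.injEq] at hd ⊢ <;> grind

/-- At the modes at which forwarding is allowed, being a continuation is a condition on modes alone
and is therefore stable under renaming. -/
theorem cont_iff {c c' : Chan} (h : c.mode = .R ∨ c.mode = .C) :
    Cont c c' ↔ c'.mode = c.mode := by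
  cases c <;> cases c' <;> simp_all [Cont, Chan.mode]

theorem ren_ch (c d x : Chan) : Function.update id (Ref.ch c) (.ch d) (.ch x) =
    .ch (Function.update id c d x) := by
  by_cases h : x = c <;> simp [h]

theorem Ctx.sub_toCtx (c d : Chan) (Δ : CCtx sg) :
    Ctx.sub (Function.update id (Ref.ch c) (.ch d)) Δ.toCtx =
      CCtx.toCtx (Δ.map fun e => (Function.update id c d e.1, e.2)) := by
  simp only [Ctx.sub, CCtx.toCtx, Multiset.map_map]
  exact Multiset.map_congr rfl fun e _ => by simp [ren_ch]

/-- Renaming of a channel in a message. -/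
theorem MTy.ren {Δ q M c A} (h : MTy sg Δ q M c A) {d d' : Chan} (hd : d'.mode = d.mode)
    (hm : d.mode = .R ∨ d.mode = .C) :
    MTy sg (Δ.map fun e => (Function.update id d d' e.1, e.2)) q (M.ren (.ch d) (.ch d'))
      (Function.update id d d' c) A := by
  have hmode : ∀ x : Chan, (Function.update id d d' x).mode = x.mode := by
    intro x
    by_cases h : x = d
    · subst h; simpa using hd
    · simp [h]
  have hcont : ∀ {x y}, Cont x y →
      Cont (Function.update id d d' x) (Function.update id d d' y) := by
    intro x y hxy
    by_cases h : (x.mode = .R ∨ x.mode = .C)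
    · rw [cont_iff (by rwa [hmode]), hmode, hmode]
      exact (cont_iff h).1 hxy
    -- At mode `L` the pair must stay on its shared channel; neither endpoint is renamed, since `d`
    -- has mode `R` or `C`.
    · rw [Function.update_of_ne (by rintro rfl; exact h hm), Function.update_of_ne (by
        rintro rfl; rw [hxy.mode_eq] at hm; exact h hm)]
      exact hxy
  have hinv : ∀ {Δ : CCtx sg} {x A}, Inv 0 Δ.toCtx (.ch x) A →
      Inv 0 (CCtx.toCtx (Δ.map fun e => (Function.update id d d' e.1, e.2)))
        (.ch (Function.update id d d' x)) A := by
    intro Δ x A h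
    have := h.sub (moves_ren (r := .ch d) hd) (Γ' := 0)
      ⟨fun e he => by simp at he, fun e he => by simp at he, fun e he => by simp at he⟩
      fun _ => rfl
    rwa [Ctx.sub_toCtx, ren_ch] at this
  obtain ⟨q₀, hq, h⟩ := h.core
  refine .relax hq ?_
  cases h with
  | ichoice hi hc hk =>
    simpa [Proc.ren, Proc.chsub, ren_ch] using MTy.ichoice (hinv hi) (hcont hc) hk
  | echoice hi hc hk =>
    simpa [Proc.ren, Proc.chsub, ren_ch] using MTy.echoice (hinv hi) (hcont hc) hk
  | tensor hi hc hn =>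
    simpa [Proc.ren, Proc.chsub, ren_ch] using
      MTy.tensor (by simpa using hinv hi) (hcont hc) (by rwa [hmode])
  | lolli hi hc hn =>
    simpa [Proc.ren, Proc.chsub, ren_ch] using
      MTy.lolli (by simpa using hinv hi) (hcont hc) (by rwa [hmode])
  | times hi hc hN hT =>
    simpa [Proc.ren, Proc.chsub, ren_ch] using MTy.times (hinv hi) (hcont hc) hN hT
  | arrow hi hc hN hT =>
    simpa [Proc.ren, Proc.chsub, ren_ch] using MTy.arrow (hinv hi) (hcont hc) hN hT
  | one hi =>
    simpa [Proc.ren, Proc.chsub, ren_ch] using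
      MTy.one (by simpa using hinv (Δ := 0) hi)
  | pay hi hc => simpa [Proc.ren, Proc.chsub, ren_ch] using MTy.pay (hinv hi) (hcont hc)
  | get hi hc => simpa [Proc.ren, Proc.chsub, ren_ch] using MTy.get (hinv hi) (hcont hc)

/-! ## Properties of the unordered configuration typing -/

theorem ObjTy.linear_le {Γ₀ : CCtx sg} {o Δ e S L} (h : ObjTy Γ₀ o Δ e S L) :
    L.map Prod.fst ≤ {o.chan} := by
  cases h with
  | proc _ h _ => cases h <;> simp [Obj.chan]
  | msg => simp [Obj.chan]

theorem ObjTy.shared_of_mode {Γ₀ : CCtx sg} {o Δ e S L} (h : ObjTy Γ₀ o Δ e S L)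
    (hm : o.chan.mode = .S) : o.chan ∈ S.map Prod.fst := by
  cases h with
  | proc _ h _ => cases h <;> simp_all [Obj.chan, Chan.mode]
  | msg h => exact absurd hm h.mode_ne

/-- A shared channel on offer has a live provider, either in its shared phase or in its linear
phase. This is why freshness of a shared channel must also exclude its linear counterparts. -/
theorem ObjTy.mem_shared {Γ₀ : CCtx sg} {o Δ e S L} (h : ObjTy Γ₀ o Δ e S L) {c}
    (hc : c ∈ S.map Prod.fst) : ∃ a, c = .S a ∧ (o.chan = .S a ∨ ∃ i, o.chan = .L a i) := by
  cases h with
  | proc _ h _ => cases h <;> simp_all [Obj.chan]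
  | msg h => simp at hc

/-- The condition on an object refers to the fixed `rank` and not to the objects added before it, so
any object can be taken as the last one added. -/
theorem Net.pop {Γ₀ : CCtx sg} {rank E' o Ω Γ' U' L'}
    (h : Net Γ₀ rank E' (o ::ₘ Ω) Γ' U' L') :
    ∃ Δ e S O E Γ U L, ObjTy Γ₀ o Δ e S O ∧ (∀ d ∈ Δ, Below rank d.1 o.chan) ∧
      Net Γ₀ rank E Ω Γ U L ∧ E' = e + E ∧ Γ' = S + Γ ∧ U' = Δ + U ∧ L' = O + L := by
  generalize hΩ : o ::ₘ Ω = Ω' at h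
  induction h generalizing Ω with
  | emp => exact absurd hΩ (Multiset.cons_ne_zero)
  | @cons E E' Ω₁ Γ Γ' U U' L L' o₁ Δ e S O h₁ h₂ h₃ hE hΓ hU hL ih =>
    rcases Multiset.cons_eq_cons.1 hΩ with ⟨rfl, rfl⟩ | ⟨-, Ω₂, rfl, rfl⟩
    · exact ⟨Δ, e, S, O, E, Γ, U, L, h₁, h₂, h₃, hE, hΓ, hU, hL⟩
    · obtain ⟨Δ₂, e₂, S₂, O₂, E₂, Γ₂, U₂, L₂, k₁, k₂, k₃, rfl, rfl, rfl, rfl⟩ := ih rfl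
      refine ⟨Δ₂, e₂, S₂, O₂, e + E₂, S + Γ₂, Δ + U₂, O + L₂, k₁, k₂,
        .cons h₁ h₂ k₃ rfl rfl rfl rfl, ?_, ?_, ?_, ?_⟩
      · omega
      · rw [hΓ]; abel
      · rw [hU]; abel
      · rw [hL]; abel

theorem Net.inv_zero {Γ₀ : CCtx sg} {rank E Γ U L} (h : Net Γ₀ rank E 0 Γ U L) :
    E = 0 ∧ Γ = 0 ∧ U = 0 ∧ L = 0 := by
  generalize hΩ : (0 : Config) = Ω at h
  cases h with
  | emp => exact ⟨rfl, rfl, rfl, rfl⟩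
  | cons => exact absurd hΩ.symm Multiset.cons_ne_zero

theorem Net.inv_one {Γ₀ : CCtx sg} {rank E o Γ U L} (h : Net Γ₀ rank E {o} Γ U L) :
    ObjTy Γ₀ o U E Γ L ∧ ∀ d ∈ U, Below rank d.1 o.chan := by
  obtain ⟨Δ, e, S, O, E, Γ, U, L, h₁, h₂, h₃, rfl, rfl, rfl, rfl⟩ := Net.pop h
  obtain ⟨rfl, rfl, rfl, rfl⟩ := h₃.inv_zero
  simp only [add_zero]
  exact ⟨h₁, h₂⟩

theorem Net.inv_two {Γ₀ : CCtx sg} {rank E o o' Γ U L} (h : Net Γ₀ rank E {o, o'} Γ U L) :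
    ∃ Δ e S O Δ' e' S' O', ObjTy Γ₀ o Δ e S O ∧ (∀ d ∈ Δ, Below rank d.1 o.chan) ∧
      ObjTy Γ₀ o' Δ' e' S' O' ∧ (∀ d ∈ Δ', Below rank d.1 o'.chan) ∧
      E = e + e' ∧ Γ = S + S' ∧ U = Δ + Δ' ∧ L = O + O' := by
  obtain ⟨Δ, e, S, O, E, Γ, U, L, h₁, h₂, h₃, rfl, rfl, rfl, rfl⟩ := Net.pop h
  obtain ⟨h₃, h₄⟩ := h₃.inv_one
  exact ⟨Δ, e, S, O, U, E, Γ, L, h₁, h₂, h₃, h₄, rfl, rfl, rfl, rfl⟩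

theorem Net.one {Γ₀ : CCtx sg} {rank e o Δ S O} (h : ObjTy Γ₀ o Δ e S O)
    (hb : ∀ d ∈ Δ, Below rank d.1 o.chan) : Net Γ₀ rank e {o} S Δ O :=
  .cons h hb .emp rfl (add_zero _).symm (add_zero _).symm (add_zero _).symm

theorem Net.two {Γ₀ : CCtx sg} {rank e e' o o' Δ Δ' S S' O O'} (h : ObjTy Γ₀ o Δ e S O)
    (hb : ∀ d ∈ Δ, Below rank d.1 o.chan) (h' : ObjTy Γ₀ o' Δ' e' S' O')
    (hb' : ∀ d ∈ Δ', Below rank d.1 o'.chan) :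
    Net Γ₀ rank (e + e') {o, o'} (S + S') (Δ + Δ') (O + O') :=
  .cons h hb (.one h' hb') rfl rfl rfl rfl

theorem Net.join {Γ₀ : CCtx sg} {rank E E' Ω Ω' Γ Γ' U U' L L'} (h : Net Γ₀ rank E Ω Γ U L)
    (h' : Net Γ₀ rank E' Ω' Γ' U' L') :
    Net Γ₀ rank (E + E') (Ω + Ω') (Γ + Γ') (U + U') (L + L') := by
  induction h with
  | emp => simpa using h'
  | cons h₁ h₂ _ hE hΓ hU hL ih =>
    subst hE hΓ hU hL
    rw [Multiset.cons_add]
    exact .cons h₁ h₂ ih (by omega) (by abel) (by abel) (by abel)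

theorem Net.split {Γ₀ : CCtx sg} {rank} {Ω Ω' : Config} :
    ∀ {E Γ U L}, Net Γ₀ rank E (Ω + Ω') Γ U L →
      ∃ E₁ Γ₁ U₁ L₁ E₂ Γ₂ U₂ L₂, Net Γ₀ rank E₁ Ω Γ₁ U₁ L₁ ∧ Net Γ₀ rank E₂ Ω' Γ₂ U₂ L₂ ∧
        E = E₁ + E₂ ∧ Γ = Γ₁ + Γ₂ ∧ U = U₁ + U₂ ∧ L = L₁ + L₂ := by
  induction Ω using Multiset.induction_on with
  | empty =>
    intro E Γ U L h
    exact ⟨0, 0, 0, 0, E, Γ, U, L, .emp, by simpa using h, by simp, by simp, by simp, by simp⟩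
  | cons o Ω ih =>
    intro E Γ U L h
    rw [Multiset.cons_add] at h
    obtain ⟨Δ, e, S, O, E, Γ, U, L, h₁, h₂, h₃, rfl, rfl, rfl, rfl⟩ := h.pop
    obtain ⟨E₁, Γ₁, U₁, L₁, E₂, Γ₂, U₂, L₂, k₁, k₂, rfl, rfl, rfl, rfl⟩ := ih h₃
    exact ⟨_, _, _, _, _, _, _, _, .cons h₁ h₂ k₁ rfl rfl rfl rfl, k₂, by omega, by abel, by abel,
      by abel⟩

/-- With distinct providers, the linear channels on offer are distinct, and hence so are those in
use, as they are part of the offer in a complete configuration. -/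
theorem Net.linear_le {Γ₀ : CCtx sg} {rank E Ω Γ U L} (h : Net Γ₀ rank E Ω Γ U L) :
    L.map Prod.fst ≤ Ω.map Obj.chan := by
  induction h with
  | emp => simp
  | cons h₁ _ _ _ _ _ hL ih =>
    subst hL
    rw [Multiset.map_add, Multiset.map_cons, ← Multiset.singleton_add]
    exact add_le_add h₁.linear_le ih

theorem Net.shared_of_mode {Γ₀ : CCtx sg} {rank E Ω Γ U L} (h : Net Γ₀ rank E Ω Γ U L) {c}
    (hc : c ∈ Ω.map Obj.chan) (hm : c.mode = .S) : c ∈ Γ.map Prod.fst := by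
  induction h with
  | emp => simp at hc
  | cons h₁ _ _ _ hΓ _ _ ih =>
    subst hΓ
    rw [Multiset.map_add, Multiset.mem_add]
    rw [Multiset.map_cons, Multiset.mem_cons] at hc
    rcases hc with rfl | hc
    · exact .inl (h₁.shared_of_mode hm)
    · exact .inr (ih hc)

theorem Net.mem_shared {Γ₀ : CCtx sg} {rank E Ω Γ U L} (h : Net Γ₀ rank E Ω Γ U L) {c}
    (hc : c ∈ Γ.map Prod.fst) :
    ∃ a, c = .S a ∧ (.S a ∈ Ω.map Obj.chan ∨ ∃ i, .L a i ∈ Ω.map Obj.chan) := by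
  induction h with
  | emp => simp at hc
  | cons h₁ _ _ _ hΓ _ _ ih =>
    subst hΓ
    rw [Multiset.map_add, Multiset.mem_add] at hc
    simp only [Multiset.map_cons, Multiset.mem_cons]
    rcases hc with hc | hc
    · obtain ⟨a, ha, h | ⟨i, h⟩⟩ := h₁.mem_shared hc
      · exact ⟨a, ha, .inl (.inl h.symm)⟩
      · exact ⟨a, ha, .inr ⟨i, .inl h.symm⟩⟩
    · obtain ⟨a, ha, h | ⟨i, h⟩⟩ := ih hc
      · exact ⟨a, ha, .inl (.inr h)⟩
      · exact ⟨a, ha, .inr ⟨i, .inr h⟩⟩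

theorem Net.used_bound {Γ₀ : CCtx sg} {rank E Ω Γ U L} (h : Net Γ₀ rank E Ω Γ U L) {d}
    (hd : d ∈ U) : ∃ o ∈ Ω, Below rank d.1 o.chan := by
  induction h with
  | emp => simp at hd
  | cons _ hb _ _ _ hU _ ih =>
    subst hU
    rcases Multiset.mem_add.1 hd with hd | hd
    · exact ⟨_, Multiset.mem_cons_self _ _, hb d hd⟩
    · obtain ⟨o, ho, h⟩ := ih hd
      exact ⟨o, Multiset.mem_cons_of_mem ho, h⟩

theorem Net.rank_congr {Γ₀ : CCtx sg} {rank rank' : Chan → ℕ} {E Ω Γ U L}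
    (h : Net Γ₀ rank E Ω Γ U L) (hr : ∀ d ∈ U, ∀ c ∈ Ω.map Obj.chan,
      Below rank d.1 c → Below rank' d.1 c) : Net Γ₀ rank' E Ω Γ U L := by
  induction h with
  | emp => exact .emp
  | cons h₁ hb _ hE hΓ hU hL ih =>
    subst hU
    refine .cons h₁ (fun d hd => hr d (Multiset.mem_add.2 (.inl hd)) _ (by simp) (hb d hd))
      (ih fun d hd c hc => hr d (Multiset.mem_add.2 (.inr hd)) c ?_) hE hΓ rfl hL
    rw [Multiset.map_cons]
    exact Multiset.mem_cons_of_mem hc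

/-- Needed when a spawn declares a new shared channel: all other objects must be retyped over the
larger `Γ₀`. Providers of mode `R` do not see `Γ₀`. -/
theorem ObjTy.weaken {Γ₀ : CCtx sg} {o Δ e S L} (h : ObjTy Γ₀ o Δ e S L) (N : CCtx sg)
    (hN : ∀ e ∈ N, e.1.mode = .S ∧ Lang .S e.2) : ObjTy (N + Γ₀) o Δ e S L := by
  cases h with
  | msg h he => exact .msg h he
  | @proc c w P Δ q e A S L h h' he =>
    refine .proc (h.weaken_shared ?_ ?_ (fun e => sharedFor_old) fun hR => sharedFor_eq_zero hR)
      (h'.mono (Multiset.le_add_left _ _)) he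
    · intro e he
      have := mem_sharedFor he
      simp [sharedFor, this]
    · intro e he
      have he' := mem_sharedFor he
      rw [CCtx.toCtx_add, Multiset.mem_add] at he'
      rcases he' with ⟨he' | he', hc⟩
      · obtain ⟨d, hd, hm⟩ := CCtx.mem_toCtx he'
        rw [hd]
        exact hN _ hm
      · exact h.inv.shared e (by simpa [sharedFor, hc] using he')

theorem Net.weaken {Γ₀ : CCtx sg} {rank E Ω Γ U L} (h : Net Γ₀ rank E Ω Γ U L) (N : CCtx sg)
    (hN : ∀ e ∈ N, e.1.mode = .S ∧ Lang .S e.2) : Net (N + Γ₀) rank E Ω Γ U L := by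
  induction h with
  | emp => exact .emp
  | cons h₁ hb _ hE hΓ hU hL ih => exact .cons (h₁.weaken N hN) hb ih hE hΓ hU hL

/-! ## Ordered and unordered configuration typing -/

/-- In `ObjTy` the energy may exceed `q + w`. Here the surplus is turned into potential `e - w` by
weakening, so that the energy in `CTy` is exact. -/
theorem CTy.cons {Γ₀ : CCtx sg} {o Δ' e S O E Ω Γ Δ} (ho : ObjTy Γ₀ o Δ' e S O)
    (h : CTy sg Γ₀ E Ω Γ (Δ + Δ')) : CTy sg Γ₀ (E + e) (o ::ₘ Ω) (S + Γ) (O + Δ) := by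
  cases ho with
  | @msg c w M Δ' q e A hM he =>
    have := CTy.msg (w := w) h (hM.relax (show q ≤ e - w by omega))
    rw [show E + (e - w) + w = E + e by omega] at this
    simpa using this
  | @proc c w P Δ' q e A S L hP hO he =>
    have hP := hP.relax (show q ≤ e - w by omega)
    cases hO with
    | R =>
      have := CTy.procR (w := w) h rfl hP
      rw [show E + (e - w) + w = E + e by omega] at this
      simpa using this
    | C =>
      have := CTy.procC (w := w) h rfl hP
      rw [show E + (e - w) + w = E + e by omega] at this
      simpa using this
    | S h₁ h₂ =>
      have := CTy.procS (w := w) h₁ h₂ h hP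
      rw [show E + (e - w) + w = E + e by omega] at this
      simpa using this
    | L h₁ h₂ =>
      have := CTy.procL (w := w) h₁ h₂ h hP
      rw [show E + (e - w) + w = E + e by omega] at this
      simpa using this

/-- A nonempty finite set has a maximal element with respect to a strict order. -/
theorem exists_not_below (rank : Chan → ℕ) {Ω : Config} (h : Ω ≠ 0) :
    ∃ o ∈ Ω, ∀ o' ∈ Ω, ¬ Below rank o.chan o'.chan := by
  induction Ω using Multiset.induction_on with
  | empty => exact absurd rfl h
  | cons a Ω ih =>
    by_cases hΩ : Ω = 0
    · subst hΩ
      refine ⟨a, by simp, fun o' ho' => ?_⟩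
      obtain rfl : o' = a := by simpa using ho'
      exact Below.irrefl
    · obtain ⟨o, ho, hmax⟩ := ih hΩ
      by_cases hoa : Below rank o.chan a.chan
      · refine ⟨a, by simp, fun o' ho' hb => ?_⟩
        rcases Multiset.mem_cons.1 ho' with rfl | ho'
        · exact Below.irrefl hb
        · exact hmax o' ho' (hoa.trans hb)
      · refine ⟨o, Multiset.mem_cons_of_mem ho, fun o' ho' hb => ?_⟩
        rcases Multiset.mem_cons.1 ho' with rfl | ho'
        · exact hoa hb
        · exact hmax o' ho' hb

/-- A maximal object `o` is used by no object, so what it offers must be part of the interface `Δ`.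
The other objects then satisfy the same balance, with the channels used by `o` returned to their
interface, and `o` is added last. -/
theorem Net.toCTy {Γ₀ : CCtx sg} {rank} {Ω : Config} : ∀ {E Γ U Δ},
    Net Γ₀ rank E Ω Γ U (U + Δ) → CTy sg Γ₀ E Ω Γ Δ := by
  classical
  induction hn : Multiset.card Ω generalizing Ω with
  | zero =>
    intro E Γ U Δ h
    obtain rfl := Multiset.card_eq_zero.1 hn
    obtain ⟨rfl, rfl, rfl, h⟩ := h.inv_zero
    obtain rfl : Δ = 0 := by simpa using h
    exact .emp
  | succ n ih =>
    intro E Γ U Δ h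
    obtain ⟨o, ho, hmax⟩ := exists_not_below rank (Ω := Ω) (by
      rintro rfl
      simp at hn)
    obtain ⟨Ω, rfl⟩ := Multiset.exists_cons_of_mem ho
    have hU : ∀ d ∈ U, d.1 ≠ o.chan := fun d hd hdo => by
      obtain ⟨o', ho', hb⟩ := h.used_bound hd
      exact hmax o' ho' (hdo ▸ hb)
    obtain ⟨Δ', e, S, O, E, Γ, U, L, h₁, h₂, h₃, rfl, rfl, rfl, hL⟩ := h.pop
    -- The total offer is `Δ' + U + Δ`, and no channel of `O` is in the used part; counting leaves
    -- only `Δ`.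
    have hO : O ≤ Δ := by
      have hle : O ≤ Δ' + U + Δ := hL ▸ Multiset.le_add_right _ _
      rw [Multiset.le_iff_count] at hle ⊢
      intro a
      by_cases ha : a ∈ O
      · have := hle a
        rw [Multiset.count_add] at this
        rw [Multiset.count_eq_zero_of_notMem (s := Δ' + U)] at this
        · simpa using this
        · intro ha'
          refine hU a ha' ?_
          have := Multiset.mem_of_le h₁.linear_le (Multiset.mem_map_of_mem Prod.fst ha)
          simpa using this
      · rw [Multiset.count_eq_zero_of_notMem ha]
        exact Nat.zero_le _
    obtain ⟨Δ, rfl⟩ := Multiset.le_iff_exists_add.1 hO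
    obtain rfl : L = U + (Δ + Δ') := by
      have : O + L = O + (U + (Δ + Δ')) := by rw [← hL]; abel
      exact add_left_cancel this
    have := CTy.cons h₁ (ih (by simpa using hn) h₃)
    rwa [add_comm E] at this

/-- The new object gets a rank above everything it uses. Every channel in use has a provider in `Ω`,
hence differs from `o.chan`, and changing the rank there affects no earlier dependency. -/
theorem Net.extend {Γ₀ : CCtx sg} {rank E Ω Γ U Δ Δ' o e S O} (ho : ObjTy Γ₀ o Δ' e S O)
    (h : Net Γ₀ rank E Ω Γ U (U + (Δ + Δ'))) (hnew : o.chan ∉ Ω.map Obj.chan) :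
    ∃ rank' : Chan → ℕ, ∃ U', Net Γ₀ rank' (E + e) (o ::ₘ Ω) (S + Γ) U' (U' + (O + Δ)) := by
  have hL : ∀ d ∈ U + (Δ + Δ'), d.1 ≠ o.chan := fun d hd hdo => by
    have := Multiset.mem_of_le h.linear_le (Multiset.mem_map_of_mem Prod.fst hd)
    exact hnew (hdo ▸ this)
  -- This is the mode component of `Below`, and it is guaranteed by the typing invariant at mode
  -- `R`.
  have hmode : o.chan.mode = .R → ∀ d ∈ Δ', d.1.mode = .R := by
    intro hR d hd
    cases ho with
    | proc hP =>
      exact (hP.inv.modeR hR).2 _ (CCtx.mem_toCtx_ch.2 hd)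
    | msg hM =>
      obtain ⟨_, _, hM⟩ := hM.core
      cases hM with
      | one => simp at hd
      | ichoice hi | echoice hi | tensor hi | lolli hi | times hi | arrow hi | pay hi | get hi =>
        exact (hi.modeR hR).2 _ (CCtx.mem_toCtx_ch.2 hd)
  obtain ⟨B, hB⟩ : ∃ B, ∀ d ∈ Δ', rank d.1 < B :=
    ⟨(Δ'.map fun d => rank d.1).sum + 1, fun d hd => Nat.lt_succ_of_le
      (Multiset.le_sum_of_mem (Multiset.mem_map_of_mem (fun d => rank d.1) hd))⟩
  refine ⟨Function.update rank o.chan B, Δ' + U, ?_⟩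
  refine .cons ho (fun d hd => ⟨fun hR => hmode hR d hd, fun _ => ?_⟩) (h.rank_congr ?_)
    (by omega) rfl rfl (by abel)
  · rw [Function.update_self, Function.update_of_ne (hL d (by simp [hd]))]
    exact hB d hd
  · intro d hd c hc hb
    have hdo : d.1 ≠ o.chan := hL d (by simp [hd])
    have hco : c ≠ o.chan := fun h => hnew (h ▸ hc)
    exact ⟨hb.1, by simpa [hdo, hco] using hb.2⟩

theorem CTy.toNet {Γ₀ : CCtx sg} {E Ω Γ Δ} (h : CTy sg Γ₀ E Ω Γ Δ)
    (hn : (Ω.map Obj.chan).Nodup) :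
    ∃ rank : Chan → ℕ, ∃ U, Net Γ₀ rank E Ω Γ U (U + Δ) := by
  induction h with
  | emp => exact ⟨fun _ => 0, 0, .emp⟩
  | @procR E q w c P Ω Γ Δ Δ' A _ hc hP ih =>
    rw [Multiset.map_cons, Multiset.nodup_cons] at hn
    obtain ⟨rank, U, h⟩ := ih hn.2
    cases c <;> try cases hc
    have := h.extend (.proc (w := w) hP .R le_rfl) hn.1
    simpa [add_assoc] using this
  | @procC E q w c P Ω Γ Δ Δ' A _ hc hP ih =>
    rw [Multiset.map_cons, Multiset.nodup_cons] at hn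
    obtain ⟨rank, U, h⟩ := ih hn.2
    cases c <;> try cases hc
    have := h.extend (.proc (w := w) hP .C le_rfl) hn.1
    simpa [add_assoc] using this
  | @procS E q w a P Ω Γ Δ Δ' A h₁ h₂ _ hP ih =>
    rw [Multiset.map_cons, Multiset.nodup_cons] at hn
    obtain ⟨rank, U, h⟩ := ih hn.2
    have := h.extend (.proc (w := w) hP (.S h₁ h₂) le_rfl) hn.1
    simpa [add_assoc] using this
  | @procL E q w a i P Ω Γ Δ Δ' A B h₁ h₂ _ hP ih =>
    rw [Multiset.map_cons, Multiset.nodup_cons] at hn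
    obtain ⟨rank, U, h⟩ := ih hn.2
    have := h.extend (.proc (w := w) hP (.L h₁ h₂) le_rfl) hn.1
    simpa [add_assoc] using this
  | @msg E q w c M Ω Γ Δ Δ' A _ hM ih =>
    rw [Multiset.map_cons, Multiset.nodup_cons] at hn
    obtain ⟨rank, U, h⟩ := ih hn.2
    have := h.extend (.msg (w := w) hM le_rfl) hn.1
    simpa [add_assoc] using this

/-! ## Equi-synchronizing types -/

/-- `ESync` is the largest relation closed under its rules read backwards, so it unfolds to itself.
The lemmas below use this to follow a protocol one communication at a time. -/
theorem ESync.step {A C : SType sg} (h : ESync A C) : ESyncStep ESync A C := by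
  obtain ⟨E, hE, h⟩ := h
  have key : ∀ {X Y}, E X Y → ESync X Y := fun h => ⟨E, hE, h⟩
  cases hE _ _ h with
  | ichoice h => exact .ichoice fun l hl => key (h l hl)
  | echoice h => exact .echoice fun l hl => key (h l hl)
  | tensor h => exact .tensor (key h)
  | lolli h => exact .lolli (key h)
  | times h => exact .times (key h)
  | arrow h => exact .arrow (key h)
  | pay h => exact .pay (key h)
  | get h => exact .get (key h)
  | up h' => exact .up (key h')
  | down h' => exact .down (key h')

theorem ESync.ichoice {K B} {C : SType sg} (h : ESync (.ichoice K B) C) {l} (hl : l ∈ K) :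
    ESync (B l) C := by
  have h := h.step
  generalize hA : SType.ichoice K B = A at h
  cases h with
  | ichoice h =>
    obtain ⟨rfl, hB⟩ := SType.ichoice_inj hA
    exact hB l hl ▸ h l hl
  | _ => cases SType.match_of_eq hA

theorem ESync.echoice {K B} {C : SType sg} (h : ESync (.echoice K B) C) {l} (hl : l ∈ K) :
    ESync (B l) C := by
  have h := h.step
  generalize hA : SType.echoice K B = A at h
  cases h with
  | echoice h =>
    obtain ⟨rfl, hB⟩ := SType.echoice_inj hA
    exact hB l hl ▸ h l hl
  | _ => cases SType.match_of_eq hA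

theorem ESync.tensor {n} {A B C : SType sg} (h : ESync (.tensor n A B) C) : ESync B C := by
  have h := h.step
  generalize hA : SType.tensor n A B = A' at h
  cases h with
  | tensor h => rwa [(SType.tensor_inj hA).2.2]
  | _ => cases SType.match_of_eq hA

theorem ESync.lolli {n} {A B C : SType sg} (h : ESync (.lolli n A B) C) : ESync B C := by
  have h := h.step
  generalize hA : SType.lolli n A B = A' at h
  cases h with
  | lolli h => rwa [(SType.lolli_inj hA).2.2]
  | _ => cases SType.match_of_eq hA

theorem ESync.times {τ} {B C : SType sg} (h : ESync (.times τ B) C) : ESync B C := by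
  have h := h.step
  generalize hA : SType.times τ B = A' at h
  cases h with
  | times h => rwa [(SType.times_inj hA).2]
  | _ => cases SType.match_of_eq hA

theorem ESync.arrow {τ} {B C : SType sg} (h : ESync (.arrow τ B) C) : ESync B C := by
  have h := h.step
  generalize hA : SType.arrow τ B = A' at h
  cases h with
  | arrow h => rwa [(SType.arrow_inj hA).2]
  | _ => cases SType.match_of_eq hA

theorem ESync.pay {r} {B C : SType sg} (h : ESync (.pay r B) C) : ESync B C := by
  have h := h.step
  generalize hA : SType.pay r B = A' at h
  cases h with
  | pay h => rwa [(SType.pay_inj hA).2]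
  | _ => cases SType.match_of_eq hA

theorem ESync.get {r} {B C : SType sg} (h : ESync (.get r B) C) : ESync B C := by
  have h := h.step
  generalize hA : SType.get r B = A' at h
  cases h with
  | get h => rwa [(SType.get_inj hA).2]
  | _ => cases SType.match_of_eq hA

/-- Used at an acquire: the linear phase begins with a type that must lead back to the whole shared
type. -/
theorem ESync.up {B C : SType sg} (h : ESync (.up B) C) : C = .up B ∧ ESync B (.up B) := by
  have h := h.step
  generalize hA : SType.up B = A' at h
  cases h with
  | up h' =>
    obtain rfl := SType.up_inj hA
    exact ⟨rfl, h'⟩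
  | _ => cases SType.match_of_eq hA

/-- Used at a release: the type reached is the declared one, and it is again equi-synchronizing with
itself, as required of a shared provider. -/
theorem ESync.down {B C : SType sg} (h : ESync (.down B) C) : C = B ∧ ESync B B := by
  have h := h.step
  generalize hA : SType.down B = A' at h
  cases h with
  | down h' =>
    obtain rfl := SType.down_inj hA
    exact ⟨rfl, h'⟩
  | _ => cases SType.match_of_eq hA

/-! ## Running a suspended process -/

theorem multi_of_mem {l : List (Ref × Ref)} (hn : (l.map Prod.fst).Nodup) {r s}
    (h : (r, s) ∈ l) : multi l r = s := by
  induction l with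
  | nil => cases h
  | cons e l ih =>
    obtain ⟨a, b⟩ := e
    rw [List.map_cons, List.nodup_cons] at hn
    rcases List.mem_cons.1 h with h' | h'
    · cases h'
      simp [multi]
    · have hne : r ≠ a := by
        rintro rfl
        exact hn.1 (List.mem_map.2 ⟨_, h', rfl⟩)
      simpa [multi, List.lookup_cons, beq_false_of_ne hne] using ih hn.2 h'

theorem multi_cases (l : List (Ref × Ref)) (r : Ref) : multi l r = r ∨ (r, multi l r) ∈ l := by
  induction l with
  | nil => exact .inl rfl
  | cons e l ih =>
    obtain ⟨a, b⟩ := e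
    by_cases h : r = a
    · subst h
      exact .inr (by simp [multi])
    · have : multi ((a, b) :: l) r = multi l r := by
        simp [multi, List.lookup_cons, beq_false_of_ne h]
      rw [this]
      exact ih.imp_right (List.mem_cons_of_mem _)

theorem map_eq_of_zip {σ : Ref → Ref} {l l' : List Ref} (h : l.length = l'.length)
    (hσ : ∀ e ∈ l.zip l', σ e.1 = e.2) : l.map σ = l' := by
  refine List.ext_getElem (by simpa using h) fun i h₁ h₂ => ?_
  have h₁' : i < l.length := by simpa using h₁
  rw [List.getElem_map]
  exact hσ (l[i], l'[i]) (by
    rw [List.mem_iff_getElem]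
    exact ⟨i, by simp; omega, by simp⟩)

theorem mode_eq_of_zip {l l' : List Ref} (h : l.map Ref.mode = l'.map Ref.mode) {r s}
    (hrs : (r, s) ∈ l.zip l') : s.mode = r.mode := by
  obtain ⟨i, hi, he⟩ := List.mem_iff_getElem.1 hrs
  rw [List.getElem_zip] at he
  cases he
  have h₁ : i < l.length := by simp at hi; omega
  have h₂ : i < l'.length := by simp at hi; omega
  have := congrArg (fun m => m[i]?) h
  simpa [h₁, h₂] using this.symm

/-- All free channels of a suspended process are bound by its header, and these variables are
distinct. So the simultaneous substitution sends each of them to its argument, and substitution of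
run-time channels applies. The linear arguments are only required to be run-time channels of the
right modes, since the resulting context is read off from the lists. -/
theorem ETy.run {p k x ys zs P A As Ds as bs} {c : Chan} {Γ : Ctx sg}
    (h : ETy sg FCtx.empty p (.proc k x ys zs P) (.proc k A As Ds)) (hc : c.mode = k)
    (has : List.Forall₂ (fun a B => (a, B) ∈ Γ) as As)
    (hΓ : ∀ e ∈ Γ, e.1.mode = .S ∧ Lang .S e.2) (hch : ∀ e ∈ Γ, ∃ c, e.1 = .ch c)
    (hbs : ∀ b ∈ bs, ∃ c, b = .ch c) (hm : bs.map Ref.mode = Ds.map Prod.fst)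
    (hR : k = .R → Γ = 0) :
    PTy sg FCtx.empty Γ ((bs.zip (Ds.map Prod.snd) : List _) : Ctx sg) p
      (P.chsub (multi ((.var x k, .ch c) ::
        ((ys.map (Ref.var · .S)).zip as ++ (zs.map fun z => Ref.var z.1 z.2).zip bs))))
      (.ch c) A := by
  obtain ⟨p₀, hp, h⟩ := h.core
  generalize hτ : FType.proc k A As Ds = τ at h
  cases h with
  | proc hk hl hl' hn hP =>
    obtain ⟨-, rfl, rfl, rfl⟩ := FType.proc_inj hτ
    have hlen : (ys.map (Ref.var · .S)).length = as.length := by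
      rw [List.length_map, hl, has.length_eq]
    have hlen' : (zs.map fun z => Ref.var z.1 z.2).length = bs.length := by
      have h₁ := congrArg List.length hl'
      have h₂ := congrArg List.length hm
      simp only [List.length_map] at h₁ h₂ ⊢
      omega
    set l : List (Ref × Ref) := (.var x k, .ch c) ::
        ((ys.map (Ref.var · .S)).zip as ++ (zs.map fun z => Ref.var z.1 z.2).zip bs) with hldef
    have hn' : (l.map Prod.fst).Nodup := by
      rw [hldef, List.map_cons, List.map_append, List.map_fst_zip hlen.le,
        List.map_fst_zip hlen'.le]
      exact hn
    -- Every target is a run-time channel of the mode of its source, which is what `Moves` demands.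
    have hmode : ∀ r s, (r, s) ∈ l → s.mode = r.mode ∧ ∃ c, s = .ch c := by
      intro r s hrs
      rw [hldef, List.mem_cons, List.mem_append] at hrs
      rcases hrs with hrs | hrs | hrs
      · cases hrs
        exact ⟨hc, c, rfl⟩
      · have ha : s ∈ as := (List.of_mem_zip hrs).2
        obtain ⟨i, hi, rfl⟩ := List.mem_iff_getElem.1 ha
        have := List.Forall₂.get has hi (has.length_eq ▸ hi)
        obtain ⟨y, -, rfl⟩ := List.mem_map.1 (List.of_mem_zip hrs).1
        exact ⟨(hΓ _ this).1, hch _ this⟩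
      · refine ⟨mode_eq_of_zip ?_ hrs, hbs _ (List.of_mem_zip hrs).2⟩
        rw [hm, ← hl', List.map_map]
        rfl
    have hσ : Moves (multi l) := by
      constructor <;> intro r <;> rcases multi_cases l r with h | h
      · rw [h]
      · exact (hmode _ _ h).1
      · exact .inl h
      · exact .inr (hmode _ _ h).2
    have h₁ : (ys.map (Ref.var · .S)).map (multi l) = as :=
      map_eq_of_zip hlen fun e he => multi_of_mem hn' (by simp [hldef, he])
    have h₂ : (zs.map fun z => Ref.var z.1 z.2).map (multi l) = bs :=
      map_eq_of_zip hlen' fun e he => multi_of_mem hn' (by simp [hldef, he])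
    have h₃ : multi l (.var x k) = .ch c := multi_of_mem hn' (by simp [hldef])
    have := hP.chsub (Γ' := Γ) hσ ⟨?_, hΓ, fun e he => .inl (hch e he)⟩ hR
    · rw [Ctx.sub_zip, h₂, h₃] at this
      exact this.relax hp
    · intro e he
      have he' := Multiset.mem_coe.1 he
      obtain ⟨i, hi, rfl⟩ := List.mem_iff_getElem.1 he'
      have hi₁ : i < ys.length := by simp at hi; omega
      have hi₂ : i < as.length := by simp at hlen; omega
      have := List.Forall₂.get has hi₂ (has.length_eq ▸ hi₂)
      have h₄ : multi l (.var ys[i] .S) = as[i] := by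
        have := congrArg (fun m => m[i]?) h₁
        simpa [hi₁, hi₂] using this
      simpa [h₄] using this

/-! ## Local rewriting -/

/-- The context in which a local rewriting step takes place. -/
structure Ambient (fresh : Chan → Prop) (Γ₀ : CCtx sg) (Ω : Config) (Γ U L : CCtx sg) : Prop where
  used : (U.map Prod.fst).Nodup
  agree : ∀ {c A A'}, (c, A) ∈ U → (c, A') ∈ L → A = A'
  chans : (Ω.map Obj.chan).Nodup
  unique₀ : (Γ₀.map Prod.fst).Nodup
  fresh_used : ∀ {c}, fresh c → ∀ e ∈ U, e.1 ≠ c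
  fresh_chan : ∀ {c}, fresh c → c ∉ Ω.map Obj.chan

/-- The objects `Ω'` can replace `Ω`, which offers `Γ` and `L` and uses `U`. -/
def LocalStep (fresh : Chan → Prop) (Γ₀ : CCtx sg) (rank : Chan → ℕ) (E : ℕ) (Ω Ω' : Config)
    (Γ U L : CCtx sg) : Prop :=
  ∃ (N : CCtx sg) (rank' : Chan → ℕ) (U' L' : CCtx sg),
    Net (N + Γ₀) rank' E Ω' (N + Γ) U' L' ∧ U' + L = U + L' ∧ (N.map Prod.fst).Nodup ∧
    (∀ e ∈ N, fresh e.1 ∧ e.1.mode = .S ∧ Lang .S e.2) ∧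
    (∀ x y, ¬ fresh x → ¬ fresh y → Below rank x y → Below rank' x y) ∧
    (Ω'.map Obj.chan).Nodup ∧
    ∀ c ∈ Ω'.map Obj.chan, c ∈ Ω.map Obj.chan ∨ fresh c ∨ c ∈ Γ.map Prod.fst

variable {fresh : Chan → Prop} {Γ₀ : CCtx sg} {rank : Chan → ℕ} {E : ℕ}

theorem LocalStep.of_net {Ω Ω' : Config} {Γ U L U' L' : CCtx sg} {rank' : Chan → ℕ}
    (h : Net Γ₀ rank' E Ω' Γ U' L') (hb : U' + L = U + L')
    (hr : ∀ x y, ¬ fresh x → ¬ fresh y → Below rank x y → Below rank' x y)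
    (hn : (Ω'.map Obj.chan).Nodup)
    (hc : ∀ c ∈ Ω'.map Obj.chan, c ∈ Ω.map Obj.chan ∨ fresh c ∨ c ∈ Γ.map Prod.fst) :
    LocalStep fresh Γ₀ rank E Ω Ω' Γ U L :=
  ⟨0, rank', U', L', by simpa using h, hb, by simp, by simp, hr, hn, hc⟩

/-- The objects are replaced by a single one. -/
theorem LocalStep.single {Ω : Config} {o : Obj} {Γ U L U' L' : CCtx sg}
    (h : ObjTy Γ₀ o U' E Γ L') (hr : ∀ d ∈ U', Below rank d.1 o.chan) (hb : U' + L = U + L')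
    (hc : o.chan ∈ Ω.map Obj.chan) : LocalStep fresh Γ₀ rank E Ω {o} Γ U L :=
  .of_net (.one h hr) hb (fun _ _ _ _ h => h) (by simp) (by
    simp only [Multiset.map_singleton, Multiset.mem_singleton, forall_eq]
    exact .inl hc)

/-- The provider of `c` sends a message on `c` and continues at the fresh channel `c'`. -/
theorem LocalStep.sendR {c c' w X P A B q r M} {S U L Δ₁ Δ₂ : CCtx sg}
    (ha : Ambient fresh Γ₀ {.proc c w X} S U L) (hO : Offer Γ₀ c A S L)
    (hb : ∀ d ∈ U, Below rank d.1 c) (hU : U = Δ₁ + Δ₂) (hf : fresh c') (hc : Cont c c')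
    (hP : PTy sg FCtx.empty (sharedFor Γ₀ c) Δ₂.toCtx q P (.ch c) B)
    (hB : ∀ X, ESync A X → ESync B X) (hM : MTy sg (Δ₁ + {(c', B)}) r M c A)
    (hE : q + r + w ≤ E) :
    LocalStep fresh Γ₀ rank E {.proc c w X} {.proc c' w (P.ren (.ch c) (.ch c')), .msg c 0 M}
      S U L := by
  subst hU
  have hcc : c ≠ c' := by
    rintro rfl
    exact ha.fresh_chan hf (by simp [Obj.chan])
  -- The continuation channel goes between the channels in use and `c`: the process now provides
  -- `c'`, and the message that provides `c` uses `c'`.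
  obtain ⟨rank', h₁, h₂, h₃⟩ := exists_rank_insert rank hcc (Δ₁ + Δ₂) (ha.fresh_used hf) hb
    (fun h e he => (hb e he).1 (by rwa [← hc.mode_eq])) (fun h => by rwa [hc.mode_eq])
  have hP' := hP.ren_chan rfl hc.mode_eq hc.mode_ne
  rw [CCtx.sub_ren_chan, Function.update_self, ← sharedFor_congr Γ₀ hc.mode_eq] at hP'
  swap
  · rintro e he rfl
    exact Below.irrefl (hb e (Multiset.mem_add.2 (.inr he)))
  obtain rfl := hO.linear hc.mode_ne
  -- The message takes its potential `r` with it and starts with work 0; the process retains the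
  -- rest of the energy.
  have hnet := Net.two (e := E - r) (ObjTy.proc (w := w) hP' (hO.cont hc hB) (by omega))
    (fun d hd => h₂ d (Multiset.mem_add.2 (.inr hd))) (ObjTy.msg (w := 0) hM le_rfl) (rank := rank') (by
    intro d hd
    rcases Multiset.mem_add.1 hd with hd | hd
    · exact (h₂ d (Multiset.mem_add.2 (.inl hd))).trans h₃
    · obtain rfl := Multiset.mem_singleton.1 hd
      exact h₃)
  rw [show E - r + (r + 0) = E by omega, add_zero] at hnet
  refine .of_net hnet (by abel) (fun x y hx hy => h₁ x y ?_ ?_) ?_ ?_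
  · rintro rfl; exact hx hf
  · rintro rfl; exact hy hf
  · simpa [Obj.chan] using hcc.symm
  · intro d hd
    simp only [Multiset.insert_eq_cons, Multiset.map_cons, Multiset.map_singleton, Obj.chan,
      Multiset.mem_cons, Multiset.mem_singleton] at hd ⊢
    rcases hd with rfl | rfl
    · exact .inr (.inl hf)
    · exact .inl rfl

/-- A client `d` of `c` sends a message on `c` and continues with the fresh channel `c'`. -/
theorem LocalStep.sendL {c c' d w X P A B C q r M} {S U L Δ₁ Δ₂ : CCtx sg}
    (ha : Ambient fresh Γ₀ {.proc d w X} S U L) (hO : Offer Γ₀ d C S L)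
    (hb : ∀ e ∈ U, Below rank e.1 d) (hU : U = Δ₁ + {(c, A)} + Δ₂) (hf : fresh c') (hc : Cont c c')
    (hP : PTy sg FCtx.empty (sharedFor Γ₀ d) (CCtx.toCtx ((c, B) ::ₘ Δ₂)) q P (.ch d) C)
    (hM : MTy sg (Δ₁ + {(c, A)}) r M c' B) (hm : c.mode = .R → ∀ e ∈ Δ₁, e.1.mode = .R)
    (hE : q + r + w ≤ E) :
    LocalStep fresh Γ₀ rank E {.proc d w X} {.msg c' 0 M, .proc d w (P.ren (.ch c) (.ch c'))}
      S U L := by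
  subst hU
  have hdc : d ≠ c' := by
    rintro rfl
    exact ha.fresh_chan hf (by simp [Obj.chan])
  have hdc' : d ≠ c := by
    rintro rfl
    exact Below.irrefl (hb (d, A) (by simp))
  -- Now the message provides `c'` and uses the old `c` together with the channel sent, if any, so
  -- `c'` is inserted between these and the client `d`.
  obtain ⟨rank', h₁, h₂, h₃⟩ := exists_rank_insert rank hdc (Δ₁ + {(c, A)})
    (fun e he => ha.fresh_used hf e (Multiset.mem_add.2 (.inl he)))
    (fun e he => hb e (Multiset.mem_add.2 (.inl he)))
    (fun h e he => by
      rw [hc.mode_eq] at h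
      rcases Multiset.mem_add.1 he with he | he
      · exact hm h e he
      · obtain rfl := Multiset.mem_singleton.1 he
        exact h)
    (fun h => by rw [hc.mode_eq]; exact (hb (c, A) (by simp)).1 h)
  have hP' := hP.ren_chan rfl hc.mode_eq hc.mode_ne
  rw [CCtx.toCtx_cons, Ctx.sub_cons, CCtx.sub_ren_chan, Function.update_self,
    Function.update_of_ne (by simpa using hdc')] at hP'
  swap
  -- No channel is used twice, so `c` does not recur in `Δ₂` and the renaming leaves `Δ₂` alone.
  · rintro e he rfl
    have := ha.used
    rw [Multiset.map_add, Multiset.map_add, Multiset.nodup_add] at this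
    exact Multiset.disjoint_left.1 this.2.2 (show e.1 ∈ _ by simp)
      (Multiset.mem_map_of_mem Prod.fst he)
  rw [id_eq] at hP'
  have hnet := Net.two (e' := E - r) (ObjTy.msg (w := 0) hM le_rfl) (rank := rank') h₂
    (ObjTy.proc (w := w) (Δ := (c', B) ::ₘ Δ₂) (by simpa using hP') hO (by omega)) (by
      intro e he
      rcases Multiset.mem_cons.1 he with rfl | he
      · exact h₃
      · exact h₁ _ _ (ha.fresh_used hf e (Multiset.mem_add.2 (.inr he))) hdc
          (hb e (Multiset.mem_add.2 (.inr he))))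
  rw [show r + 0 + (E - r) = E by omega, zero_add] at hnet
  refine .of_net hnet ?_ (fun x y hx hy => h₁ x y ?_ ?_) ?_ ?_
  · rw [← Multiset.singleton_add]; abel
  · rintro rfl; exact hx hf
  · rintro rfl; exact hy hf
  · simpa [Obj.chan] using hdc.symm
  · intro d hd
    simp only [Multiset.insert_eq_cons, Multiset.map_cons, Multiset.map_singleton, Obj.chan,
      Multiset.mem_cons, Multiset.mem_singleton] at hd ⊢
    rcases hd with rfl | rfl
    · exact .inr (.inl hf)
    · exact .inl rfl

/-- The client's side of a switch to the continuation channel. As `c` is neither the offered channel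
nor used elsewhere, the renaming moves only this one entry. -/
theorem PTy.continue {Δ : CCtx sg} {c c' d P q B C}
    (h : PTy sg FCtx.empty (sharedFor Γ₀ d) (CCtx.toCtx ((c, B) ::ₘ Δ)) q P (.ch d) C)
    (hc : Cont c c') (hd : d ≠ c) (hΔ : ∀ e ∈ Δ, e.1 ≠ c) :
    PTy sg FCtx.empty (sharedFor Γ₀ d) (CCtx.toCtx ((c', B) ::ₘ Δ)) q (P.ren (.ch c) (.ch c'))
      (.ch d) C := by
  have h := h.ren_chan rfl hc.mode_eq hc.mode_ne
  rw [CCtx.toCtx_cons, Ctx.sub_cons, CCtx.sub_ren_chan _ hΔ, Function.update_self,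
    Function.update_of_ne (by simpa using hd)] at h
  rwa [CCtx.toCtx_cons]

theorem PTy.receive_chan {Δ : CCtx sg} {y n e d P q A C}
    (h : PTy sg FCtx.empty (sharedFor Γ₀ d) ((.var y n, A) ::ₘ Δ.toCtx) q P (.ch d) C)
    (he : e.mode = n) :
    PTy sg FCtx.empty (sharedFor Γ₀ d) (CCtx.toCtx ((e, A) ::ₘ Δ)) q (P.ren (.var y n) (.ch e))
      (.ch d) C := by
  have h := h.ren_var (y := y) rfl he
  rw [Ctx.sub_cons, CCtx.sub_ren_var, Function.update_self,
    Function.update_of_ne (by simp)] at h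
  rwa [CCtx.toCtx_cons]

/-- A client `d` of `c` receives a message on `c`. -/
theorem LocalStep.receiveL {c d w w' M Q Q' q A C} {S L Δ Δ₀ : CCtx sg} (hO : Offer Γ₀ d C S L)
    (hm : ∀ e ∈ Δ, Below rank e.1 c) (hb : ∀ e ∈ (c, A) ::ₘ Δ₀, Below rank e.1 d)
    (hP : PTy sg FCtx.empty (sharedFor Γ₀ d) (Δ + Δ₀).toCtx q Q' (.ch d) C)
    (hE : q + (w + w') ≤ E) :
    LocalStep fresh Γ₀ rank E {.msg c w M, .proc d w' Q} {.proc d (w + w') Q'} (0 + S)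
      (Δ + (c, A) ::ₘ Δ₀) ({(c, A)} + L) := by
  refine .single (U' := Δ + Δ₀) (L' := L) (.proc hP ?_ hE) ?_ ?_ (by simp [Obj.chan])
  · simpa using hO
  · intro e he
    rcases Multiset.mem_add.1 he with he | he
    · exact (hm e he).trans (hb (c, A) (Multiset.mem_cons_self _ _))
    · exact hb e (Multiset.mem_cons_of_mem he)
  · rw [← Multiset.singleton_add]; abel

/-- The provider of `c` receives a message on `c` and continues at `c'`. -/
theorem LocalStep.receiveR {c c' w w' M Q Q' q A B} {S L Δ Δ₁ : CCtx sg} (hO : Offer Γ₀ c A S L)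
    (hm : ∀ e ∈ Δ₁ + {(c, A)}, Below rank e.1 c') (hb : ∀ e ∈ Δ, Below rank e.1 c)
    (hc : Cont c c') (hΔ₁ : ∀ e ∈ Δ₁, e.1 ≠ c)
    (hP : PTy sg FCtx.empty (sharedFor Γ₀ c) (Δ₁ + Δ).toCtx q Q' (.ch c) B)
    (hB : ∀ X, ESync A X → ESync B X) (hE : q + (w + w') ≤ E) :
    LocalStep fresh Γ₀ rank E {.proc c w' Q, .msg c' w M}
      {.proc c' (w + w') (Q'.ren (.ch c) (.ch c'))} (S + 0) (Δ + (Δ₁ + {(c, A)}))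
      (L + {(c', B)}) := by
  have hP' := hP.ren_chan rfl hc.mode_eq hc.mode_ne
  rw [CCtx.sub_ren_chan, Function.update_self, ← sharedFor_congr Γ₀ hc.mode_eq] at hP'
  swap
  · intro e he
    rcases Multiset.mem_add.1 he with he | he
    · exact hΔ₁ e he
    · rintro rfl
      exact Below.irrefl (hb e he)
  obtain rfl := hO.linear hc.mode_ne
  refine .single (.proc hP' (S := S + 0) ?_ hE) ?_ (U' := Δ₁ + Δ) (L' := {(c', B)}) ?_
    (by simp [Obj.chan])
  · simpa using hO.cont hc hB
  · intro e he
    rcases Multiset.mem_add.1 he with he | he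
    · exact hm e (Multiset.mem_add.2 (.inl he))
    · exact (hb e he).trans (hm (c, A) (by simp))
  · abel

theorem Ambient.notMem_used {Ω : Config} {Γ L Δ Δ₀ : CCtx sg} {c A}
    (h : Ambient fresh Γ₀ Ω Γ (Δ + (c, A) ::ₘ Δ₀) L) : ∀ e ∈ Δ₀, e.1 ≠ c := by
  rintro e he rfl
  have := h.used
  rw [Multiset.map_add, Multiset.map_cons, Multiset.nodup_add, Multiset.nodup_cons] at this
  exact this.2.1.1 (Multiset.mem_map.2 ⟨e, he, rfl⟩)

/-- No object uses the channel that it provides. The same process syntax serves for providers and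
clients, and this dismisses the client's rule when the process provides the channel in question. -/
theorem notMem_of_below {Δ : CCtx sg} {c} (h : ∀ e ∈ Δ, Below rank e.1 c) {A} {Δ' : CCtx sg}
    (hΔ : Δ = (c, A) ::ₘ Δ') : False :=
  Below.irrefl (h (c, A) (hΔ ▸ Multiset.mem_cons_self _ _))

variable {Γ U L : CCtx sg}

-- Local steps: evaluation, work and closing

theorem Net.internal_spawn (hsg : sg.WF) {c w k x M V μ as ds Q} (hM : Eval sg M V μ)
    (h : Net Γ₀ rank E {.proc c w (.spawn k x M as ds Q)} Γ U L) :
    LocalStep fresh Γ₀ rank E {.proc c w (.spawn k x M as ds Q)}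
      {.proc c (w + μ) (.spawn k x V as ds Q)} Γ U L := by
  obtain ⟨ho, hb⟩ := h.inv_one
  cases ho with
  | proc hP hO he =>
    obtain ⟨q₀, hq, hP⟩ := hP.core
    -- The cost `μ` leaves the potential and enters the work counter, so the energy bound is
    -- unaffected.
    suffices ∃ q', q' + μ ≤ q₀ ∧
        PTy sg FCtx.empty (sharedFor Γ₀ c) U.toCtx q' (.spawn k x V as ds Q) (.ch c) _ by
      obtain ⟨q', hq', hP'⟩ := this
      exact .single (.proc hP' hO (by omega)) hb rfl (by simp [Obj.chan])
    generalize hΔ : U.toCtx = D at hP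
    cases hP with
    | spawnR h₁ h₂ h₃ h₄ h₅ h₆ h₇ =>
      obtain ⟨rfl, rfl⟩ := h₄.eq_empty
      obtain ⟨-, r, hr, h₆⟩ := hM.preservation hsg h₆
      exact ⟨_, by omega, .spawnR h₁ h₂ h₃ h₄ h₅ h₆ h₇⟩
    | spawnS h₁ h₂ h₃ h₈ h₉ h₁₀ h₄ h₅ h₆ h₇ =>
      obtain ⟨rfl, rfl⟩ := h₄.eq_empty
      obtain ⟨-, r, hr, h₆⟩ := hM.preservation hsg h₆
      exact ⟨_, by omega, .spawnS h₁ h₂ h₃ h₈ h₉ h₁₀ h₄ h₅ h₆ h₇⟩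
    | spawnC h₁ h₂ h₃ h₈ h₄ h₅ h₆ h₇ =>
      obtain ⟨rfl, rfl⟩ := h₄.eq_empty
      obtain ⟨-, r, hr, h₆⟩ := hM.preservation hsg h₆
      exact ⟨_, by omega, .spawnC h₁ h₂ h₃ h₈ h₄ h₅ h₆ h₇⟩

theorem Net.internal_send (hsg : sg.WF) {c w x M V μ P} (hM : Eval sg M V μ)
    (h : Net Γ₀ rank E {.proc c w (.sendV x M P)} Γ U L) :
    LocalStep fresh Γ₀ rank E {.proc c w (.sendV x M P)} {.proc c (w + μ) (.sendV x V P)}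
      Γ U L := by
  obtain ⟨ho, hb⟩ := h.inv_one
  cases ho with
  | @proc _ _ _ _ _ _ A _ _ hP hO he =>
    obtain ⟨q₀, hq, hP⟩ := hP.core
    suffices ∃ q', q' + μ ≤ q₀ ∧
        PTy sg FCtx.empty (sharedFor Γ₀ c) U.toCtx q' (.sendV x V P) (.ch c) A by
      obtain ⟨q', hq', hP'⟩ := this
      exact .single (.proc hP' hO (by omega)) hb rfl (by simp [Obj.chan])
    clear hO
    generalize hΔ : U.toCtx = D at hP
    cases hP with
    | timesR h₁ h₂ h₃ h₄ =>
      obtain ⟨rfl, rfl⟩ := h₂.eq_empty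
      obtain ⟨-, r, hr, h₃⟩ := hM.preservation hsg h₃
      exact ⟨_, by omega, .timesR h₁ h₂ h₃ h₄⟩
    | arrowL h₁ h₂ h₃ h₄ =>
      obtain ⟨rfl, rfl⟩ := h₂.eq_empty
      obtain ⟨-, r, hr, h₃⟩ := hM.preservation hsg h₃
      exact ⟨_, by omega, .arrowL h₁ h₂ h₃ h₄⟩

theorem Net.work {c w μ P} (h : Net Γ₀ rank E {.proc c w (.work μ P)} Γ U L) :
    LocalStep fresh Γ₀ rank E {.proc c w (.work μ P)} {.proc c (w + μ) P} Γ U L := by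
  obtain ⟨ho, hb⟩ := h.inv_one
  cases ho with
  | proc hP hO he =>
    obtain ⟨q₀, hq, hP⟩ := hP.core
    generalize hΔ : U.toCtx = D at hP
    cases hP with
    | work hi hP =>
      subst hΔ
      exact .single (.proc hP hO (by omega)) hb rfl (by simp [Obj.chan])

/-- Messages are typed without shared channels at a linear mode, so their invariant follows from
that of the sender once the linear context and the offer have been checked. -/
theorem Inv.closed {Γ Δ : Ctx sg} {z C} {Δ' : Ctx sg} {z' C'} (h : Inv Γ Δ z C)
    (hl : ∀ e ∈ Δ', e.1.mode ≠ .S ∧ Lang e.1.mode e.2) (ho : Lang z'.mode C')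
    (hS : z'.mode ≠ .S) (hz : z'.mode = .R → z.mode = .R)
    (hR : Purelin Δ → z'.mode = .R → Purelin Δ') : Inv 0 Δ' z' C' :=
  ⟨fun e he => (by cases he), hl, ho, fun h' => ⟨rfl, hR (h.modeR (hz h')).2 h'⟩,
    fun h => absurd h hS⟩

theorem Net.close_send {c w} (h : Net Γ₀ rank E {.proc c w (.close (.ch c))} Γ U L) :
    LocalStep fresh Γ₀ rank E {.proc c w (.close (.ch c))} {.msg c w (.close (.ch c))} Γ U L := by
  obtain ⟨ho, hb⟩ := h.inv_one
  cases ho with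
  | proc hP hO he =>
    obtain ⟨q₀, hq, hP⟩ := hP.core
    generalize hΔ : U.toCtx = D at hP
    cases hP with
    | oneR hi =>
      obtain rfl := CCtx.toCtx_eq_zero hΔ
      have hm : c.mode = .R ∨ c.mode = .C := hi.offer.one_mode
      have hcl : Inv (sg := sg) 0 0 (.ch c) .one :=
        hi.closed (by simp) hi.offer (by rcases hm with hm | hm <;> simp [Ref.mode, hm])
          (fun h => h) fun h _ => h
      cases hO with
      | R => exact .single (.msg (q := 0) (.one hcl) (by omega)) hb rfl (by simp [Obj.chan])
      | C => exact .single (.msg (q := 0) (.one hcl) (by omega)) hb rfl (by simp [Obj.chan])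
      -- The type `one` exists at modes `R` and `C` only, so no shared channel is lost by closing.
      | S => rcases hm with hm | hm <;> cases hm
      | L => rcases hm with hm | hm <;> cases hm


/-! ## Sending -/

/-- Ensures that a message sent to a purely linear provider uses purely linear channels only, as the
mode component of `Below` requires. -/
theorem Lang.lolli_mode {n m} {A B : SType sg} (h : Lang m (.lolli n A B)) (hm : m = .R) :
    n = .R := by
  obtain ⟨F, G, h⟩ := h.step
  generalize hA : SType.lolli n A B = X at h
  cases h with
  | lolli _ _ h => rw [(SType.lolli_inj hA).1]; exact h hm
  | _ => cases SType.match_of_eq hA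

/-- For messages from a provider: they use part of the sender's linear context and the continuation,
and offer the sender's old channel. -/
theorem Inv.msgR {Δ Δ₁ : CCtx sg} {Γ' : Ctx sg} {c c' A B} (h : Inv Γ' Δ.toCtx (.ch c) A)
    (hΔ : Δ₁ ≤ Δ) (hB : Lang c.mode B) (hc : Cont c c') :
    Inv 0 (CCtx.toCtx (Δ₁ + {(c', B)})) (.ch c) A := by
  have hsub : ∀ e ∈ Δ₁.toCtx, e ∈ Δ.toCtx :=
    fun e he => Multiset.mem_of_le (Multiset.map_le_map hΔ) he
  refine h.closed (fun e he => ?_) h.offer hc.mode_ne (fun h => h) fun hR hm e he => ?_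
  all_goals
    rw [CCtx.toCtx_add, CCtx.toCtx_singleton, Multiset.mem_add, Multiset.mem_singleton] at he
    rcases he with he | rfl
  · exact h.linear e (hsub e he)
  · exact ⟨hc.mode_eq.trans_ne hc.mode_ne, by simpa [Ref.mode, hc.mode_eq] using hB⟩
  · exact hR e (hsub e he)
  · exact hc.mode_eq.trans hm

/-- For messages from a client: the offered channel is now the continuation, whose mode may be more
restrictive than that of the client. Hence purity of `Δ₁` has to be assumed separately. -/
theorem Inv.msgL {Δ Δ₁ : CCtx sg} {Γ' : Ctx sg} {c c' d A B C} (h : Inv Γ' Δ.toCtx (.ch d) C)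
    (hΔ : Δ₁ + {(c, A)} ≤ Δ) (hB : Lang c.mode B) (hc : Cont c c')
    (hm : c.mode = .R → ∀ e ∈ Δ₁, e.1.mode = .R) :
    Inv 0 (CCtx.toCtx (Δ₁ + {(c, A)})) (.ch c') B := by
  have hsub : ∀ e ∈ CCtx.toCtx (Δ₁ + {(c, A)}), e ∈ Δ.toCtx :=
    fun e he => Multiset.mem_of_le (Multiset.map_le_map hΔ) he
  refine ⟨fun e he => (by cases he), fun e he => h.linear e (hsub e he),
    by simpa [Ref.mode, hc.mode_eq] using hB, fun hR => ⟨rfl, fun e he => ?_⟩,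
    fun hS => absurd (hc.mode_eq.symm.trans hS) hc.mode_ne⟩
  have hR : c.mode = .R := hc.mode_eq.symm.trans hR
  rw [CCtx.toCtx_add, CCtx.toCtx_singleton, Multiset.mem_add, Multiset.mem_singleton] at he
  rcases he with he | rfl
  · obtain ⟨x, hx, he⟩ := CCtx.mem_toCtx he
    rw [hx]
    exact hm hR _ he
  · exact hR

theorem Inv.msgL_single {Δ : CCtx sg} {Γ' : Ctx sg} {c c' d A B C}
    (h : Inv Γ' ((.ch c, A) ::ₘ Δ.toCtx) (.ch d) C) (hB : Lang c.mode B) (hc : Cont c c') :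
    Inv 0 (CCtx.toCtx {(c, A)}) (.ch c') B := by
  rw [← CCtx.toCtx_cons (c, A) Δ] at h
  simpa using h.msgL (Δ₁ := 0) (A := A) (by simp) hB hc (by simp)

theorem pair_eq_add {α : Type*} (a b : α) : ({a, b} : Multiset α) = {a} + {b} := by
  rw [Multiset.insert_eq_cons, Multiset.singleton_add]

theorem Net.ichoice_send {c c' w l P} (hf : fresh c') (hc : Cont c c')
    (ha : Ambient fresh Γ₀ {.proc c w (.sendL (.ch c) l P)} Γ U L)
    (h : Net Γ₀ rank E {.proc c w (.sendL (.ch c) l P)} Γ U L) :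
    LocalStep fresh Γ₀ rank E {.proc c w (.sendL (.ch c) l P)}
        {.proc c' w (P.ren (.ch c) (.ch c')),
         .msg c 0 (.sendL (.ch c) l (.fwd (.ch c) (.ch c')))} Γ U L := by
  obtain ⟨ho, hb⟩ := h.inv_one
  cases ho with
  | proc hP hO he =>
    obtain ⟨q₀, hq, hC⟩ := hP.core
    clear hP
    generalize hΔ : U.toCtx = D at hC
    cases hC with
    | ichoiceR hi hk hP =>
      subst hΔ
      exact .sendR (Δ₁ := 0) ha hO hb (zero_add _).symm hf hc hP (fun X hX => hX.ichoice hk)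
        (by
          have := MTy.ichoice (hi.msgR (Multiset.zero_le _) hP.inv.offer hc) hc hk
          simpa using this) (by omega)
    -- The same term could be typed as a client's send, but then the process would use the channel
    -- that it provides.
    | echoiceL =>
      obtain ⟨x, Δ', hx, hU, -⟩ := CCtx.toCtx_eq_cons hΔ
      cases hx
      exact (notMem_of_below hb hU).elim

theorem Net.echoice_send {c c' d w l P} (hd : d ≠ c) (hf : fresh c') (hc : Cont c c')
    (ha : Ambient fresh Γ₀ {.proc d w (.sendL (.ch c) l P)} Γ U L)
    (h : Net Γ₀ rank E {.proc d w (.sendL (.ch c) l P)} Γ U L) :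
    LocalStep fresh Γ₀ rank E {.proc d w (.sendL (.ch c) l P)}
        {.msg c' 0 (.sendL (.ch c) l (.fwd (.ch c') (.ch c))),
         .proc d w (P.ren (.ch c) (.ch c'))} Γ U L := by
  obtain ⟨ho, hb⟩ := h.inv_one
  cases ho with
  | proc hP hO he =>
    obtain ⟨q₀, hq, hC⟩ := hP.core
    clear hP
    generalize hΔ : U.toCtx = D at hC
    cases hC with
    | ichoiceR => exact absurd rfl hd
    | @echoiceL _ _ _ _ _ _ K B _ _ hi hk hP =>
      obtain ⟨x, Δ', hx, rfl, rfl⟩ := CCtx.toCtx_eq_cons hΔ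
      cases hx
      refine .sendL (Δ₁ := 0) (Δ₂ := Δ') (r := 0) (A := .echoice K B) ha hO hb (by simp) hf hc
        (by simpa using hP) ?_ (by simp) (by omega)
      simpa using MTy.echoice (hi.msgL_single
        (hP.inv.linear _ (Multiset.mem_cons_self _ _)).2 hc) hc hk

theorem Net.tensor_send {c c' e w P} (hf : fresh c') (hc : Cont c c')
    (ha : Ambient fresh Γ₀ {.proc c w (.sendC (.ch c) (.ch e) P)} Γ U L)
    (h : Net Γ₀ rank E {.proc c w (.sendC (.ch c) (.ch e) P)} Γ U L) :
    LocalStep fresh Γ₀ rank E {.proc c w (.sendC (.ch c) (.ch e) P)}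
        {.proc c' w (P.ren (.ch c) (.ch c')),
         .msg c 0 (.sendC (.ch c) (.ch e) (.fwd (.ch c) (.ch c')))} Γ U L := by
  obtain ⟨ho, hb⟩ := h.inv_one
  cases ho with
  | proc hP hO he =>
    obtain ⟨q₀, hq, hC⟩ := hP.core
    clear hP
    generalize hΔ : U.toCtx = D at hC
    cases hC with
    | tensorR hi hn hP =>
      obtain ⟨x, Δ', hx, rfl, rfl⟩ := CCtx.toCtx_eq_cons hΔ
      cases hx
      refine .sendR (Δ₁ := {(e, _)}) (r := 0) ha hO hb (Multiset.singleton_add _ _).symm hf hc hP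
        (fun X hX => hX.tensor) ?_ (by omega)
      rw [← pair_eq_add]
      refine .tensor ?_ hc hn
      rw [pair_eq_add]
      exact Inv.msgR (Δ := (e, _) ::ₘ Δ') (by simpa using hi) (by simp) hP.inv.offer hc
    | lolliL =>
      obtain ⟨x, Δ', -, hU, hΔ⟩ := CCtx.toCtx_eq_cons hΔ
      obtain ⟨x, Δ', hx, rfl, -⟩ := CCtx.toCtx_eq_cons hΔ.symm
      cases hx
      rw [Multiset.cons_swap] at hU
      exact (notMem_of_below hb hU).elim

theorem Net.lolli_send {c c' d e w P} (hd : d ≠ c) (hf : fresh c') (hc : Cont c c')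
    (ha : Ambient fresh Γ₀ {.proc d w (.sendC (.ch c) (.ch e) P)} Γ U L)
    (h : Net Γ₀ rank E {.proc d w (.sendC (.ch c) (.ch e) P)} Γ U L) :
    LocalStep fresh Γ₀ rank E {.proc d w (.sendC (.ch c) (.ch e) P)}
        {.msg c' 0 (.sendC (.ch c) (.ch e) (.fwd (.ch c') (.ch c))),
         .proc d w (P.ren (.ch c) (.ch c'))} Γ U L := by
  obtain ⟨ho, hb⟩ := h.inv_one
  cases ho with
  | proc hP hO he =>
    obtain ⟨q₀, hq, hC⟩ := hP.core
    clear hP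
    generalize hΔ : U.toCtx = D at hC
    cases hC with
    | tensorR => exact absurd rfl hd
    | @lolliL _ _ _ _ _ _ n A B _ _ hi hn hP =>
      obtain ⟨x, Δ', hx, rfl, hΔ'⟩ := CCtx.toCtx_eq_cons hΔ
      obtain ⟨y, Δ', hy, rfl, rfl⟩ := CCtx.toCtx_eq_cons hΔ'.symm
      cases hx
      cases hy
      have hm : c.mode = .R → ∀ x ∈ ({(e, A)} : CCtx sg), x.1.mode = .R := by
        intro hR x hx
        obtain rfl := Multiset.mem_singleton.1 hx
        have := (hi.linear (.ch c, .lolli n A B) (by simp)).2.lolli_mode hR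
        exact hn.trans this
      refine .sendL (Δ₁ := {(e, A)}) (Δ₂ := Δ') (r := 0) (A := .lolli n A B) ha hO hb
        (by simp only [← Multiset.singleton_add]; abel) hf hc (by simpa using hP) ?_ hm (by omega)
      rw [← pair_eq_add]
      refine .lolli ?_ hc hn
      rw [pair_eq_add]
      exact Inv.msgL (Δ := (e, A) ::ₘ (c, .lolli n A B) ::ₘ Δ') (by simpa using hi)
        (by simp) (hP.inv.linear (.ch c, B) (by simp)).2 hc hm

theorem Net.times_send {c c' w N P} (hf : fresh c') (hc : Cont c c') (hN : IsVal N)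
    (ha : Ambient fresh Γ₀ {.proc c w (.sendV (.ch c) N P)} Γ U L)
    (h : Net Γ₀ rank E {.proc c w (.sendV (.ch c) N P)} Γ U L) :
    LocalStep fresh Γ₀ rank E {.proc c w (.sendV (.ch c) N P)}
        {.proc c' w (P.ren (.ch c) (.ch c')),
         .msg c 0 (.sendV (.ch c) N (.fwd (.ch c) (.ch c')))} Γ U L := by
  obtain ⟨ho, hb⟩ := h.inv_one
  cases ho with
  | proc hP hO he =>
    obtain ⟨q₀, hq, hC⟩ := hP.core
    clear hP
    generalize hΔ : U.toCtx = D at hC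
    cases hC with
    | timesR hi hs hM hP =>
      obtain ⟨rfl, rfl⟩ := hs.eq_empty
      subst hΔ
      refine .sendR (Δ₁ := 0) ha hO hb (zero_add _).symm hf hc hP (fun X hX => hX.times)
        (by
          have := MTy.times (hi.msgR (Multiset.zero_le _) hP.inv.offer hc) hc hN hM
          simpa using this) (by omega)
    | arrowL =>
      obtain ⟨x, Δ', hx, hU, -⟩ := CCtx.toCtx_eq_cons hΔ
      cases hx
      exact (notMem_of_below hb hU).elim

theorem Net.arrow_send {c c' d w N P} (hd : d ≠ c) (hf : fresh c') (hc : Cont c c')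
    (hN : IsVal N) (ha : Ambient fresh Γ₀ {.proc d w (.sendV (.ch c) N P)} Γ U L)
    (h : Net Γ₀ rank E {.proc d w (.sendV (.ch c) N P)} Γ U L) :
    LocalStep fresh Γ₀ rank E {.proc d w (.sendV (.ch c) N P)}
        {.msg c' 0 (.sendV (.ch c) N (.fwd (.ch c') (.ch c))),
         .proc d w (P.ren (.ch c) (.ch c'))} Γ U L := by
  obtain ⟨ho, hb⟩ := h.inv_one
  cases ho with
  | proc hP hO he =>
    obtain ⟨q₀, hq, hC⟩ := hP.core
    clear hP
    generalize hΔ : U.toCtx = D at hC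
    cases hC with
    | timesR => exact absurd rfl hd
    | @arrowL _ _ _ _ p _ _ _ _ τ A _ _ hi hs hM hP =>
      obtain ⟨rfl, rfl⟩ := hs.eq_empty
      obtain ⟨x, Δ', hx, rfl, rfl⟩ := CCtx.toCtx_eq_cons hΔ
      cases hx
      -- The potential `p` stored in the value travels with the message.
      refine .sendL (Δ₁ := 0) (Δ₂ := Δ') (r := p) (A := .arrow τ A) ha hO hb (by simp) hf hc
        (by simpa using hP) ?_ (by simp) (by omega)
      simpa using MTy.arrow (hi.msgL_single
        (hP.inv.linear _ (Multiset.mem_cons_self _ _)).2 hc) hc hN hM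

theorem Net.pay_send {c c' w r P} (hf : fresh c') (hc : Cont c c')
    (ha : Ambient fresh Γ₀ {.proc c w (.pay (.ch c) r P)} Γ U L)
    (h : Net Γ₀ rank E {.proc c w (.pay (.ch c) r P)} Γ U L) :
    LocalStep fresh Γ₀ rank E {.proc c w (.pay (.ch c) r P)}
        {.proc c' w (P.ren (.ch c) (.ch c')),
         .msg c 0 (.pay (.ch c) r (.fwd (.ch c) (.ch c')))} Γ U L := by
  obtain ⟨ho, hb⟩ := h.inv_one
  cases ho with
  | proc hP hO he =>
    obtain ⟨q₀, hq, hC⟩ := hP.core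
    clear hP
    generalize hΔ : U.toCtx = D at hC
    cases hC with
    | payR hi hP =>
      subst hΔ
      refine .sendR (Δ₁ := 0) ha hO hb (zero_add _).symm hf hc hP (fun X hX => hX.pay)
        (by
          have := MTy.pay (hi.msgR (Multiset.zero_le _) hP.inv.offer hc) hc
          simpa using this) (by omega)
    | getL =>
      obtain ⟨x, Δ', hx, hU, -⟩ := CCtx.toCtx_eq_cons hΔ
      cases hx
      exact (notMem_of_below hb hU).elim

theorem Net.get_send {c c' d w r P} (hd : d ≠ c) (hf : fresh c') (hc : Cont c c')
    (ha : Ambient fresh Γ₀ {.proc d w (.pay (.ch c) r P)} Γ U L)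
    (h : Net Γ₀ rank E {.proc d w (.pay (.ch c) r P)} Γ U L) :
    LocalStep fresh Γ₀ rank E {.proc d w (.pay (.ch c) r P)}
        {.msg c' 0 (.pay (.ch c) r (.fwd (.ch c') (.ch c))),
         .proc d w (P.ren (.ch c) (.ch c'))} Γ U L := by
  obtain ⟨ho, hb⟩ := h.inv_one
  cases ho with
  | proc hP hO he =>
    obtain ⟨q₀, hq, hC⟩ := hP.core
    clear hP
    generalize hΔ : U.toCtx = D at hC
    cases hC with
    | payR => exact absurd rfl hd
    | @getL _ _ _ _ _ _ A _ _ hi hP =>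
      obtain ⟨x, Δ', hx, rfl, rfl⟩ := CCtx.toCtx_eq_cons hΔ
      cases hx
      refine .sendL (Δ₁ := 0) (Δ₂ := Δ') (r := r) (A := .get r A) ha hO hb (by simp) hf hc
        (by simpa using hP) ?_ (by simp) (by omega)
      simpa using MTy.get (hi.msgL_single
        (hP.inv.linear _ (Multiset.mem_cons_self _ _)).2 hc) hc


/-! ## Receiving -/

/-- Sender and receiver have been typed independently; uniqueness of linear channels makes them
agree on the type of the channel between them. -/
theorem Ambient.agree_msg {Ω : Config} {L Δ Δ₀ : CCtx sg} {c A A'}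
    (h : Ambient fresh Γ₀ Ω Γ (Δ + (c, A) ::ₘ Δ₀) ({(c, A')} + L)) : A = A' :=
  h.agree (c := c) (by simp) (by simp)

theorem Ambient.agree_offer {Ω : Config} {L' Δ Δ₀ : CCtx sg} {c A A' S}
    (h : Ambient fresh Γ₀ Ω Γ (Δ + (Δ₀ + {(c, A)})) (L + L')) (hO : Offer Γ₀ c A' S L)
    (hc : c.mode ≠ .S) : A = A' := by
  obtain rfl := hO.linear hc
  exact h.agree (c := c) (by simp) (by simp)

theorem Net.ichoice_recv {c c' d l K Q w w'} (hd : d ≠ c) (hl : l ∈ K)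
    (ha : Ambient fresh Γ₀ {.msg c w (.sendL (.ch c) l (.fwd (.ch c) (.ch c'))),
      .proc d w' (.case (.ch c) K Q)} Γ U L)
    (h : Net Γ₀ rank E {.msg c w (.sendL (.ch c) l (.fwd (.ch c) (.ch c'))),
      .proc d w' (.case (.ch c) K Q)} Γ U L) :
    LocalStep fresh Γ₀ rank E {.msg c w (.sendL (.ch c) l (.fwd (.ch c) (.ch c'))),
      .proc d w' (.case (.ch c) K Q)}
      {.proc d (w + w') ((Q l).ren (.ch c) (.ch c'))} Γ U L := by
  obtain ⟨Δ₁, e₁, S₁, O₁, Δ₂, e₂, S₂, O₂, ho₁, hb₁, ho₂, hb₂, rfl, rfl, rfl, rfl⟩ := h.inv_two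
  cases ho₁ with
  | msg hM he₁ =>
  cases ho₂ with
  | proc hP hO he₂ =>
    obtain ⟨q₁, hq₁, hM⟩ := hM.core
    obtain ⟨q₂, hq₂, hC⟩ := hP.core
    clear hP
    generalize hΔ : Δ₂.toCtx = D at hC
    cases hC with
    | echoiceR => exact absurd rfl hd
    | ichoiceL hi hQ =>
      obtain ⟨x, Δ₂, hx, rfl, rfl⟩ := CCtx.toCtx_eq_cons hΔ
      cases hx
      cases hM with
      -- A message in the opposite direction has this shape only if channel and continuation
      -- coincide, and then it would use the channel that it provides.
      | echoice => exact (Below.irrefl (hb₁ _ (Multiset.mem_singleton_self _))).elim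
      | ichoice hi' hc hk =>
        have hA := ha.agree_msg
        obtain ⟨rfl, hB⟩ := SType.ichoice_inj hA
        have hP' := hQ l hl
        rw [hB l hl, ← CCtx.toCtx_cons (c, _) Δ₂] at hP'
        rw [hA] at hb₂ ha ⊢
        refine .receiveL (q := q₂) hO hb₁ hb₂ ?_ (by omega)
        simpa using hP'.continue hc hd ha.notMem_used

theorem Net.tensor_recv {c c' d e y n Q w w'} (hd : d ≠ c)
    (ha : Ambient fresh Γ₀ {.msg c w (.sendC (.ch c) (.ch e) (.fwd (.ch c) (.ch c'))),
      .proc d w' (.recvC (.ch c) y n Q)} Γ U L)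
    (h : Net Γ₀ rank E {.msg c w (.sendC (.ch c) (.ch e) (.fwd (.ch c) (.ch c'))),
      .proc d w' (.recvC (.ch c) y n Q)} Γ U L) :
    LocalStep fresh Γ₀ rank E {.msg c w (.sendC (.ch c) (.ch e) (.fwd (.ch c) (.ch c'))),
      .proc d w' (.recvC (.ch c) y n Q)}
      {.proc d (w + w') ((Q.ren (.var y n) (.ch e)).ren (.ch c) (.ch c'))} Γ U L := by
  obtain ⟨Δ₁, e₁, S₁, O₁, Δ₂, e₂, S₂, O₂, ho₁, hb₁, ho₂, hb₂, rfl, rfl, rfl, rfl⟩ := h.inv_two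
  cases ho₁ with
  | msg hM he₁ =>
  cases ho₂ with
  | proc hP hO he₂ =>
    obtain ⟨q₁, hq₁, hM⟩ := hM.core
    obtain ⟨q₂, hq₂, hC⟩ := hP.core
    clear hP
    generalize hΔ : Δ₂.toCtx = D at hC
    cases hC with
    | lolliR => exact absurd rfl hd
    | tensorL hi hn hQ =>
      obtain ⟨x, Δ₂, hx, rfl, rfl⟩ := CCtx.toCtx_eq_cons hΔ
      cases hx
      cases hM with
      | lolli =>
        exact (Below.irrefl (hb₁ _ (Multiset.mem_cons_of_mem (Multiset.mem_singleton_self _)))).elim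
      | tensor hi' hc hn' =>
        obtain ⟨rfl, rfl, rfl⟩ := SType.tensor_inj ha.agree_msg
        rw [← CCtx.toCtx_cons (c, _) Δ₂] at hQ
        have hQ' := hQ.receive_chan hn'
        rw [Multiset.cons_swap] at hQ'
        have := hQ'.continue hc hd fun x hx => ?_
        · refine .receiveL (q := q₂) hO hb₁ hb₂ ?_ (by omega)
          simpa [Multiset.cons_swap] using this
        -- The received channel is not `c`, since the message uses the former and provides the
        -- latter.
        · rcases Multiset.mem_cons.1 hx with rfl | hx
          · rintro rfl
            exact Below.irrefl (hb₁ _ (by simp))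
          · exact ha.notMem_used x hx

theorem Net.times_recv {c c' d N y Q w w'} (hd : d ≠ c)
    (ha : Ambient fresh Γ₀ {.msg c w (.sendV (.ch c) N (.fwd (.ch c) (.ch c'))),
      .proc d w' (.recvV (.ch c) y Q)} Γ U L)
    (h : Net Γ₀ rank E {.msg c w (.sendV (.ch c) N (.fwd (.ch c) (.ch c'))),
      .proc d w' (.recvV (.ch c) y Q)} Γ U L) :
    LocalStep fresh Γ₀ rank E {.msg c w (.sendV (.ch c) N (.fwd (.ch c) (.ch c'))),
      .proc d w' (.recvV (.ch c) y Q)}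
      {.proc d (w + w') ((Q.vsub y N).ren (.ch c) (.ch c'))} Γ U L := by
  obtain ⟨Δ₁, e₁, S₁, O₁, Δ₂, e₂, S₂, O₂, ho₁, hb₁, ho₂, hb₂, rfl, rfl, rfl, rfl⟩ := h.inv_two
  cases ho₁ with
  | msg hM he₁ =>
  cases ho₂ with
  | proc hP hO he₂ =>
    obtain ⟨q₁, hq₁, hM⟩ := hM.core
    obtain ⟨q₂, hq₂, hC⟩ := hP.core
    clear hP
    generalize hΔ : Δ₂.toCtx = D at hC
    cases hC with
    | arrowR => exact absurd rfl hd
    | timesL hi hQ =>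
      obtain ⟨x, Δ₂, hx, rfl, rfl⟩ := CCtx.toCtx_eq_cons hΔ
      cases hx
      cases hM with
      | arrow => exact (Below.irrefl (hb₁ _ (Multiset.mem_singleton_self _))).elim
      | times hi' hc hN hT =>
        obtain ⟨rfl, rfl⟩ := SType.times_inj ha.agree_msg
        rw [← CCtx.toCtx_cons (c, _) Δ₂] at hQ
        have hQ' := hQ.vsub_empty hN hT
        -- The receiver gains the potential of the value, which the message has carried.
        exact .receiveL (q := q₂ + q₁) hO hb₁ hb₂
          (by simpa using hQ'.continue hc hd ha.notMem_used) (by omega)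

theorem Net.pay_recv {c c' d r Q w w'} (hd : d ≠ c)
    (ha : Ambient fresh Γ₀ {.msg c w (.pay (.ch c) r (.fwd (.ch c) (.ch c'))),
      .proc d w' (.get (.ch c) r Q)} Γ U L)
    (h : Net Γ₀ rank E {.msg c w (.pay (.ch c) r (.fwd (.ch c) (.ch c'))),
      .proc d w' (.get (.ch c) r Q)} Γ U L) :
    LocalStep fresh Γ₀ rank E {.msg c w (.pay (.ch c) r (.fwd (.ch c) (.ch c'))),
      .proc d w' (.get (.ch c) r Q)}
      {.proc d (w + w') (Q.ren (.ch c) (.ch c'))} Γ U L := by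
  obtain ⟨Δ₁, e₁, S₁, O₁, Δ₂, e₂, S₂, O₂, ho₁, hb₁, ho₂, hb₂, rfl, rfl, rfl, rfl⟩ := h.inv_two
  cases ho₁ with
  | msg hM he₁ =>
  cases ho₂ with
  | proc hP hO he₂ =>
    obtain ⟨q₁, hq₁, hM⟩ := hM.core
    obtain ⟨q₂, hq₂, hC⟩ := hP.core
    clear hP
    generalize hΔ : Δ₂.toCtx = D at hC
    cases hC with
    | getR => exact absurd rfl hd
    | payL hi hQ =>
      obtain ⟨x, Δ₂, hx, rfl, rfl⟩ := CCtx.toCtx_eq_cons hΔ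
      cases hx
      cases hM with
      | get => exact (Below.irrefl (hb₁ _ (Multiset.mem_singleton_self _))).elim
      | pay hi' hc =>
        obtain ⟨-, rfl⟩ := SType.pay_inj ha.agree_msg
        rw [← CCtx.toCtx_cons (c, _) Δ₂] at hQ
        exact .receiveL (q := q₂ + r) hO hb₁ hb₂
          (by simpa using hQ.continue hc hd ha.notMem_used) (by omega)

theorem Net.close_recv {c d Q w w'}
    (ha : Ambient fresh Γ₀ {.msg c w (.close (.ch c)), .proc d w' (.wait (.ch c) Q)} Γ U L)
    (h : Net Γ₀ rank E {.msg c w (.close (.ch c)), .proc d w' (.wait (.ch c) Q)} Γ U L) :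
    LocalStep fresh Γ₀ rank E {.msg c w (.close (.ch c)), .proc d w' (.wait (.ch c) Q)}
      {.proc d (w + w') Q} Γ U L := by
  obtain ⟨Δ₁, e₁, S₁, O₁, Δ₂, e₂, S₂, O₂, ho₁, hb₁, ho₂, hb₂, rfl, rfl, rfl, rfl⟩ := h.inv_two
  cases ho₁ with
  | msg hM he₁ =>
  cases ho₂ with
  | proc hP hO he₂ =>
    obtain ⟨q₁, hq₁, hM⟩ := hM.core
    obtain ⟨q₂, hq₂, hC⟩ := hP.core
    clear hP
    generalize hΔ : Δ₂.toCtx = D at hC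
    cases hC with
    | oneL hi hQ =>
      obtain ⟨x, Δ₂, hx, rfl, rfl⟩ := CCtx.toCtx_eq_cons hΔ
      cases hx
      cases hM with
      | one =>
        exact .receiveL (q := q₂) hO hb₁ hb₂ (by simpa using hQ) (by omega)

theorem Net.echoice_recv {c c' l K Q w w'} (hl : l ∈ K)
    (ha : Ambient fresh Γ₀ {.proc c w' (.case (.ch c) K Q),
      .msg c' w (.sendL (.ch c) l (.fwd (.ch c') (.ch c)))} Γ U L)
    (h : Net Γ₀ rank E {.proc c w' (.case (.ch c) K Q),
      .msg c' w (.sendL (.ch c) l (.fwd (.ch c') (.ch c)))} Γ U L) :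
    LocalStep fresh Γ₀ rank E {.proc c w' (.case (.ch c) K Q),
      .msg c' w (.sendL (.ch c) l (.fwd (.ch c') (.ch c)))}
      {.proc c' (w + w') ((Q l).ren (.ch c) (.ch c'))} Γ U L := by
  have hcc : c ≠ c' := by simpa [Obj.chan] using ha.chans
  obtain ⟨Δ₂, e₂, S₂, O₂, Δ₁, e₁, S₁, O₁, ho₂, hb₂, ho₁, hb₁, rfl, rfl, rfl, rfl⟩ := h.inv_two
  cases ho₁ with
  | msg hM he₁ =>
  cases ho₂ with
  | proc hP hO he₂ =>
    obtain ⟨q₁, hq₁, hM⟩ := hM.core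
    obtain ⟨q₂, hq₂, hC⟩ := hP.core
    clear hP
    generalize hΔ : Δ₂.toCtx = D at hC
    cases hC with
    | ichoiceL =>
      obtain ⟨x, Δ', hx, hU, -⟩ := CCtx.toCtx_eq_cons hΔ
      cases hx
      exact (notMem_of_below hb₂ hU).elim
    | echoiceR hi hQ =>
      subst hΔ
      cases hM with
      | ichoice => exact absurd rfl hcc
      | echoice hi' hc hk =>
        rw [← zero_add {(c, _)}] at ha hb₁ ⊢
        have hA := ha.agree_offer hO hc.mode_ne
        obtain ⟨rfl, hB⟩ := SType.echoice_inj hA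
        refine .receiveR (hA ▸ hO) hb₁ hb₂ hc (by simp) (q := q₂) ?_
          (fun X hX => hX.echoice hl) (by omega)
        rw [hB l hl, zero_add]
        exact hQ l hl

theorem Net.lolli_recv {c c' e y n Q w w'}
    (ha : Ambient fresh Γ₀ {.proc c w' (.recvC (.ch c) y n Q),
      .msg c' w (.sendC (.ch c) (.ch e) (.fwd (.ch c') (.ch c)))} Γ U L)
    (h : Net Γ₀ rank E {.proc c w' (.recvC (.ch c) y n Q),
      .msg c' w (.sendC (.ch c) (.ch e) (.fwd (.ch c') (.ch c)))} Γ U L) :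
    LocalStep fresh Γ₀ rank E {.proc c w' (.recvC (.ch c) y n Q),
      .msg c' w (.sendC (.ch c) (.ch e) (.fwd (.ch c') (.ch c)))}
      {.proc c' (w + w') ((Q.ren (.var y n) (.ch e)).ren (.ch c) (.ch c'))} Γ U L := by
  have hcc : c ≠ c' := by simpa [Obj.chan] using ha.chans
  obtain ⟨Δ₂, e₂, S₂, O₂, Δ₁, e₁, S₁, O₁, ho₂, hb₂, ho₁, hb₁, rfl, rfl, rfl, rfl⟩ := h.inv_two
  cases ho₁ with
  | msg hM he₁ =>
  cases ho₂ with
  | proc hP hO he₂ =>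
    obtain ⟨q₁, hq₁, hM⟩ := hM.core
    obtain ⟨q₂, hq₂, hC⟩ := hP.core
    clear hP
    generalize hΔ : Δ₂.toCtx = D at hC
    cases hC with
    | tensorL =>
      obtain ⟨x, Δ', hx, hU, -⟩ := CCtx.toCtx_eq_cons hΔ
      cases hx
      exact (notMem_of_below hb₂ hU).elim
    | lolliR hi hn hQ =>
      subst hΔ
      cases hM with
      | tensor => exact absurd rfl hcc
      | lolli hi' hc hn' =>
        rw [pair_eq_add (e, _)] at ha hb₁ ⊢
        obtain ⟨rfl, rfl, rfl⟩ := SType.lolli_inj (ha.agree_offer hO hc.mode_ne)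
        refine .receiveR hO hb₁ hb₂ hc ?_ (by simpa using hQ.receive_chan hn')
          (fun X hX => hX.lolli) (by omega)
        -- The message uses both the channel sent and `c`; they differ because no linear channel is
        -- used twice.
        rintro x hx rfl
        have := ha.used
        obtain rfl := Multiset.mem_singleton.1 hx
        rw [Multiset.map_add, Multiset.map_add, Multiset.nodup_add] at this
        simpa using this.2.1

theorem Net.arrow_recv {c c' N y Q w w'}
    (ha : Ambient fresh Γ₀ {.proc c w' (.recvV (.ch c) y Q),
      .msg c' w (.sendV (.ch c) N (.fwd (.ch c') (.ch c)))} Γ U L)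
    (h : Net Γ₀ rank E {.proc c w' (.recvV (.ch c) y Q),
      .msg c' w (.sendV (.ch c) N (.fwd (.ch c') (.ch c)))} Γ U L) :
    LocalStep fresh Γ₀ rank E {.proc c w' (.recvV (.ch c) y Q),
      .msg c' w (.sendV (.ch c) N (.fwd (.ch c') (.ch c)))}
      {.proc c' (w + w') ((Q.vsub y N).ren (.ch c) (.ch c'))} Γ U L := by
  have hcc : c ≠ c' := by simpa [Obj.chan] using ha.chans
  obtain ⟨Δ₂, e₂, S₂, O₂, Δ₁, e₁, S₁, O₁, ho₂, hb₂, ho₁, hb₁, rfl, rfl, rfl, rfl⟩ := h.inv_two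
  cases ho₁ with
  | msg hM he₁ =>
  cases ho₂ with
  | proc hP hO he₂ =>
    obtain ⟨q₁, hq₁, hM⟩ := hM.core
    obtain ⟨q₂, hq₂, hC⟩ := hP.core
    clear hP
    generalize hΔ : Δ₂.toCtx = D at hC
    cases hC with
    | timesL =>
      obtain ⟨x, Δ', hx, hU, -⟩ := CCtx.toCtx_eq_cons hΔ
      cases hx
      exact (notMem_of_below hb₂ hU).elim
    | arrowR hi hQ =>
      subst hΔ
      cases hM with
      | times => exact absurd rfl hcc
      | arrow hi' hc hN hT =>
        rw [← zero_add {(c, _)}] at ha hb₁ ⊢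
        obtain ⟨rfl, rfl⟩ := SType.arrow_inj (ha.agree_offer hO hc.mode_ne)
        exact .receiveR hO hb₁ hb₂ hc (by simp) (by simpa using hQ.vsub_empty hN hT)
          (fun X hX => hX.arrow) (by omega)

theorem Net.get_recv {c c' r Q w w'}
    (ha : Ambient fresh Γ₀ {.proc c w' (.get (.ch c) r Q),
      .msg c' w (.pay (.ch c) r (.fwd (.ch c') (.ch c)))} Γ U L)
    (h : Net Γ₀ rank E {.proc c w' (.get (.ch c) r Q),
      .msg c' w (.pay (.ch c) r (.fwd (.ch c') (.ch c)))} Γ U L) :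
    LocalStep fresh Γ₀ rank E {.proc c w' (.get (.ch c) r Q),
      .msg c' w (.pay (.ch c) r (.fwd (.ch c') (.ch c)))}
      {.proc c' (w + w') (Q.ren (.ch c) (.ch c'))} Γ U L := by
  have hcc : c ≠ c' := by simpa [Obj.chan] using ha.chans
  obtain ⟨Δ₂, e₂, S₂, O₂, Δ₁, e₁, S₁, O₁, ho₂, hb₂, ho₁, hb₁, rfl, rfl, rfl, rfl⟩ := h.inv_two
  cases ho₁ with
  | msg hM he₁ =>
  cases ho₂ with
  | proc hP hO he₂ =>
    obtain ⟨q₁, hq₁, hM⟩ := hM.core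
    obtain ⟨q₂, hq₂, hC⟩ := hP.core
    clear hP
    generalize hΔ : Δ₂.toCtx = D at hC
    cases hC with
    | payL =>
      obtain ⟨x, Δ', hx, hU, -⟩ := CCtx.toCtx_eq_cons hΔ
      cases hx
      exact (notMem_of_below hb₂ hU).elim
    | getR hi hQ =>
      subst hΔ
      cases hM with
      | pay => exact absurd rfl hcc
      | get hi' hc =>
        rw [← zero_add {(c, _)}] at ha hb₁ ⊢
        obtain ⟨-, rfl⟩ := SType.get_inj (ha.agree_offer hO hc.mode_ne)
        exact .receiveR hO hb₁ hb₂ hc (by simp) (by simpa using hQ)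
          (fun X hX => hX.get) (by omega)


/-! ## Forwarding -/

theorem Offer.of_mode {c A} {S L : CCtx sg} (h : Offer Γ₀ c A S L)
    (hc : c.mode = .R ∨ c.mode = .C) :
    S = 0 ∧ L = {(c, A)} := by
  cases h <;> simp_all [Chan.mode]

theorem Offer.mk_of_mode {c} {A : SType sg} (hc : c.mode = .R ∨ c.mode = .C) :
    Offer Γ₀ c A 0 {(c, A)} := by
  cases c with
  | R => exact .R
  | C => exact .C
  | S | L => simp [Chan.mode] at hc

theorem CCtx.map_update {Δ : CCtx sg} {c d : Chan} (h : ∀ e ∈ Δ, e.1 ≠ c) :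
    Δ.map (fun e => (Function.update id c d e.1, e.2)) = Δ := by
  conv_rhs => rw [← Multiset.map_id Δ]
  exact Multiset.map_congr rfl fun e he => by simp [h e he]

/-- Forwarding is typed at modes `R` and `C` only, where the provider offers nothing shared and
continuations are constrained by mode alone. So the message can be renamed to provide `c`, and its
dependencies remain below `c` by transitivity through `d`. -/
theorem Net.fwd_msg {c d w w' M}
    (ha : Ambient fresh Γ₀ {.msg d w' M, .proc c w (.fwd (.ch c) (.ch d))} Γ U L)
    (h : Net Γ₀ rank E {.msg d w' M, .proc c w (.fwd (.ch c) (.ch d))} Γ U L) :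
    LocalStep fresh Γ₀ rank E {.msg d w' M, .proc c w (.fwd (.ch c) (.ch d))}
      {.msg c (w + w') (M.ren (.ch d) (.ch c))} Γ U L := by
  obtain ⟨Δ₁, e₁, S₁, O₁, Δ₂, e₂, S₂, O₂, ho₁, hb₁, ho₂, hb₂, rfl, rfl, rfl, rfl⟩ := h.inv_two
  cases ho₁ with
  | msg hM he₁ =>
  cases ho₂ with
  | proc hP hO he₂ =>
    obtain ⟨q₂, hq₂, hC⟩ := hP.core
    clear hP
    generalize hΔ : Δ₂.toCtx = D at hC
    cases hC with
    | fwd hi hm hm' =>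
      rw [← Multiset.cons_zero] at hΔ
      obtain ⟨x, Δ₂, hx, rfl, hΔ'⟩ := CCtx.toCtx_eq_cons hΔ
      cases hx
      obtain rfl := CCtx.toCtx_eq_zero hΔ'.symm
      obtain rfl := ha.agree_msg
      obtain ⟨rfl, rfl⟩ := hO.of_mode hm
      have hM' := hM.ren (d := d) (d' := c) hm'.symm (by rwa [← hm'] at hm)
      rw [CCtx.map_update, Function.update_self] at hM'
      swap
      · rintro e he rfl
        exact Below.irrefl (hb₁ e he)
      refine .single (.msg hM' (by omega))
        (fun e he => (hb₁ e he).trans (hb₂ (d, _) (Multiset.mem_cons_self _ _))) ?_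
        (by simp [Obj.chan])
      rw [Multiset.cons_zero]
      abel

theorem Net.msg_fwd {c d e w w' M} (hec : e ≠ c) (hM : M.Occ c)
    (ha : Ambient fresh Γ₀ {.proc c w (.fwd (.ch c) (.ch d)), .msg e w' M} Γ U L)
    (h : Net Γ₀ rank E {.proc c w (.fwd (.ch c) (.ch d)), .msg e w' M} Γ U L) :
    LocalStep fresh Γ₀ rank E {.proc c w (.fwd (.ch c) (.ch d)), .msg e w' M}
      {.msg e (w + w') (M.ren (.ch c) (.ch d))} Γ U L := by
  obtain ⟨Δ₁, e₁, S₁, O₁, Δ₂, e₂, S₂, O₂, ho₁, hb₁, ho₂, hb₂, rfl, rfl, rfl, rfl⟩ := h.inv_two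
  cases ho₂ with
  | msg hT he₂ =>
  cases ho₁ with
  | proc hP hO he₁ =>
    obtain ⟨q₁, hq₁, hC⟩ := hP.core
    clear hP
    generalize hΔ : Δ₁.toCtx = D at hC
    cases hC with
    | fwd hi hm hm' =>
      rw [← Multiset.cons_zero] at hΔ
      obtain ⟨x, Δ₁, hx, rfl, hΔ'⟩ := CCtx.toCtx_eq_cons hΔ
      cases hx
      obtain rfl := CCtx.toCtx_eq_zero hΔ'.symm
      obtain ⟨rfl, rfl⟩ := hO.of_mode hm
      -- The message does not provide `c`, so its occurrence of `c` is a use, and the type is that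
      -- offered by the forwarding process.
      obtain ⟨A', hA'⟩ := (hT.occ hM).resolve_left hec.symm
      obtain ⟨Δ₂, rfl⟩ := Multiset.exists_cons_of_mem hA'
      obtain rfl := ha.agree_msg
      have hM' := hT.ren (d := c) (d' := d) hm' hm
      rw [Multiset.map_cons, CCtx.map_update ha.notMem_used, Function.update_self,
        Function.update_of_ne hec] at hM'
      refine .single (.msg hM' (by omega)) (fun x hx => ?_) ?_ (by simp [Obj.chan])
      · rcases Multiset.mem_cons.1 hx with rfl | hx
        · exact (hb₁ (d, _) (Multiset.mem_cons_self _ _)).trans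
            (hb₂ (c, _) (Multiset.mem_cons_self _ _))
        · exact hb₂ x (Multiset.mem_cons_of_mem hx)
      · simp only [← Multiset.singleton_add]
        abel

/-! ## Spawning -/

/-- This holds for every rank, and is the reason for putting purely linear channels first: shared
processes can be spawned, acquired and released without regard to the ranks of the channels that
they use. -/
theorem below_of_mode {d c : Chan} (hd : d.mode = .R) (hc : c.mode ≠ .R) : Below rank d c :=
  ⟨fun h => absurd h hc, fun h => absurd hd (h.resolve_left hc)⟩

/-- A process `d` spawns the provider of the fresh linear channel `c`. -/
theorem LocalStep.spawn {c d w X P' Q' A C p q} {S U L Δ₁ Δ₂ : CCtx sg}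
    (ha : Ambient fresh Γ₀ {.proc d w X} S U L) (hO : Offer Γ₀ d C S L)
    (hb : ∀ e ∈ U, Below rank e.1 d) (hU : U = Δ₁ + Δ₂) (hf : fresh c)
    (hc : c.mode = .R ∨ c.mode = .C)
    (hP : PTy sg FCtx.empty (sharedFor Γ₀ c) Δ₁.toCtx p P' (.ch c) A)
    (hQ : PTy sg FCtx.empty (sharedFor Γ₀ d) (CCtx.toCtx ((c, A) ::ₘ Δ₂)) q Q' (.ch d) C)
    (hE : p + q + w ≤ E) :
    LocalStep fresh Γ₀ rank E {.proc d w X} {.proc c 0 P', .proc d w Q'} S U L := by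
  subst hU
  have hdc : d ≠ c := by
    rintro rfl
    exact ha.fresh_chan hf (by simp [Obj.chan])
  obtain ⟨rank', h₁, h₂, h₃⟩ := exists_rank_insert rank hdc Δ₁
    (fun e he => ha.fresh_used hf e (Multiset.mem_add.2 (.inl he)))
    (fun e he => hb e (Multiset.mem_add.2 (.inl he)))
    (fun h e he => (hP.inv.modeR h).2 (.ch e.1, e.2) (CCtx.mem_toCtx_ch.2 he))
    (fun h => (hQ.inv.modeR h).2 (.ch c, A) (by simp))
  have hnet := Net.two (e := p) (e' := E - p) (rank := rank')
    (ObjTy.proc (w := 0) hP (Offer.mk_of_mode hc) (by omega)) h₂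
    (ObjTy.proc (w := w) hQ hO (by omega)) (by
      intro e he
      rcases Multiset.mem_cons.1 he with rfl | he
      · exact h₃
      · exact h₁ _ _ (ha.fresh_used hf e (Multiset.mem_add.2 (.inr he))) hdc
          (hb e (Multiset.mem_add.2 (.inr he))))
  rw [show p + (E - p) = E by omega, zero_add] at hnet
  refine .of_net hnet ?_ (fun x y hx hy => h₁ x y ?_ ?_) ?_ ?_
  · rw [← Multiset.singleton_add]; abel
  · rintro rfl; exact hx hf
  · rintro rfl; exact hy hf
  · simpa [Obj.chan] using hdc.symm
  · intro d hd
    simp only [Multiset.insert_eq_cons, Multiset.map_cons, Multiset.map_singleton, Obj.chan,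
      Multiset.mem_cons, Multiset.mem_singleton] at hd ⊢
    rcases hd with rfl | rfl
    · exact .inr (.inl hf)
    · exact .inl rfl

/-- Binding a shared variable to a shared channel. -/
theorem PTy.bind_shared {Γ₁ : CCtx sg} {Ψ Δ q Q d C y a A}
    (h : PTy sg Ψ ((.var y .S, A) ::ₘ sharedFor Γ₀ d) (CCtx.toCtx Δ) q Q (.ch d) C)
    (hd : d.mode ≠ .R) (ha : a.mode = .S) (hmem : (a, A) ∈ Γ₁) (hsub : ∀ e ∈ Γ₀, e ∈ Γ₁)
    (hsup : ∀ e ∈ Γ₁, e = (a, A) ∨ e ∈ Γ₀) :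
    PTy sg Ψ (sharedFor Γ₁ d) Δ.toCtx q (Q.ren (.var y .S) (.ch a)) (.ch d) C := by
  have h' : ∀ Γ : CCtx sg, sharedFor Γ d = Γ.toCtx := fun Γ => by simp [sharedFor, hd]
  have := h.chsub (σ := Function.update id (.var y .S) (.ch a)) (Γ' := sharedFor Γ₁ d)
    (moves_ren ha) ⟨fun e he => ?_, fun e he => ?_, fun e he => .inl (sharedFor_old he)⟩
    fun hR => absurd hR hd
  · rwa [CCtx.sub_ren_var, Function.update_of_ne (by simp)] at this
  · rw [h'] at he ⊢
    rcases Multiset.mem_cons.1 he with rfl | he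
    · simpa using CCtx.mem_toCtx_ch.2 hmem
    · obtain ⟨c, hc, hm⟩ := CCtx.mem_toCtx he
      simpa [hc] using CCtx.mem_toCtx_ch.2 (hsub _ hm)
  · rw [h'] at he
    obtain ⟨c, hc, hm⟩ := CCtx.mem_toCtx he
    rw [hc]
    rcases hsup _ hm with hm | hm
    · obtain ⟨rfl, hA⟩ := Prod.mk.inj hm
      exact ⟨ha, hA ▸ (h.inv.shared _ (Multiset.mem_cons_self _ _)).2⟩
    · exact h.inv.shared (.ch c, e.2) (by simp [h', CCtx.mem_toCtx_ch, hm])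

theorem Net.spawn {c d w k x x' ys zs P as bs Q} (hf : fresh c) (hc : c.mode = k)
    (ha : Ambient fresh Γ₀ {.proc d w (.spawn k x (.proc k x' ys zs P) as bs Q)} Γ U L)
    (h : Net Γ₀ rank E {.proc d w (.spawn k x (.proc k x' ys zs P) as bs Q)} Γ U L) :
    LocalStep fresh Γ₀ rank E {.proc d w (.spawn k x (.proc k x' ys zs P) as bs Q)}
        {.proc c 0 (P.chsub (multi ((.var x' k, .ch c) ::
            ((ys.map (Ref.var · .S)).zip as ++ (zs.map fun z => Ref.var z.1 z.2).zip bs)))),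
         .proc d w (Q.ren (.var x k) (.ch c))} Γ U L := by
  have hdc : d ≠ c := by
    rintro rfl
    exact ha.fresh_chan hf (by simp [Obj.chan])
  obtain ⟨ho, hb⟩ := h.inv_one
  cases ho with
  | proc hP hO he =>
    obtain ⟨q₀, hq, hC⟩ := hP.core
    clear hP
    have hch : ∀ e ∈ sharedFor Γ₀ d, ∃ c, e.1 = .ch c := fun e => sharedFor_old
    -- The linear arguments make up part of a context of run-time channels, so none of them is a
    -- variable.
    have hbs : ∀ {Δ₁ : CCtx sg} {Ds : List (Mode × SType sg)},
        bs.map Ref.mode = Ds.map Prod.fst →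
        ((bs.zip (Ds.map Prod.snd) : List _) : Ctx sg) = Δ₁.toCtx → ∀ b ∈ bs, ∃ c, b = .ch c := by
      intro Δ₁ Ds hm hΔ b hb
      obtain ⟨i, hi, rfl⟩ := List.mem_iff_getElem.1 hb
      have hlen := congrArg List.length hm
      simp only [List.length_map] at hlen
      have hmem : (bs[i], (Ds.map Prod.snd)[i]'(by simpa using hlen ▸ hi)) ∈
          bs.zip (Ds.map Prod.snd) := by
        rw [List.mem_iff_getElem]
        exact ⟨i, by simp; omega, by simp⟩
      rw [← Multiset.mem_coe, hΔ] at hmem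
      obtain ⟨c, hc, -⟩ := CCtx.mem_toCtx hmem
      exact ⟨c, hc⟩
    generalize hΔ : U.toCtx = D at hC
    cases hC with
    | spawnR hi hR hm hs hn hM hQ =>
      obtain ⟨Δ₁, Δ₂, rfl, h₁, rfl⟩ := CCtx.toCtx_eq_list_add hΔ
      obtain ⟨rfl, rfl⟩ := hs.eq_empty
      have hbody := hM.run (bs := bs) (Γ := 0) hc .nil (by simp) (by simp) (hbs hm h₁) hm
        (fun _ => rfl)
      rw [h₁, ← sharedFor_eq_zero (Γ₀ := Γ₀) hc] at hbody
      exact .spawn ha hO hb rfl hf (.inl hc) hbody (hQ.receive_chan hc) (by omega)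
    | spawnC hi hz has hm hs hn hM hQ =>
      obtain ⟨Δ₁, Δ₂, rfl, h₁, rfl⟩ := CCtx.toCtx_eq_list_add hΔ
      obtain ⟨rfl, rfl⟩ := hs.eq_empty
      have hbody := hM.run (bs := bs) hc has hi.shared hch (hbs hm h₁) hm (fun h => by cases h)
      have hsh : sharedFor Γ₀ d = sharedFor Γ₀ c := by
        have : d.mode ≠ .R := by rcases hz with hz | hz <;> exact fun h => by cases h.symm.trans hz
        simp [sharedFor, hc, this]
      rw [h₁, hsh] at hbody
      exact .spawn ha hO hb rfl hf (.inr hc) hbody (hQ.receive_chan hc) (by omega)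
    | @spawnS _ _ _ _ p q _ _ _ _ _ A _ _ _ _ hi hz has hR hm hA hs hn hM hQ =>
      obtain ⟨Δ₁, Δ₂, rfl, h₁, rfl⟩ := CCtx.toCtx_eq_list_add hΔ
      obtain ⟨rfl, rfl⟩ := hs.eq_empty
      have hbody := hM.run (bs := bs) hc has hi.shared hch (hbs hm h₁) hm (fun h => by cases h)
      have hsh : ∀ Γ₁ : CCtx sg, sharedFor Γ₁ d = sharedFor Γ₁ c := by
        intro Γ₁
        have : d.mode ≠ .R := hz
        simp [sharedFor, hc, this]
      have hlang : Lang .S A := (hQ.inv.shared _ (Multiset.mem_cons_self _ _)).2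
      rw [h₁, hsh] at hbody
      obtain ⟨a, rfl⟩ : ∃ a, c = .S a := by cases c <;> cases hc; exact ⟨_, rfl⟩
      have hN : ∀ e ∈ ({(.S a, A)} : CCtx sg), fresh e.1 ∧ e.1.mode = .S ∧ Lang .S e.2 := by
        simpa using ⟨hf, rfl, hlang⟩
      have hmem : (Chan.S a, A) ∈ {(Chan.S a, A)} + Γ₀ := by simp
      have hbody' := hbody.weaken_shared (Γ' := sharedFor ({(.S a, A)} + Γ₀) (.S a))
        (fun e he => by
          have := (mem_sharedFor he).1
          simp [sharedFor, Chan.mode, this])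
        (fun e he => by
          have := (mem_sharedFor he).1
          rw [CCtx.toCtx_add, Multiset.mem_add, CCtx.toCtx_singleton,
            Multiset.mem_singleton] at this
          rcases this with rfl | this
          · exact ⟨rfl, hlang⟩
          · exact hbody.inv.shared e (by simpa [sharedFor, Chan.mode] using this))
        (fun e => sharedFor_old) fun hR => by cases hR
      have hQ' := hQ.bind_shared (Γ₁ := {(.S a, A)} + Γ₀) hz rfl hmem (by simp +contextual)
        (by simp)
      -- The rank need not change: a shared channel is not a linear dependency of anyone, and its
      -- provider uses purely linear channels only.
      have hnet := Net.two (e := p) (e' := E - p) (rank := rank)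
        (ObjTy.proc (w := 0) hbody' (.S hmem hA) (by omega))
        (fun e he => below_of_mode (hbody.inv.modeS rfl _ (CCtx.mem_toCtx_ch.2 he))
          (fun h => by cases h))
        (ObjTy.proc (w := w) hQ' (hO.mono (Multiset.le_add_left _ _)) (by omega))
        (fun e he => hb e (Multiset.mem_add.2 (.inr he)))
      rw [show p + (E - p) = E by omega] at hnet
      refine ⟨_, rank, _, _, hnet, by abel, by simp, hN, fun _ _ _ _ h => h, ?_, ?_⟩
      · simpa [Obj.chan] using hdc.symm
      · intro d hd
        simp only [Multiset.insert_eq_cons, Multiset.map_cons, Multiset.map_singleton, Obj.chan,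
          Multiset.mem_cons, Multiset.mem_singleton] at hd ⊢
        rcases hd with rfl | rfl
        · exact .inr (.inl hf)
        · exact .inl rfl

/-! ## Acquiring and releasing -/

theorem eq_of_nodup_fst {α β : Type*} {s : Multiset (α × β)} (h : (s.map Prod.fst).Nodup)
    {a b b'} (hb : (a, b) ∈ s) (hb' : (a, b') ∈ s) : b = b' := by
  have := Multiset.inj_on_of_nodup_map h _ hb _ hb' rfl
  simpa using this

/-- The acquired type is the one offered, as `Γ₀` declares each channel once. The client comes to
depend on the new linear counterpart, which may be inserted below it because the channels used by
the shared process are purely linear and so already below the client. The shared offer stays in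
place during the linear phase. -/
theorem Net.acquire {a i c w w' x y P Q} (hf : fresh (.L a i))
    (ha : Ambient fresh Γ₀ {.proc (.S a) w' (.accept x (.ch (.S a)) P),
      .proc c w (.acquire y (.ch (.S a)) Q)} Γ U L)
    (h : Net Γ₀ rank E {.proc (.S a) w' (.accept x (.ch (.S a)) P),
      .proc c w (.acquire y (.ch (.S a)) Q)} Γ U L) :
    LocalStep fresh Γ₀ rank E {.proc (.S a) w' (.accept x (.ch (.S a)) P),
      .proc c w (.acquire y (.ch (.S a)) Q)}
      {.proc (.L a i) w' (P.ren (.var x .L) (.ch (.L a i))),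
         .proc c w (Q.ren (.var y .L) (.ch (.L a i)))} Γ U L := by
  have hcL : c ≠ .L a i := by
    rintro rfl
    exact ha.fresh_chan hf (by simp [Obj.chan])
  obtain ⟨Δ₁, e₁, S₁, O₁, Δ₂, e₂, S₂, O₂, ho₁, hb₁, ho₂, hb₂, rfl, rfl, rfl, rfl⟩ := h.inv_two
  cases ho₁ with
  | proc hP hO₁ he₁ =>
  cases ho₂ with
  | proc hQ hO₂ he₂ =>
    obtain ⟨q₁, hq₁, hP⟩ := hP.core
    obtain ⟨q₂, hq₂, hQ⟩ := hQ.core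
    generalize hΔ₁ : Δ₁.toCtx = D₁ at hP
    generalize hΔ₂ : Δ₂.toCtx = D₂ at hQ
    cases hP with
    | upR hi _ hlin _ hP' =>
    cases hQ with
    | upL _ hz hmem _ hQ' =>
      subst hΔ₁ hΔ₂
      cases hO₁ with
      | S hΓ hA =>
      have hA' := hA.up.2
      have hmem' := CCtx.mem_toCtx_ch.1 (mem_sharedFor hmem).1
      obtain rfl := SType.up_inj (eq_of_nodup_fst ha.unique₀ hmem' hΓ)
      have hcR : c.mode ≠ .R := by
        rcases hz with hz | hz <;> exact fun h => by cases h.symm.trans hz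
      have hmR : ∀ e ∈ Δ₁, e.1.mode = .R := fun e he => hlin _ (CCtx.mem_toCtx_ch.2 he)
      obtain ⟨rank', h₁, h₂, h₃⟩ := exists_rank_insert rank hcL Δ₁
        (fun e he => ha.fresh_used hf e (Multiset.mem_add.2 (.inl he)))
        (fun e he => below_of_mode (hmR e he) hcR) (fun h => by cases h) (fun h => absurd h hcR)
      have hP'' := PTy.ren_var (y := x) (m := .L) (e := .L a i) (d := .L a i) (Γ₀ := Γ₀) hP' rfl rfl
      rw [CCtx.sub_ren_var, Function.update_self] at hP''
      have hnet := Net.two (rank := rank') (e := e₁) (e' := e₂)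
        (ObjTy.proc (w := w') hP'' (.L hΓ hA') (by omega)) h₂
        (ObjTy.proc (w := w) (hQ'.receive_chan rfl) hO₂ (by omega)) (by
          intro e he
          rcases Multiset.mem_cons.1 he with rfl | he
          · exact h₃
          · exact h₁ _ _ (ha.fresh_used hf e (Multiset.mem_add.2 (.inr he))) hcL (hb₂ e he))
      refine .of_net hnet ?_ (fun x y hx hy => h₁ x y ?_ ?_) ?_ ?_
      · rw [← Multiset.singleton_add]; abel
      · rintro rfl; exact hx hf
      · rintro rfl; exact hy hf
      · simpa [Obj.chan] using hcL.symm
      · intro d hd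
        simp only [Multiset.insert_eq_cons, Multiset.map_cons, Multiset.map_singleton, Obj.chan,
          Multiset.mem_cons, Multiset.mem_singleton] at hd ⊢
        rcases hd with rfl | rfl
        · exact .inr (.inl hf)
        · exact .inl (.inr rfl)

/-- Equi-synchronization identifies the type after the release with the declared type of `S a`. So
the provider resumes its shared phase with the same shared offer, and the client's variable is bound
to a channel already in `Γ₀`. One dependency disappears, and the rank can be kept. -/
theorem Net.release {a i c w w' x y P Q}
    (ha : Ambient fresh Γ₀ {.proc (.L a i) w' (.detach x (.ch (.L a i)) P),
      .proc c w (.release y (.ch (.L a i)) Q)} Γ U L)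
    (h : Net Γ₀ rank E {.proc (.L a i) w' (.detach x (.ch (.L a i)) P),
      .proc c w (.release y (.ch (.L a i)) Q)} Γ U L) :
    LocalStep fresh Γ₀ rank E {.proc (.L a i) w' (.detach x (.ch (.L a i)) P),
      .proc c w (.release y (.ch (.L a i)) Q)}
      {.proc (.S a) w' (P.ren (.var x .S) (.ch (.S a))),
         .proc c w (Q.ren (.var y .S) (.ch (.S a)))} Γ U L := by
  obtain ⟨Δ₁, e₁, S₁, O₁, Δ₂, e₂, S₂, O₂, ho₁, hb₁, ho₂, hb₂, rfl, rfl, rfl, rfl⟩ := h.inv_two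
  cases ho₁ with
  | proc hP hO₁ he₁ =>
  cases ho₂ with
  | proc hQ hO₂ he₂ =>
    obtain ⟨q₁, hq₁, hP⟩ := hP.core
    obtain ⟨q₂, hq₂, hQ⟩ := hQ.core
    generalize hΔ : Δ₂.toCtx = D at hQ
    generalize hΔ₁ : Δ₁.toCtx = D₁ at hP
    cases hP with
    | downR hi _ hlin _ hP' =>
    cases hQ with
    | downL _ _ hz _ hQ' =>
      subst hΔ₁
      obtain ⟨d, Δ₂, hd, rfl, rfl⟩ := CCtx.toCtx_eq_cons hΔ
      cases hd
      cases hO₁ with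
      | L hΓ hA =>
      obtain ⟨rfl, hA'⟩ := hA.down
      obtain rfl := SType.down_inj ha.agree_msg
      have hcR : c.mode ≠ .R := by
        rcases hz with hz | hz <;> exact fun h => by cases h.symm.trans hz
      have hcS : c ≠ .S a := by rintro rfl; rcases hz with hz | hz <;> cases hz
      have hP'' := PTy.ren_var (y := x) (m := .S) (e := .S a) (d := .S a) (Γ₀ := Γ₀) hP' rfl rfl
      rw [CCtx.sub_ren_var, Function.update_self] at hP''
      have hQ' := hQ'.bind_shared (a := .S a) (Γ₁ := Γ₀) hcR rfl hΓ (fun _ h => h)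
        (fun _ h => .inr h)
      have hnet := Net.two (rank := rank) (e := e₁) (e' := e₂)
        (ObjTy.proc (w := w') hP'' (.S hΓ hA') (by omega))
        (fun e he => below_of_mode (hlin _ (CCtx.mem_toCtx_ch.2 he)) (fun h => by cases h))
        (ObjTy.proc (w := w) hQ' hO₂ (by omega))
        (fun e he => hb₂ e (Multiset.mem_cons_of_mem he))
      refine .of_net hnet ?_ (fun x y hx hy h => h) ?_ ?_
      · rw [← Multiset.singleton_add]; abel
      · simpa [Obj.chan] using hcS.symm
      · intro d hd
        simp only [Multiset.insert_eq_cons, Multiset.map_cons, Multiset.map_singleton, Obj.chan,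
          Multiset.mem_cons, Multiset.mem_singleton] at hd ⊢
        rcases hd with rfl | rfl
        · exact .inr (.inr (by simp))
        · exact .inl (.inr rfl)


/-! ## Type preservation -/

theorem Red.local (hsg : sg.WF) {Ω Ω' : Config} (hr : Red sg fresh Ω Ω')
    (ha : Ambient fresh Γ₀ Ω Γ U L) (h : Net Γ₀ rank E Ω Γ U L) :
    LocalStep fresh Γ₀ rank E Ω Ω' Γ U L := by
  cases hr with
  | internalSpawn hM => exact h.internal_spawn hsg hM
  | internalSend hM => exact h.internal_send hsg hM
  | spawn hf hc => exact Net.spawn hf hc ha h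
  | fwdPos => exact Net.fwd_msg ha h
  | fwdNeg hec hM => exact Net.msg_fwd hec hM ha h
  | ichoiceS hf hc => exact Net.ichoice_send hf hc ha h
  | ichoiceC hd hl => exact Net.ichoice_recv hd hl ha h
  | echoiceS hd hf hc => exact Net.echoice_send hd hf hc ha h
  | echoiceC hl => exact Net.echoice_recv hl ha h
  | tensorS hf hc => exact Net.tensor_send hf hc ha h
  | tensorC hd => exact Net.tensor_recv hd ha h
  | lolliS hd hf hc => exact Net.lolli_send hd hf hc ha h
  | lolliC => exact Net.lolli_recv ha h
  | timesS hf hc hN => exact Net.times_send hf hc hN ha h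
  | timesC hd => exact Net.times_recv hd ha h
  | arrowS hd hf hc hN => exact Net.arrow_send hd hf hc hN ha h
  | arrowC => exact Net.arrow_recv ha h
  | oneS => exact h.close_send
  | oneC hd => exact Net.close_recv ha h
  | work => exact h.work
  | payS hf hc => exact Net.pay_send hf hc ha h
  | payC hd => exact Net.pay_recv hd ha h
  | getS hd hf hc => exact Net.get_send hd hf hc ha h
  | getC => exact Net.get_recv ha h
  | up hf => exact Net.acquire hf ha h
  | down => exact Net.release ha h

theorem occurs_of_chan {Ω : Config} {c} (h : c ∈ Ω.map Obj.chan) : Occurs c Ω := by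
  obtain ⟨o, ho, rfl⟩ := Multiset.mem_map.1 h
  refine ⟨o, ho, ?_⟩
  cases o <;> exact .inl rfl

/-- The set `N` of excluded channels stays fixed while `Γ₀` grows along a computation. The invariant
`hN` compensates: a declared channel outside `N` is on offer, so it or a linear counterpart occurs
in the configuration and it cannot be chosen as fresh. -/
theorem WellTyped.step (hsg : sg.WF) {N : Set Chan} {Ω Ω' : Config} {Δ : CCtx sg}
    (h : WellTyped sg Γ₀ E Ω Γ Δ) (hN : ∀ e ∈ Γ₀, e.1 ∈ N ∨ e.1 ∈ Γ.map Prod.fst)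
    (hs : Step sg N Ω Ω') :
    ∃ Γ₀' Γ', WellTyped sg Γ₀' E Ω' Γ' Δ ∧ Γ₀ ≤ Γ₀' ∧ Γ ≤ Γ' ∧
      ∀ e ∈ Γ₀', e.1 ∈ N ∨ e.1 ∈ Γ'.map Prod.fst := by
  obtain ⟨D, R, R', rfl, rfl, hr⟩ := hs
  obtain ⟨rank, U, hnet⟩ := h.typed.toNet h.providers
  have hlin := hnet.linear_le
  have hnodup : ((U + Δ).map Prod.fst).Nodup := Multiset.nodup_of_le hlin h.providers
  have hshared : ∀ {c}, Fresh N (D + R) c → ∀ e ∈ Γ₀, e.1 ≠ c := by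
    rintro c ⟨hcN, hocc, hL⟩ e he rfl
    rcases hN e he with hmem | hmem
    · exact hcN hmem
    · obtain ⟨a, ha, hS | ⟨i, hi⟩⟩ := hnet.mem_shared hmem
      · exact hocc (ha ▸ occurs_of_chan hS)
      · exact hL a i ha (occurs_of_chan hi)
  have hchan : ∀ {c}, Fresh N (D + R) c → c ∉ (D + R).map Obj.chan :=
    fun hf hc => hf.2.1 (occurs_of_chan hc)
  have hused : ∀ {c}, Fresh N (D + R) c → ∀ e ∈ U, e.1 ≠ c := by
    rintro c hf e he rfl
    exact hchan hf (Multiset.mem_of_le hlin (Multiset.mem_map_of_mem Prod.fst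
      (Multiset.mem_add.2 (.inl he))))
  have hprov := h.providers
  obtain ⟨E₁, Γ₁, U₁, L₁, E₂, Γ₂, U₂, L₂, h₁, h₂, rfl, rfl, rfl, hL⟩ := hnet.split
  have hΓ := h.uniqueS
  rw [Multiset.map_add, Multiset.nodup_add] at hprov hΓ
  have ha : Ambient (Fresh N (D + R)) Γ₀ R Γ₂ U₂ L₂ := by
    refine ⟨?_, ?_, hprov.2.1, h.unique₀, ?_, ?_⟩
    · rw [Multiset.map_add, Multiset.map_add, Multiset.nodup_add, Multiset.nodup_add] at hnodup
      exact hnodup.1.2.1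
    -- The total offer equals `U + Δ`, in which each channel occurs once; both entries belong to it.
    · intro c A A' hA hA'
      refine eq_of_nodup_fst hnodup (a := c) (by simp [hA]) ?_
      rw [hL]
      simp [hA']
    · exact fun hf e he => hused hf e (Multiset.mem_add.2 (.inr he))
    · exact fun hf hc => hchan hf (by rw [Multiset.map_add]; exact Multiset.mem_add.2 (.inr hc))
  obtain ⟨N', rank', U', L', hnet', hb, hN', hfresh, hrank, hR', hch⟩ := hr.local hsg ha h₂
  have hD := (h₁.weaken N' fun e he => (hfresh e he).2).rank_congr (rank' := rank')
    fun d hd c hc hbelow => hrank d.1 c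
      (fun hf => hused hf d (Multiset.mem_add.2 (.inl hd)) rfl)
      (fun hf => hchan hf (by rw [Multiset.map_add]; exact Multiset.mem_add.2 (.inl hc))) hbelow
  have hall := hD.join hnet'
  -- The local balance `U' + L₂ = U₂ + L'` transfers the global one to the new configuration; adding
  -- `U₂` on both sides avoids subtraction of multisets.
  have hbal : L₁ + L' = U₁ + U' + Δ := by
    refine add_right_cancel (b := U₂) ?_
    calc L₁ + L' + U₂ = L₁ + (U₂ + L') := by abel
      _ = L₁ + (U' + L₂) := by rw [hb]
      _ = L₁ + L₂ + U' := by abel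
      _ = U₁ + U₂ + Δ + U' := by rw [hL]
      _ = U₁ + U' + Δ + U₂ := by abel
  rw [hbal] at hall
  have hdisj : ∀ {e f : Chan × SType sg}, e ∈ N' → f ∈ Γ₀ → e.1 ≠ f.1 := fun he hf heq =>
    hshared (hfresh _ he).1 _ hf heq.symm
  have hunique₀ : ((N' + Γ₀).map Prod.fst).Nodup := by
    rw [Multiset.map_add, Multiset.nodup_add]
    refine ⟨hN', h.unique₀, Multiset.disjoint_left.2 fun {c} hc hc' => ?_⟩
    obtain ⟨e, he, rfl⟩ := Multiset.mem_map.1 hc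
    obtain ⟨f, hf, hef⟩ := Multiset.mem_map.1 hc'
    exact hdisj he hf hef.symm
  have hsub : Γ₁ + (N' + Γ₂) ≤ N' + Γ₀ := by
    rw [add_left_comm]
    exact add_le_add_right h.sub N'
  refine ⟨N' + Γ₀, Γ₁ + (N' + Γ₂), ⟨hall.toCTy, ?_, hunique₀, ?_, h.uniqueL, hsub⟩,
    Multiset.le_add_left _ _, ?_, ?_⟩
  · rw [Multiset.map_add, Multiset.nodup_add]
    refine ⟨hprov.1, hR', Multiset.disjoint_left.2 fun {c} hc hc' => ?_⟩
    rcases hch c hc' with hc' | hf | hmem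
    · exact Multiset.disjoint_left.1 hprov.2.2 hc hc'
    · exact hchan hf (by rw [Multiset.map_add]; exact Multiset.mem_add.2 (.inl hc))
    -- After a release the provided channel `S a` is not fresh. It was already in the shared offer
    -- of the rewritten part, and shared offers are unique, so no other object provides it.
    · obtain ⟨a, rfl, -⟩ := h₂.mem_shared hmem
      exact Multiset.disjoint_left.1 hΓ.2.2 (h₁.shared_of_mode hc rfl) hmem
  · exact Multiset.nodup_of_le (Multiset.map_le_map hsub) hunique₀
  · rw [add_left_comm]
    exact Multiset.le_add_left _ _
  · intro e he
    rcases Multiset.mem_add.1 he with he | he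
    · refine .inr (Multiset.mem_map_of_mem Prod.fst ?_)
      simp [he]
    · refine (hN e he).imp_right fun hm => ?_
      obtain ⟨f, hf, hef⟩ := Multiset.mem_map.1 hm
      refine Multiset.mem_map.2 ⟨f, ?_, hef⟩
      rcases Multiset.mem_add.1 hf with hf | hf <;> simp [hf]

/-- Each object contributes its work plus a natural number to the energy. -/
theorem CTy.totalWork_le {Ω : Config} {Δ : CCtx sg} (h : CTy sg Γ₀ E Ω Γ Δ) :
    totalWork Ω ≤ E := by
  induction h with
  | emp => simp [totalWork]
  | procR | procS | procL | procC | msg =>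
    simp only [totalWork, Multiset.map_cons, Multiset.sum_cons, Obj.workDone] at *
    omega

theorem WellTyped.steps (hsg : sg.WF) {N : Set Chan} {Ω Ω' : Config} {Δ : CCtx sg}
    (h : WellTyped sg Γ₀ E Ω Γ Δ) (hN : ∀ e ∈ Γ₀, e.1 ∈ N ∨ e.1 ∈ Γ.map Prod.fst)
    (hs : Relation.ReflTransGen (Step sg N) Ω Ω') :
    ∃ Γ₀' Γ', WellTyped sg Γ₀' E Ω' Γ' Δ ∧ ∀ e ∈ Γ₀', e.1 ∈ N ∨ e.1 ∈ Γ'.map Prod.fst := by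
  induction hs with
  | refl => exact ⟨Γ₀, Γ, h, hN⟩
  | tail _ hs ih =>
    obtain ⟨Γ₁, Γ', h', hN'⟩ := ih
    obtain ⟨Γ₂, Γ'', h'', -, -, hN''⟩ := h'.step hsg hN' hs
    exact ⟨Γ₂, Γ'', h'', hN''⟩

end Nomos


theorem theorem1 (sg : Sig) (hsg : sg.WF) :
    (∀ (q : ℕ) (M : Expr) (τ : FType sg) (V : Expr) (μ : ℕ),
      ETy sg FCtx.empty q M τ → Eval sg M V μ →
        IsVal V ∧ μ ≤ q ∧ ETy sg FCtx.empty (q - μ) V τ) ∧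
    (∀ (Γ₀ : CCtx sg) (E : ℕ) (Ω : Config) (Γ Δ : CCtx sg), WellTyped sg Γ₀ E Ω Γ Δ →
      (∀ Ω' : Config, Step sg Γ₀.names Ω Ω' →
        ∃ Γ₀' Γ' : CCtx sg, WellTyped sg Γ₀' E Ω' Γ' Δ ∧ Γ₀ ≤ Γ₀' ∧ Γ ≤ Γ') ∧
      (∀ Ω' : Config, Relation.ReflTransGen (Step sg Γ₀.names) Ω Ω' → totalWork Ω' ≤ E)) := by
  constructor
  · intro q M τ V μ hM hV
    obtain ⟨hval, r, hr, hT⟩ := hV.preservation hsg hM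
    exact ⟨hval, by omega, hT.relax (by omega)⟩
  · intro Γ₀ E Ω Γ Δ h
    -- At the start all declared channels are excluded explicitly; the second alternative is needed
    -- only for those declared later.
    have hN : ∀ e ∈ Γ₀, e.1 ∈ Γ₀.names ∨ e.1 ∈ Γ.map Prod.fst := fun e he => .inl ⟨e.2, he⟩
    refine ⟨fun Ω' hs => ?_, fun Ω' hs => ?_⟩
    · obtain ⟨Γ₀', Γ', h', h₀, h₁, -⟩ := h.step hsg hN hs
      exact ⟨Γ₀', Γ', h', h₀, h₁⟩
    · obtain ⟨_, _, h', -⟩ := h.steps hsg hN hs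
      exact h'.typed.totalWork_le
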